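/- **The submodular matroid secretary problem with shortlists.** Let $U$ be a finite set of $n$ items, $\mathcal M$ a matroid on $U$ of rank $k\ge 1$ with independent sets $\mathcal I$, and $f:2^U\to\mathbb R_{\ge 0}$ a monotone submodular function. The items arrive one by one in a uniformly random order. The algorithm knows $n$ and $k$, and may query $f$ and membership in $\mathcal I$ through oracles. In each round it irrevocably decides whether to put the arriving item on a shortlist $A$. At the end it outputs a set $A^*\subseteq A$ with $A^*\in\mathcal I$. Let $\mathrm{OPT}=\max\{f(S): S\subseteq U,\ S\in\mathcal I\}$ and $\mathrm{ALG}=\mathbb E\big[\max\{f(S): S\subseteq A,\ S\in\mathcal I\}\big]$, where the expectation is over the arrival order and the algorithm's random choices. **The algorithm.** For $S\in\mathcal I$ and an item $e$, let $\theta(e,S)$ be a choice of at most one element of $S$ such that $S+e-\theta(e,S)\in\mathcal I$ and $f(S+e-\theta(e,S))$ is as large as possible (items $e$ for which there is no such choice are ignored), and let $g(e,S)=f(S+e-\theta(e,S))-f(S)$. Items of equal $g$-value are compared by a fixed linear order on $U$. The parameters are $\varepsilon\in(0,1]$ and an integer $\beta\ge1$ that depends only on $\varepsilon$; put $\delta=\varepsilon/2$.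 1. Throw $n$ balls independently and uniformly into $k\beta$ bins, and divide the arrival positions $1,\dots,n$ into $k\beta$ slots of consecutive positions, the size of each slot being the load of the corresponding bin. Start with $SH=\emptyset$, $R=\emptyset$, $A=\emptyset$. 2. For each slot $s$ in turn: * Draw a sample $R'\subseteq R$ that contains each element of $R$ with probability $1/(k\beta)$. (There is an array with one cell for each slot, the element added to $R$ in a slot is kept in the cell of that slot, and $R'$ is the content of a uniformly random cell.) * Run the online max algorithm on the $N$ items of the slot with the values $g(\cdot,SH)$: put the $i$-th item of the slot on the shortlist if its value is better than the values of all earlier items of the slot, $i\ge N\delta/2$, and fewer than $4\ln(2/\delta)$ items of the slot have been put on the shortlist so far. Let $M_s$ be the set of the items of the slot put on the shortlist. * Let $m_s$ be the best element of $s\cup R'$ with respect to $g(\cdot,SH)$, and $o_s=\theta(m_s,SH)$. If $f(SH+m_s-o_s)>f(SH)$, replace $SH$ by $SH+m_s-o_s$, and add $m_s$ to $R$ if $m_s\in M_s$. 3. Output $A^*=SH\cap R$. The shortlist is $A=\bigcup_s M_s$. **Theorem.** There is an absolute constant $C$ such that for every $0<\varepsilon\le 1$ there are an integer $\beta\ge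 1$ and a constant $K$, both depending only on $\varepsilon$, such that the following holds for all $n$, $k\ge1$, $U$, $\mathcal M$ and $f$ as above. * For every arrival order and every outcome of the random choices, the shortlist has size $|A|\le C\,\frac{k}{\varepsilon}\,\ln\frac{2}{\varepsilon}$ (so it is $\tilde O(k/\varepsilon)$), the algorithm makes at most $K\,n\,k$ steps (oracle calls, arrivals, selections and elementary operations; so it runs in time $O(nk)$ for constant $\varepsilon$), $A^*\subseteq A$, and $A^*\in\mathcal I$. * The competitive ratio is at least $\frac12\left(1-\frac1{e^2}-\varepsilon\right)$: $$\mathbb E[f(A^*)]\ \ge\ \tfrac12\Big(1-\tfrac1{e^2}-\varepsilon\Big)\,\mathrm{OPT},\qquad\text{and}\qquad \mathrm{ALG}\ \ge\ \tfrac12\Big(1-\tfrac1{e^2}-\varepsilon\Big)\,\mathrm{OPT}.$$ -/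

import Mathlib

open Finset
open scoped BigOperators

/-! ### Online computations with a value oracle and an independence oracle -/

/-- Programs in the shortlist model on items of type `α`, with a result of type `β`.
* `value S k`: ask the value oracle for `f S`;
* `indep S k`: ask the independence oracle whether `S` is independent;
* `next k`: move on to the next round and look at the arriving item (`none` if there is none);
* `select k`: put the item that arrived last on the shortlist. There is no instruction that takes
  an item off the shortlist, and after `next` a passed item cannot be put on it any more;
* `tick t k`: perform `t` further elementary operations (comparisons, updates, random draws). -/
inductive OnlineProg (α : Type) (β : Type) : Type
  | ret (b : β) : OnlineProg α β
  | value (S : Finset α) (k : ℝ → OnlineProg α β) : OnlineProg α β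
  | indep (S : Finset α) (k : Bool → OnlineProg α β) : OnlineProg α β
  | next (k : Option α → OnlineProg α β) : OnlineProg α β
  | select (k : OnlineProg α β) : OnlineProg α β
  | tick (t : ℕ) (k : OnlineProg α β) : OnlineProg α β

namespace OnlineProg

variable {α β γ : Type}

/-- Sequential composition. -/
def bind : OnlineProg α β → (β → OnlineProg α γ) → OnlineProg α γ
  | ret b, q => q b
  | value S k, q => value S fun v => bind (k v) q
  | indep S k, q => indep S fun b => bind (k b) q
  | next k, q => next fun e => bind (k e) q
  | select k, q => select (bind k q)
  | tick t k, q => tick t (bind k q)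

instance : Monad (OnlineProg α) where
  pure := ret
  bind := bind

/-- Ask for the value of `S`. -/
def askValue (S : Finset α) : OnlineProg α ℝ := value S ret

/-- Ask whether `S` is independent. -/
def askIndep (S : Finset α) : OnlineProg α Bool := indep S ret

/-- See the next arriving item. -/
def nextItem : OnlineProg α (Option α) := next ret

/-- Put the item that arrived last on the shortlist. -/
def selectCurrent : OnlineProg α Unit := select (ret ())

/-- Spend `t` elementary operations. -/
def ticks (t : ℕ) : OnlineProg α Unit := tick t (ret ())

/-- The state of a run: the items still to arrive (in order), the item that arrived last, the
current shortlist, and the number of steps made so far. -/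
structure RunState (α : Type) where
  upcoming : List α
  current : Option α
  shortlist : Finset α
  steps : ℕ

open Classical in
/-- Executing a program when the oracles answer for the function `f` and the matroid `M`. Each
oracle call, each arrival and each selection is one step; `tick t` is `t` steps. -/
noncomputable def run (M : Matroid α) (f : Finset α → ℝ) :
    OnlineProg α β → RunState α → β × RunState α
  | ret b, s => (b, s)
  | value S k, s => run M f (k (f S)) { s with steps := s.steps + 1 }
  | indep S k, s => run M f (k (decide (M.Indep (S : Set α)))) { s with steps := s.steps + 1 }
  | next k, s =>
      run M f (k s.upcoming.head?)
        { s with upcoming := s.upcoming.tail, current := s.upcoming.head?, steps := s.steps + 1 }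
  | select k, s =>
      run M f k
        { s with shortlist := s.shortlist ∪ s.current.toFinset, steps := s.steps + 1 }
  | tick t k, s => run M f k { s with steps := s.steps + t }

end OnlineProg

/-! ### The algorithm -/

namespace MatroidShortlist

open OnlineProg

noncomputable section

variable {α : Type} [LinearOrder α]

/-- One candidate set `T = S + e - e'` in the search for `θ(e, S)`; `best` is the best feasible
candidate so far, given by its `f`-value and the removed element (`none` for no removal). -/
def trySwap (T : Finset α) (removed : Option α) (best : Option (ℝ × Option α)) :
    OnlineProg α (Option (ℝ × Option α)) := do
  ticks 1
  let feasible ← askIndep T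
  if feasible then do
    let v ← askValue T
    ticks 1
    match best with
    | none => return some (v, removed)
    | some (w, r) => if w < v then return some (v, removed) else return some (w, r)
  else return best

/-- Try to remove each of the elements in the list from `S + e`. -/
def trySwaps (e : α) (S : Finset α) :
    List α → Option (ℝ × Option α) → OnlineProg α (Option (ℝ × Option α))
  | [], best => return best
  | x :: l, best => do
      let best' ← trySwap ((insert e S).erase x) (some x) best
      trySwaps e S l best'

/-- `θ(e, S)`, together with `f (S + e - θ(e, S))`: the best independent set among `S + e` and
`S + e - e'`, `e' ∈ S`. The answer is `none` if there is no independent one. -/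
def bestSwap (e : α) (S : List α) : OnlineProg α (Option (ℝ × Option α)) := do
  let best ← trySwap (insert e S.toFinset) none none
  trySwaps e S.toFinset S best

/-- An item `e` with `gain = g(e, S)` and `removed = θ(e, S)`. -/
structure Candidate (α : Type) where
  gain : ℝ
  item : α
  removed : Option α

/-- Comparison by gain. Ties are broken by the fixed linear order on the items. -/
def Candidate.beats (c : Candidate α) : Option (Candidate α) → Bool
  | none => true
  | some d => decide (d.gain < c.gain ∨ (d.gain = c.gain ∧ d.item < c.item))

/-- Computing `g(e, S) = f (S + e - θ(e, S)) - f S`, where `fS = f S` is already known. -/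
def evaluate (S : List α) (fS : ℝ) (e : α) : OnlineProg α (Option (Candidate α)) := do
  let r ← bestSwap e S
  match r with
  | none => return none
  | some (v, o) => return some ⟨v - fS, e, o⟩

/-- The main loop of the online max algorithm: `r` items are still to be read, the next one is
the `i`-th of its slot, `best` is the best item of the slot so far, and `A` is the list of items
that have been selected. -/
def onlineMaxLoop (S : List α) (fS u L : ℝ) :
    (r i : ℕ) → Option (Candidate α) → List α → OnlineProg α (Option (Candidate α) × List α)
  | 0, _, best, A => return (best, A)
  | r + 1, i, best, A => do
      let arriving ← nextItem
      match arriving with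
      | none => return (best, A)
      | some e => do
          let c? ← evaluate S fS e
          ticks 1
          match c? with
          | none => onlineMaxLoop S fS u L r (i + 1) best A
          | some c =>
              if c.beats best then
                if u ≤ (i : ℝ) ∧ (A.length : ℝ) < L then do
                  selectCurrent
                  onlineMaxLoop S fS u L r (i + 1) (some c) (e :: A)
                else onlineMaxLoop S fS u L r (i + 1) (some c) A
              else onlineMaxLoop S fS u L r (i + 1) best A

/-- The online max algorithm with error parameter `δ` on the next `N` arriving items, for the
values `g(·, S)`: from position `N δ / 2` on, select each item that is better than all the
earlier ones, as long as fewer than `4 ln (2 / δ)` items have been selected. It returns the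
maximum and the list of the selected items. -/
def onlineMax (S : List α) (fS : ℝ) (N : ℕ) (δ : ℝ) :
    OnlineProg α (Option (Candidate α) × List α) :=
  onlineMaxLoop S fS (N * δ / 2) (4 * Real.log (2 / δ)) N 1 none []

/-- The better one of the maximum over the slot and the maximum over the sampled set `R'`. -/
def merge (a b : Option (Candidate α)) : Option (Candidate α) :=
  match b with
  | none => a
  | some c => if c.beats a then some c else a

/-- `S + m - o`. -/
def exchange (S : List α) (c : Candidate α) : List α :=
  match c.removed with
  | none => c.item :: S
  | some o => c.item :: S.erase o

/-- The slots `s` in the given list, one after the other. `X s` is the number of items of the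
slot `s`. The set `R` is stored in an array with one cell for each of the `m = k β` slots: the
cell of a slot holds the item that was added to `R` in this slot, if there is one. `J s` is a
uniformly random cell, and `R'` is what the cell `J s` holds at the beginning of the slot `s`.
So `R'` contains each element of `R` with probability `1 / (k β)`, and it has `|R| / (k β)`
elements in expectation. The current solution is the list `SH`. -/
def slots {m : ℕ} (δ : ℝ) (X : Fin m → ℕ) (J : Fin m → Fin m) :
    List (Fin m) → (SH : List α) → (R : Fin m → Option α) →
      OnlineProg α (List α × (Fin m → Option α))
  | [], SH, R => return (SH, R)
  | s :: l, SH, R => do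
      ticks 1
      let fSH ← askValue SH.toFinset
      let sampled ← (match R (J s) with
        | none => return none
        | some x => evaluate SH fSH x : OnlineProg α (Option (Candidate α)))
      let (best, A) ← onlineMax SH fSH (X s) δ
      ticks 2
      match merge best sampled with
      | none => slots δ X J l SH R
      | some c =>
          if 0 < c.gain then do
            ticks (SH.length + A.length + 2)
            slots δ X J l (exchange SH c)
              (if c.item ∈ A then Function.update R s (some c.item) else R)
          else slots δ X J l SH R

/-- The random choices of the algorithm: a slot for each of the `n` balls, and a cell of the array
for each of the `m` slots. They are independent and uniformly distributed. -/
abbrev Coins (n m : ℕ) : Type := (Fin n → Fin m) × (Fin m → Fin m)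

/-- The submodular matroid secretary algorithm with shortlists, for `n` items, rank `k`, accuracy
`ε` and parameter `β`. The indices `1, …, n` are divided into `k β` slots of consecutive indices,
whose sizes are the bin loads when `n` balls are thrown into `k β` bins. -/
def algorithm (n k β : ℕ) (ε : ℝ) (c : Coins n (k * β)) : OnlineProg α (Finset α) := do
  ticks (n + 2 * (k * β))
  let (SH, R) ← slots (ε / 2) (fun j => #{i | c.1 i = j}) c.2 (List.finRange (k * β)) []
    (fun _ => none)
  ticks (SH.length * (k * β))
  return SH.toFinset.filter fun x => ∃ j, R j = some x

variable [Fintype α]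

/-- The items arrive in the order `σ 0, σ 1, …`. -/
def execute (M : Matroid α) (f : Finset α → ℝ) (k β : ℕ) (ε : ℝ)
    (σ : Fin (Fintype.card α) ≃ α) (c : Coins (Fintype.card α) (k * β)) :
    Finset α × RunState α :=
  (algorithm (Fintype.card α) k β ε c).run M f ⟨(List.finRange _).map σ, none, ∅, 0⟩

/-- The output `A*` of the algorithm. -/
def output (M : Matroid α) (f : Finset α → ℝ) (k β : ℕ) (ε : ℝ)
    (σ : Fin (Fintype.card α) ≃ α) (c : Coins (Fintype.card α) (k * β)) : Finset α :=
  (execute M f k β ε σ c).1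

/-- The shortlist `A` at the end of the `n` rounds. -/
def shortlist (M : Matroid α) (f : Finset α → ℝ) (k β : ℕ) (ε : ℝ)
    (σ : Fin (Fintype.card α) ≃ α) (c : Coins (Fintype.card α) (k * β)) : Finset α :=
  (execute M f k β ε σ c).2.shortlist

/-- The running time. -/
def runningTime (M : Matroid α) (f : Finset α → ℝ) (k β : ℕ) (ε : ℝ)
    (σ : Fin (Fintype.card α) ≃ α) (c : Coins (Fintype.card α) (k * β)) : ℕ :=
  (execute M f k β ε σ c).2.steps

end

end MatroidShortlist

/-! ### The objective -/

/-- Submodular set functions. -/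
def IsSubmodular {α : Type} [DecidableEq α] (f : Finset α → ℝ) : Prop :=
  ∀ S T : Finset α, f (S ∪ T) + f (S ∩ T) ≤ f S + f T

open Classical in
/-- The maximum of `f S` over the independent sets `S ⊆ A`. -/
noncomputable def maxIndepValue {α : Type} (M : Matroid α) (f : Finset α → ℝ)
    (A : Finset α) : ℝ :=
  (A.powerset.filter fun S : Finset α => M.Indep (S : Set α)).sup' ⟨∅, by simp⟩ f

/-!
The proof follows the current solution `SH`, whose expected value grows in each of the `m = k β`
slots by about the fraction `2 / m` of its distance to `OPT / 2`, and then compares it with the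
output `SH ∩ R`.

*Local search.* If `S` and `T` are independent, then by Hall's theorem the elements of `T` that
depend on `S` can be exchanged into `S` for pairwise distinct elements of `S`
(`exists_exchange_injOn`). With submodularity this gives `f T - 2 f S ≤ ∑ e ∈ T, g (e, S)`
(`sub_two_mul_le_sum_gainOf`).

*Independence of the slots.* Cutting a random arrival order into slots with the loads of random
bins amounts to assigning the items to the slots independently and uniformly, and ordering the
items of each slot independently (`expect_blocks_eq_expect_slotItems`). The run of the algorithm
then becomes a deterministic process that depends on the orders only through the successes of the
online max algorithm, that is, on whether it selects the best item of the slot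
(`outputOf_eq_keptItems`). It fails with probability at most `3 δ / 4`, because a record occurs at
position `i` with probability at most `1 / i`, so that the number of selected items has a small
exponential moment (`expect_misses_le`).

*Progress in one slot.* Instead of conditioning on the history, the argument changes single
coordinates of the random choices. An item that arrived in an earlier successful slot and was not
added to the array could as well have arrived in the present slot without changing the history
(`process_move`); an item in the array is sampled with probability `1 / m`. So each item of an
optimal set is available with probability about `1 / m`, also when it is weighted by the surplus of
its gain over the gains of the other available items (`expect_surplus_le`). Surpluses of available
items add up to at most the largest gain (`sum_sub_sup_erase_le`), which makes this bound additive
over the optimal set; replacing the gains by the surpluses costs at most `k` times the gain of the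
slot, hence only a factor `1 + 1 / β`. The outcome is the recurrence `expect_value_succ`.

*Output.* Whether an item of the final solution was selected when it arrived has no influence on
the solution as long as the item stays in it (`process_outcome_irrelevant`). So each item of the
final solution is lost with probability at most `3 δ / 4`, also conditionally on the final
solution (`expect_not_kept_le`), and a submodular function loses at most this fraction of its value
on average (`IsSubmodular.one_sub_mul_expect_le`). For `β ≥ 100 / ε` all the losses add up to less
than `ε` (`ratio_le`).
-/

open scoped NNReal

/-! ### Running programs, and the search for the best exchange -/

namespace OnlineProg

variable {α β γ : Type} (M : Matroid α) (f : Finset α → ℝ)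

theorem run_bind (p : OnlineProg α β) (q : β → OnlineProg α γ) (s : RunState α) :
    (p >>= q).run M f s = (q (p.run M f s).1).run M f (p.run M f s).2 := by
  show (p.bind q).run M f s = _
  induction p generalizing s with
  | ret b => rfl
  | value S k ih => exact ih _ _
  | indep S k ih => exact ih _ _
  | next k ih => exact ih _ _
  | select k ih => exact ih _
  | tick t k ih => exact ih _

/-- The program `p` computes the value `b` without touching the arrivals or the shortlist, in at
most `T` steps. -/
def Computes (p : OnlineProg α β) (b : β) (T : ℕ) : Prop :=
  ∀ s : RunState α, ∃ t ≤ T, p.run M f s = (b, { s with steps := s.steps + t })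

variable {M f}

theorem Computes.bind {p : OnlineProg α β} {q : β → OnlineProg α γ} {b : β} {c : γ} {T T' : ℕ}
    (hp : Computes M f p b T) (hq : Computes M f (q b) c T') :
    Computes M f (p >>= q) c (T + T') := by
  intro s
  obtain ⟨t, ht, h⟩ := hp s
  obtain ⟨t', ht', h'⟩ := hq { s with steps := s.steps + t }
  refine ⟨t + t', by omega, ?_⟩
  rw [run_bind, h, h', add_assoc]

theorem Computes.mono {p : OnlineProg α β} {b : β} {T T' : ℕ} (hp : Computes M f p b T)
    (h : T ≤ T') : Computes M f p b T' := fun s => by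
  obtain ⟨t, ht, h'⟩ := hp s
  exact ⟨t, ht.trans h, h'⟩

theorem computes_pure (b : β) : Computes M f (pure b) b 0 := fun _ => ⟨0, le_rfl, rfl⟩

theorem computes_ticks (t : ℕ) : Computes M f (ticks t : OnlineProg α Unit) () t :=
  fun _ => ⟨t, le_rfl, rfl⟩

theorem computes_askValue (S : Finset α) : Computes M f (askValue S) (f S) 1 :=
  fun _ => ⟨1, le_rfl, rfl⟩

open Classical in
theorem computes_askIndep (S : Finset α) :
    Computes M f (askIndep S) (decide (M.Indep (S : Set α))) 1 :=
  fun _ => ⟨1, le_rfl, rfl⟩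

end OnlineProg

namespace MatroidShortlist

open OnlineProg

section

variable {α : Type} [LinearOrder α] (M : Matroid α) (f : Finset α → ℝ)

open Classical in
/-- The value computed by `trySwap`. -/
noncomputable def swapUpdate (T : Finset α) (removed : Option α) (best : Option (ℝ × Option α)) :
    Option (ℝ × Option α) :=
  if M.Indep (T : Set α) then
    match best with
    | none => some (f T, removed)
    | some (w, r) => if w < f T then some (f T, removed) else some (w, r)
  else best

/-- The value computed by `bestSwap`. -/
noncomputable def swapBest (e : α) (S : List α) : Option (ℝ × Option α) :=
  S.foldl (fun b x => swapUpdate M f ((insert e S.toFinset).erase x) (some x) b)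
    (swapUpdate M f (insert e S.toFinset) none none)

/-- The candidate `(g(e, S), e, θ(e, S))`, or `none` if `e` cannot be exchanged into `S`. -/
noncomputable def candidate (S : List α) (e : α) : Option (Candidate α) :=
  (swapBest M f e S).map fun p => ⟨p.1 - f S.toFinset, e, p.2⟩

variable {M f}

theorem computes_trySwap (T : Finset α) (removed : Option α) (best : Option (ℝ × Option α)) :
    Computes M f (trySwap T removed best) (swapUpdate M f T removed best) 4 := by
  unfold trySwap swapUpdate
  refine ((computes_ticks 1).bind ((computes_askIndep T).bind
    (T' := 2) ?_)).mono (by norm_num)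
  by_cases h : M.Indep (T : Set α)
  · simp only [h, decide_true, if_true]
    refine ((computes_askValue T).bind ((computes_ticks 1).bind (T' := 0) ?_)).mono (by norm_num)
    rcases best with _ | ⟨w, r⟩
    · exact computes_pure _
    · by_cases hw : w < f T
      · simpa [hw] using computes_pure _
      · simpa [hw] using computes_pure _
  · simp only [h, decide_false, if_false]
    exact (computes_pure _).mono (by norm_num)

theorem computes_trySwaps (e : α) (S : Finset α) (l : List α) (best : Option (ℝ × Option α)) :
    Computes M f (trySwaps e S l best)
      (l.foldl (fun b x => swapUpdate M f ((insert e S).erase x) (some x) b) best)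
      (4 * l.length) := by
  induction l generalizing best with
  | nil => exact computes_pure _
  | cons x l ih =>
    rw [trySwaps]
    exact ((computes_trySwap _ _ _).bind (ih _)).mono (by simp; omega)

theorem computes_evaluate (S : List α) (e : α) :
    Computes M f (evaluate S (f S.toFinset) e) (candidate M f S e) (4 * S.length + 4) := by
  unfold evaluate bestSwap candidate
  refine (((computes_trySwap _ _ _).bind (computes_trySwaps e S.toFinset S _)).bind
    (T' := 0) ?_).mono (by omega)
  change Computes M f (match swapBest M f e S with
    | none => _
    | some (v, o) => _) _ _
  rcases swapBest M f e S with _ | ⟨v, o⟩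
  · exact computes_pure _
  · exact computes_pure _

end

end MatroidShortlist

/-! ### Submodular functions and the local search inequality -/

section

variable {α : Type} [DecidableEq α] {f : Finset α → ℝ}

theorem IsSubmodular.insert_sub_le (hf : IsSubmodular f) {S T : Finset α} (h : S ⊆ T) {e : α}
    (he : e ∉ T) : f (insert e T) - f T ≤ f (insert e S) - f S := by
  have h1 := hf (insert e S) T
  have h2 : insert e S ∪ T = insert e T := by
    rw [insert_union, union_eq_right.2 h]
  have h3 : insert e S ∩ T = S := by
    rw [insert_inter_of_notMem he, inter_eq_left.2 h]
  rw [h2, h3] at h1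
  linarith

/-- The marginal values over `S` of the elements of `T` add up to at least `f (S ∪ T) - f S`. -/
theorem IsSubmodular.sub_le_sum_insert (hf : IsSubmodular f) (S T : Finset α) :
    f (S ∪ T) - f S ≤ ∑ e ∈ T, (f (insert e S) - f S) := by
  induction T using Finset.induction_on with
  | empty => simp
  | insert e T he ih =>
    rw [sum_insert he, union_insert]
    by_cases heS : e ∈ S
    · rw [insert_eq_of_mem (mem_union_left _ heS), insert_eq_of_mem heS]
      linarith
    · have := hf.insert_sub_le (S := S) (T := S ∪ T) subset_union_left (e := e) (by simp [heS, he])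
      linarith

/-- Removing single elements of `T ⊆ S` from `S` loses at most `f S` in total. -/
theorem IsSubmodular.sum_sub_erase_le (hf : IsSubmodular f) (h0 : ∀ S, 0 ≤ f S)
    {S T : Finset α} (h : T ⊆ S) : ∑ x ∈ T, (f S - f (S.erase x)) ≤ f S := by
  suffices H : ∑ x ∈ T, (f S - f (S.erase x)) ≤ f S - f (S \ T) by
    linarith [h0 (S \ T)]
  induction T using Finset.induction_on with
  | empty => simp
  | insert x T hx ih =>
    rw [sum_insert hx]
    have hxS : x ∈ S := h (mem_insert_self _ _)
    have ih := ih ((subset_insert _ _).trans h)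
    have := hf.insert_sub_le (S := S \ insert x T) (T := S.erase x) (e := x) (by
      intro y; simp; tauto) (by simp)
    rw [insert_erase hxS] at this
    have h2 : insert x (S \ insert x T) = S \ T := by
      ext y; simp only [mem_insert, mem_sdiff, not_or]
      by_cases hy : y = x
      · subst hy; simp [hxS, hx]
      · simp [hy]
    rw [h2] at this
    linarith

end

namespace MatroidShortlist

section
variable {α : Type} [DecidableEq α] {M : Matroid α} {f : Finset α → ℝ}

/-- If `S` and `T` are independent, then the elements of `T` that depend on `S` can be exchanged
into `S` for pairwise distinct elements of `S`. Hall's condition holds because a set of such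
elements lies in the closure of the set of all elements that may leave for one of them. -/
theorem exists_exchange_injOn {S T : Finset α} (hS : M.Indep (S : Set α))
    (hT : M.Indep (T : Set α)) :
    ∃ π : α → α, Set.InjOn π {e | e ∈ T ∧ ¬ M.Indep (insert e S : Set α)} ∧
      ∀ e ∈ T, ¬ M.Indep (insert e S : Set α) →
        π e ∈ S ∧ M.Indep (((insert e S).erase (π e) : Finset α) : Set α) := by
  classical
  let D : Type := {e // e ∈ T ∧ ¬ M.Indep (insert e S : Set α)}
  let t : D → Finset α := fun e =>
    S.filter fun x => M.Indep (((insert e.1 S).erase x : Finset α) : Set α)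
  have hcl : ∀ e : D, e.1 ∈ M.closure (t e : Set α) := by
    rintro ⟨e, heT, hdep⟩
    have heS : e ∉ (S : Set α) := fun h => hdep (by rwa [Set.insert_eq_of_mem h])
    have heE : e ∈ M.E := hT.subset_ground heT
    have hecl : e ∈ M.closure (S : Set α) := by
      rw [hS.mem_closure_iff_of_notMem heS]
      exact ⟨hdep, Set.insert_subset heE hS.subset_ground⟩
    have hC := hS.fundCircuit_isCircuit hecl heS
    refine M.closure_subset_closure ?_
      (hC.mem_closure_sdiff_singleton_of_mem (M.mem_fundCircuit e S))
    rintro x ⟨hx, hxe⟩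
    have hxe : x ≠ e := hxe
    have hxS : x ∈ S := by simpa [hxe] using (M.fundCircuit_subset_insert e S) hx
    rw [hS.mem_fundCircuit_iff hecl heS] at hx
    simpa [t, hxS] using hx
  have hall : ∀ A : Finset D, #A ≤ #(A.biUnion t) := by
    intro A
    have hsub : (A.image Subtype.val : Set α) ⊆ M.closure (A.biUnion t : Set α) := by
      intro x hx
      obtain ⟨e, he, rfl⟩ := by simpa only [coe_image, Set.mem_image, mem_coe] using hx
      refine M.closure_subset_closure ?_ (hcl e)
      exact_mod_cast subset_biUnion_of_mem t he
    have hind : M.Indep (A.image Subtype.val : Set α) := by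
      refine hT.subset ?_
      intro x hx
      obtain ⟨e, he, rfl⟩ := by simpa only [coe_image, Set.mem_image, mem_coe] using hx
      exact e.2.1
    have h1 := M.eRk_mono hsub
    rw [hind.eRk_eq_encard, M.eRk_closure_eq] at h1
    have h2 := h1.trans (M.eRk_le_encard _)
    rw [Set.encard_coe_eq_coe_finsetCard, Set.encard_coe_eq_coe_finsetCard,
      card_image_of_injective _ Subtype.val_injective] at h2
    exact_mod_cast h2
  obtain ⟨g, hg, hgt⟩ := (Finset.all_card_le_biUnion_card_iff_exists_injective t).1 hall
  refine ⟨fun e => if h : e ∈ T ∧ ¬ M.Indep (insert e S : Set α) then g ⟨e, h⟩ else e, ?_, ?_⟩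
  · intro e he e' he' hee
    have he : e ∈ T ∧ ¬ M.Indep (insert e S : Set α) := he
    have he' : e' ∈ T ∧ ¬ M.Indep (insert e' S : Set α) := he'
    simp only [dif_pos he, dif_pos he'] at hee
    exact congrArg Subtype.val (hg hee)
  · intro e he hdep
    have := hgt ⟨e, he, hdep⟩
    simpa [dif_pos (And.intro he hdep), t] using this

/-- The local search inequality: over an independent set `S`, the values of the best exchanges of
the elements of an independent set `T` add up to at least `f T - 2 f S`. -/
theorem sub_two_mul_le_sum_exchange (hmono : Monotone f) (hf : IsSubmodular f)
    (h0 : ∀ S, 0 ≤ f S) {S T : Finset α} (hS : M.Indep (S : Set α)) (hT : M.Indep (T : Set α))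
    (G : α → ℝ)
    (hG1 : ∀ e, M.Indep (insert e S : Set α) → f (insert e S) - f S ≤ G e)
    (hG2 : ∀ e, ∀ x ∈ S, M.Indep (((insert e S).erase x : Finset α) : Set α) →
      f ((insert e S).erase x) - f S ≤ G e) :
    f T - 2 * f S ≤ ∑ e ∈ T, G e := by
  classical
  obtain ⟨π, hinj, hπ⟩ := exists_exchange_injOn hS hT
  let D := T.filter fun e => ¬ M.Indep (insert e S : Set α)
  have h1 : ∑ e ∈ D, (f S - f (S.erase (π e))) ≤ f S := by
    rw [← sum_image (f := fun x => f S - f (S.erase x)) (g := π) (s := D)]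
    · refine hf.sum_sub_erase_le h0 ?_
      intro x hx
      obtain ⟨e, he, rfl⟩ := mem_image.1 hx
      exact (hπ e (mem_filter.1 he).1 (mem_filter.1 he).2).1
    · intro x hx y hy
      exact hinj (by simpa [D] using hx) (by simpa [D] using hy)
  have h2 : ∑ e ∈ T, (f (insert e S) - f S) - ∑ e ∈ D, (f S - f (S.erase (π e))) ≤
      ∑ e ∈ T, G e := by
    rw [show D = T.filter fun e => ¬ M.Indep (insert e S : Set α) from rfl, sum_filter,
      ← sum_sub_distrib]
    refine sum_le_sum fun e he => ?_
    by_cases hdep : M.Indep (insert e S : Set α)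
    · simpa [hdep] using hG1 e hdep
    · rw [if_pos hdep]
      obtain ⟨hmem, hind⟩ := hπ e he hdep
      have heS : e ∉ S := fun h => hdep (by
        rw [Set.insert_eq_of_mem (by exact_mod_cast h)]; exact hS)
      have hne : π e ≠ e := fun h => heS (h ▸ hmem)
      have h3 := hG2 e _ hmem hind
      have h4 := hf.insert_sub_le (S := S.erase (π e)) (T := S) (erase_subset _ _) heS
      rw [← erase_insert_of_ne hne.symm] at h4
      linarith
  have h3 := hf.sub_le_sum_insert S T
  have h4 : f T ≤ f (S ∪ T) := hmono subset_union_right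
  linarith


end

end MatroidShortlist

/-! ### The candidates of the algorithm and their gains -/

namespace MatroidShortlist

section

variable {α : Type} [LinearOrder α] {M : Matroid α} {f : Finset α → ℝ}

/-- The set `S + e - o`, where `o = none` stands for no removal. -/
def swapSet (S : Finset α) (e : α) : Option α → Finset α
  | none => insert e S
  | some x => (insert e S).erase x

/-- The search finds an independent set of largest value among `S + e` and the sets `S + e - x`
with `x ∈ S`. -/
theorem swapBest_spec (e : α) (S : List α) :
    (∀ p, swapBest M f e S = some p → (∀ x, p.2 = some x → x ∈ S) ∧
      M.Indep (swapSet S.toFinset e p.2 : Set α) ∧ f (swapSet S.toFinset e p.2) = p.1) ∧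
    ∀ o, (∀ x, o = some x → x ∈ S) → M.Indep (swapSet S.toFinset e o : Set α) →
      ∃ p, swapBest M f e S = some p ∧ f (swapSet S.toFinset e o) ≤ p.1 := by
  -- The search keeps the best of the feasible sets in any predicate `Q` that has been scanned.
  have key : ∀ (Q : Option α → Prop) (b : Option (ℝ × Option α)) (o : Option α),
      ((∀ p, b = some p → Q p.2 ∧
        M.Indep (swapSet S.toFinset e p.2 : Set α) ∧ f (swapSet S.toFinset e p.2) = p.1) ∧
      ∀ o', Q o' → M.Indep (swapSet S.toFinset e o' : Set α) →
        ∃ p, b = some p ∧ f (swapSet S.toFinset e o') ≤ p.1) →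
      ((∀ p, swapUpdate M f (swapSet S.toFinset e o) o b = some p → (Q p.2 ∨ p.2 = o) ∧
        M.Indep (swapSet S.toFinset e p.2 : Set α) ∧ f (swapSet S.toFinset e p.2) = p.1) ∧
      ∀ o', (Q o' ∨ o' = o) → M.Indep (swapSet S.toFinset e o' : Set α) →
        ∃ p, swapUpdate M f (swapSet S.toFinset e o) o b = some p ∧
          f (swapSet S.toFinset e o') ≤ p.1) := by
    rintro Q b o ⟨h1, h2⟩
    unfold swapUpdate
    split_ifs with hind
    · rcases b with _ | ⟨w, r⟩
      · refine ⟨?_, ?_⟩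
        · rintro p hp
          obtain rfl := Option.some.inj hp
          exact ⟨Or.inr rfl, hind, rfl⟩
        · rintro o' (hQ | rfl) ho'
          · obtain ⟨p, hp, -⟩ := h2 o' hQ ho'
            simp at hp
          · exact ⟨_, rfl, le_rfl⟩
      · obtain ⟨hr, hri, hrv⟩ := h1 _ rfl
        dsimp only at hr hri hrv ⊢
        split_ifs with hw
        · refine ⟨?_, ?_⟩
          · rintro p hp
            obtain rfl := Option.some.inj hp
            exact ⟨Or.inr rfl, hind, rfl⟩
          · rintro o' (hQ | rfl) ho'
            · obtain ⟨p, hp, hle⟩ := h2 o' hQ ho'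
              obtain rfl := Option.some.inj hp
              exact ⟨_, rfl, hle.trans hw.le⟩
            · exact ⟨_, rfl, le_rfl⟩
        · refine ⟨?_, ?_⟩
          · rintro p hp
            obtain rfl := Option.some.inj hp
            exact ⟨Or.inl hr, hri, hrv⟩
          · rintro o' (hQ | rfl) ho'
            · exact h2 o' hQ ho'
            · exact ⟨_, rfl, not_lt.1 hw⟩
    · refine ⟨fun p hp => ⟨Or.inl (h1 p hp).1, (h1 p hp).2⟩, ?_⟩
      rintro o' (hQ | rfl) ho'
      · exact h2 o' hQ ho'
      · exact absurd ho' hind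
  have fold : ∀ (l : List α) (Q : Option α → Prop) (b : Option (ℝ × Option α)),
      ((∀ p, b = some p → Q p.2 ∧
        M.Indep (swapSet S.toFinset e p.2 : Set α) ∧ f (swapSet S.toFinset e p.2) = p.1) ∧
      ∀ o', Q o' → M.Indep (swapSet S.toFinset e o' : Set α) →
        ∃ p, b = some p ∧ f (swapSet S.toFinset e o') ≤ p.1) →
      ((∀ p, l.foldl (fun b x => swapUpdate M f ((insert e S.toFinset).erase x) (some x) b) b =
          some p → (Q p.2 ∨ ∃ x ∈ l, p.2 = some x) ∧
        M.Indep (swapSet S.toFinset e p.2 : Set α) ∧ f (swapSet S.toFinset e p.2) = p.1) ∧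
      ∀ o', (Q o' ∨ ∃ x ∈ l, o' = some x) → M.Indep (swapSet S.toFinset e o' : Set α) →
        ∃ p, l.foldl (fun b x => swapUpdate M f ((insert e S.toFinset).erase x) (some x) b) b =
          some p ∧ f (swapSet S.toFinset e o') ≤ p.1) := by
    intro l
    induction l with
    | nil => intro Q b h; simpa using h
    | cons x l ih =>
      intro Q b h
      have := ih (fun o' => Q o' ∨ o' = some x) _ (key Q b (some x) h)
      simpa [or_assoc, swapSet] using this
  have start := key (fun _ => False) none none (by simp)
  have all := fold S (fun o' => False ∨ o' = none) _ start
  constructor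
  · intro p hp
    obtain ⟨h1, h2⟩ := all.1 p hp
    refine ⟨fun x hx => ?_, h2⟩
    simpa [hx] using h1
  · intro o ho
    refine all.2 o ?_
    rcases o with _ | x
    · simp
    · simpa using ho x rfl

theorem candidate_spec {S : List α} {e : α} {c : Candidate α} (h : candidate M f S e = some c) :
    c.item = e ∧ (∀ x, c.removed = some x → x ∈ S) ∧
      M.Indep (swapSet S.toFinset e c.removed : Set α) ∧
      f (swapSet S.toFinset e c.removed) = f S.toFinset + c.gain := by
  obtain ⟨p, hp, rfl⟩ := Option.map_eq_some_iff.1 h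
  obtain ⟨h1, h2, h3⟩ := (swapBest_spec e S).1 p hp
  exact ⟨rfl, h1, h2, by simp [h3]⟩

theorem exists_candidate {S : List α} {e : α} {o : Option α} (ho : ∀ x, o = some x → x ∈ S)
    (hi : M.Indep (swapSet S.toFinset e o : Set α)) :
    ∃ c, candidate M f S e = some c ∧ f (swapSet S.toFinset e o) - f S.toFinset ≤ c.gain := by
  obtain ⟨p, hp, hle⟩ := (swapBest_spec (f := f) e S).2 o ho hi
  exact ⟨_, Option.map_eq_some_iff.2 ⟨p, hp, rfl⟩, by simpa using hle⟩

theorem candidate_gain_nonpos (hf : Monotone f) {S : List α} {e : α} {c : Candidate α}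
    (h : candidate M f S e = some c) (he : e ∈ S) : c.gain ≤ 0 := by
  obtain ⟨-, -, -, hv⟩ := candidate_spec h
  have : swapSet S.toFinset e c.removed ≤ S.toFinset := by
    have hi : insert e S.toFinset = S.toFinset := insert_eq_of_mem (List.mem_toFinset.2 he)
    rcases c.removed with _ | x
    · exact hi.le
    · simpa only [swapSet, hi] using erase_subset _ _
  linarith [hf this]

variable (M f) in
/-- The positive part of `g(e, S)`, which is `0` if `e` cannot be exchanged into `S`. -/
noncomputable def gainOf (S : List α) (e : α) : ℝ≥0 :=
  ((candidate M f S e).elim 0 Candidate.gain).toNNReal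

theorem gainOf_of_candidate {S : List α} {e : α} {c : Candidate α}
    (h : candidate M f S e = some c) : gainOf M f S e = c.gain.toNNReal := by
  simp [gainOf, h]

/-- The local search inequality for the gains of the algorithm. -/
theorem sub_two_mul_le_sum_gainOf (hmono : Monotone f) (hf : IsSubmodular f)
    (h0 : ∀ S, 0 ≤ f S) {S : List α} {T : Finset α} (hS : M.Indep (S.toFinset : Set α))
    (hT : M.Indep (T : Set α)) :
    f T - 2 * f S.toFinset ≤ ∑ e ∈ T, (gainOf M f S e : ℝ) := by
  have key : ∀ e o, (∀ x, o = some x → x ∈ S) → M.Indep (swapSet S.toFinset e o : Set α) →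
      f (swapSet S.toFinset e o) - f S.toFinset ≤ gainOf M f S e := by
    intro e o ho hi
    obtain ⟨c, hc, hle⟩ := exists_candidate (f := f) ho hi
    rw [gainOf_of_candidate hc]
    exact hle.trans (Real.le_coe_toNNReal _)
  refine sub_two_mul_le_sum_exchange hmono hf h0 hS hT _ ?_ ?_
  · intro e he
    exact key e none (by simp) (by simpa [swapSet] using he)
  · intro e x hx he
    refine key e (some x) ?_ he
    rintro _ ⟨⟩
    simpa using hx

theorem exchange_toFinset {S : List α} (hS : S.Nodup) {c : Candidate α} (hc : c.item ∉ S)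
    (hr : ∀ x, c.removed = some x → x ∈ S) :
    (exchange S c).toFinset = swapSet S.toFinset c.item c.removed := by
  unfold exchange
  cases h : c.removed with
  | none => simp [swapSet]
  | some o =>
    have ho : c.item ≠ o := fun hco => hc (hco ▸ hr o h)
    ext x
    simp only [List.toFinset_cons, swapSet, mem_insert, List.mem_toFinset, hS.mem_erase_iff,
      mem_erase]
    constructor
    · rintro (rfl | ⟨h1, h2⟩)
      · exact ⟨ho, Or.inl rfl⟩
      · exact ⟨h1, Or.inr h2⟩
    · rintro ⟨h1, rfl | h2⟩
      · exact Or.inl rfl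
      · exact Or.inr ⟨h1, h2⟩

theorem exchange_nodup {S : List α} (hS : S.Nodup) {c : Candidate α} (hc : c.item ∉ S) :
    (exchange S c).Nodup := by
  unfold exchange
  cases c.removed with
  | none => exact List.nodup_cons.2 ⟨hc, hS⟩
  | some o => exact List.nodup_cons.2 ⟨fun h => hc (List.mem_of_mem_erase h), hS.erase o⟩

theorem mem_exchange {S : List α} {c : Candidate α} {x : α} (h : x ∈ exchange S c) :
    x = c.item ∨ x ∈ S := by
  unfold exchange at h
  cases hr : c.removed with
  | none => simpa [hr] using h
  | some o =>
    rw [hr] at h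
    rcases List.mem_cons.1 h with h | h
    · exact Or.inl h
    · exact Or.inr (List.mem_of_mem_erase h)

/-! ### The best candidate of a set of items -/

/-- The position of a candidate in the order by gain, ties being broken by the order of items. -/
def Candidate.key (c : Candidate α) : ℝ ×ₗ α := toLex (c.gain, c.item)

theorem beats_some_iff (c d : Candidate α) : c.beats (some d) = true ↔ d.key < c.key := by
  simp [Candidate.beats, Candidate.key, Prod.Lex.lt_iff]

variable (M f)

/-- The candidate `c` is the best one among those of the items in `T`. -/
def IsBest (S : List α) (T : Finset α) (c : Candidate α) : Prop :=
  c.item ∈ T ∧ candidate M f S c.item = some c ∧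
    ∀ e ∈ T, ∀ d, candidate M f S e = some d → d = c ∨ d.key < c.key

/-- The best candidate among those of the items in `T`, or `none` if there is none. -/
def IsMaximum (S : List α) (T : Finset α) (b : Option (Candidate α)) : Prop :=
  (∀ c, b = some c → IsBest M f S T c) ∧ (b = none → ∀ e ∈ T, candidate M f S e = none)

variable {M f}

theorem IsBest.unique {S : List α} {T : Finset α} {c d : Candidate α} (hc : IsBest M f S T c)
    (hd : IsBest M f S T d) : c = d := by
  rcases hd.2.2 _ hc.1 _ hc.2.1 with h | h
  · exact h
  · rcases hc.2.2 _ hd.1 _ hd.2.1 with h' | h'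
    · exact h'.symm
    · exact absurd (h.trans h') (lt_irrefl _)

theorem isMaximum_empty (S : List α) : IsMaximum M f S ∅ none := by
  simp [IsMaximum]

theorem IsMaximum.insert {S : List α} {T : Finset α} {b : Option (Candidate α)}
    (h : IsMaximum M f S T b) (e : α) :
    IsMaximum M f S (insert e T) (merge b (candidate M f S e)) := by
  cases hc : candidate M f S e with
  | none =>
    refine ⟨fun c hb => ?_, fun hb x hx => ?_⟩
    · obtain ⟨h1, h2, h3⟩ := h.1 c hb
      refine ⟨mem_insert_of_mem h1, h2, fun x hx d hd => ?_⟩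
      rcases mem_insert.1 hx with rfl | hx
      · rw [hc] at hd; cases hd
      · exact h3 x hx d hd
    · rcases mem_insert.1 hx with rfl | hx
      · exact hc
      · exact h.2 hb x hx
  | some c =>
    have hce : c.item = e := (candidate_spec hc).1
    unfold merge
    dsimp only
    split_ifs with hb
    · refine ⟨?_, by simp⟩
      rintro _ ⟨⟩
      refine ⟨by simp [hce], by rw [hce, hc], fun x hx d hd => ?_⟩
      rcases mem_insert.1 hx with rfl | hx
      · exact Or.inl (Option.some.inj (hd.symm.trans hc))
      · right
        rcases b with _ | d'
        · rw [h.2 rfl x hx] at hd; cases hd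
        · rw [beats_some_iff] at hb
          rcases (h.1 _ rfl).2.2 x hx d hd with rfl | hlt
          · exact hb
          · exact hlt.trans hb
    · rcases b with _ | d'
      · exact absurd rfl hb
      · rw [beats_some_iff] at hb
        refine ⟨?_, by simp⟩
        rintro _ ⟨⟩
        obtain ⟨h1, h2, h3⟩ := h.1 _ rfl
        refine ⟨mem_insert_of_mem h1, h2, fun x hx d hd => ?_⟩
        rcases mem_insert.1 hx with rfl | hx
        · obtain rfl := Option.some.inj (hd.symm.trans hc)
          rcases (not_lt.1 hb).lt_or_eq with hlt | heq
          · exact Or.inr hlt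
          · left
            have hit : d.item = d'.item := by
              have := congrArg (fun p => (ofLex p).2) heq
              simpa [Candidate.key] using this
            rw [← hit, hce, hc] at h2
            exact Option.some.inj h2
        · exact h3 x hx d hd

variable (M f) in
open Classical in
/-- The best candidate of positive gain among those of the items in `T`. -/
noncomputable def improver (S : List α) (T : Finset α) : Option (Candidate α) :=
  if h : ∃ c, IsBest M f S T c ∧ 0 < c.gain then some h.choose else none

theorem improver_eq_some {S : List α} {T : Finset α} {c : Candidate α} :
    improver M f S T = some c ↔ IsBest M f S T c ∧ 0 < c.gain := by
  unfold improver
  split_ifs with h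
  · refine ⟨?_, fun hc => by rw [h.choose_spec.1.unique hc.1]⟩
    rintro ⟨⟩
    exact h.choose_spec
  · exact ⟨by simp, fun hc => absurd ⟨c, hc⟩ h⟩

theorem IsMaximum.improver_eq {S : List α} {T : Finset α} {b : Option (Candidate α)}
    (h : IsMaximum M f S T b) :
    improver M f S T = b.filter fun c => decide (0 < c.gain) := by
  rcases b with _ | c
  · rw [Option.filter_none, Option.eq_none_iff_forall_ne_some]
    intro c hc
    have hb := (improver_eq_some.1 hc).1
    have := h.2 rfl _ hb.1
    rw [hb.2.1] at this
    cases this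
  · have hb := h.1 c rfl
    by_cases hg : 0 < c.gain
    · rw [improver_eq_some.2 ⟨hb, hg⟩, Option.filter_some_pos (by simpa using hg)]
    · rw [Option.filter_some_neg (by simpa using hg), Option.eq_none_iff_forall_ne_some]
      intro d hd
      obtain ⟨h1, h2⟩ := improver_eq_some.1 hd
      exact hg ((h1.unique hb) ▸ h2)

theorem exists_isMaximum (S : List α) (T : Finset α) : ∃ b, IsMaximum M f S T b := by
  induction T using Finset.induction_on with
  | empty => exact ⟨none, isMaximum_empty S⟩
  | insert e T _ ih => exact ih.elim fun b hb => ⟨_, hb.insert e⟩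

/-- The largest gain of an item of `T`. -/
theorem improver_gain (S : List α) (T : Finset α) :
    ((improver M f S T).elim 0 Candidate.gain).toNNReal = T.sup (gainOf M f S) := by
  obtain ⟨b, hb⟩ := exists_isMaximum (M := M) (f := f) S T
  rw [hb.improver_eq]
  rcases b with _ | c
  · symm
    rw [Option.filter_none, Option.elim_none, Real.toNNReal_zero, ← bot_eq_zero,
      Finset.sup_eq_bot_iff]
    intro e he
    simp [gainOf, hb.2 rfl e he]
  · obtain ⟨h1, h2, h3⟩ := hb.1 c rfl
    have hsup : T.sup (gainOf M f S) = c.gain.toNNReal := by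
      refine le_antisymm (Finset.sup_le fun e he => ?_) ?_
      · cases hd : candidate M f S e with
        | none => simp [gainOf, hd]
        | some d =>
          rw [gainOf_of_candidate hd]
          refine Real.toNNReal_le_toNNReal ?_
          rcases h3 e he d hd with rfl | hlt
          · exact le_rfl
          · rw [Candidate.key, Candidate.key, Prod.Lex.lt_iff] at hlt
            rcases hlt with h | h
            · exact h.le
            · exact h.1.le
      · rw [← gainOf_of_candidate h2]
        exact Finset.le_sup h1
    rw [hsup]
    by_cases hg : 0 < c.gain
    · rw [Option.filter_some_pos (by simpa using hg), Option.elim_some]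
    · rw [Option.filter_some_neg (by simpa using hg), Option.elim_none, Real.toNNReal_zero,
        Real.toNNReal_of_nonpos (not_lt.1 hg)]

/-- Removing an item other than the best one changes nothing. -/
theorem improver_erase {S : List α} {T : Finset α} {e : α}
    (h : ∀ c, improver M f S T = some c → c.item ≠ e) :
    improver M f S (T.erase e) = improver M f S T := by
  cases hT : improver M f S T with
  | some c =>
    obtain ⟨⟨h1, h2, h3⟩, h4⟩ := improver_eq_some.1 hT
    exact improver_eq_some.2 ⟨⟨mem_erase.2 ⟨h c hT, h1⟩, h2,
      fun x hx => h3 x (mem_of_mem_erase hx)⟩, h4⟩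
  | none =>
    have h0 := improver_gain (M := M) (f := f) S T
    rw [hT, Option.elim_none, Real.toNNReal_zero] at h0
    rw [Option.eq_none_iff_forall_ne_some]
    intro c hc
    have hle : (T.erase e).sup (gainOf M f S) ≤ T.sup (gainOf M f S) :=
      Finset.sup_mono (erase_subset _ _)
    rw [← h0, ← improver_gain, hc, Option.elim_some] at hle
    exact absurd (Real.toNNReal_eq_zero.1 (le_antisymm hle zero_le))
      (not_le.2 (improver_eq_some.1 hc).2)

variable (M f) in
/-- The solution after the best exchange with an item of `T`. -/
noncomputable def improve (S : List α) (T : Finset α) : List α :=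
  (improver M f S T).elim S (exchange S)

theorem improver_item_notMem (hf : Monotone f) {S : List α} {T : Finset α} {c : Candidate α}
    (h : improver M f S T = some c) : c.item ∉ S := fun hm =>
  absurd (improver_eq_some.1 h).2
    (not_lt.2 (candidate_gain_nonpos hf (improver_eq_some.1 h).1.2.1 hm))

/-- The solution stays independent, and its value grows by the largest gain of an item. -/
theorem improve_spec (hf : Monotone f) {S : List α} (hS : S.Nodup)
    (hi : M.Indep (S.toFinset : Set α)) (T : Finset α) :
    (improve M f S T).Nodup ∧ M.Indep ((improve M f S T).toFinset : Set α) ∧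
      f (improve M f S T).toFinset = f S.toFinset + T.sup (gainOf M f S) := by
  rw [← improver_gain]
  unfold improve
  cases h : improver M f S T with
  | none => exact ⟨hS, hi, by simp⟩
  | some c =>
    have hn := improver_item_notMem hf h
    obtain ⟨⟨h1, h2, h3⟩, h4⟩ := improver_eq_some.1 h
    obtain ⟨-, h5, h6, h7⟩ := candidate_spec h2
    simp only [Option.elim_some]
    rw [exchange_toFinset hS hn h5]
    exact ⟨exchange_nodup hS hn, h6, by rw [h7, Real.coe_toNNReal _ h4.le]⟩

theorem mem_improve {S : List α} {T : Finset α} {x : α} (h : x ∈ improve M f S T) :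
    (∃ c, improver M f S T = some c ∧ x = c.item) ∨ x ∈ S := by
  unfold improve at h
  cases hc : improver M f S T with
  | none => rw [hc] at h; exact Or.inr h
  | some c =>
    rw [hc] at h
    exact (mem_exchange h).imp (fun h => ⟨c, rfl, h⟩) id

end

end MatroidShortlist

/-! ### The online max algorithm and the loop over the slots -/

namespace MatroidShortlist

open OnlineProg

section

variable {α : Type} [LinearOrder α] (M : Matroid α) (f : Finset α → ℝ)

/-- One round of the online max algorithm. The state consists of the position of the next item in
its slot, the best candidate so far and the selected items. -/
noncomputable def maxStep (S : List α) (u L : ℝ) (st : ℕ × Option (Candidate α) × List α)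
    (e : α) : ℕ × Option (Candidate α) × List α :=
  match candidate M f S e with
  | none => (st.1 + 1, st.2)
  | some c =>
    if c.beats st.2.1 then
      if u ≤ (st.1 : ℝ) ∧ (st.2.2.length : ℝ) < L then (st.1 + 1, some c, e :: st.2.2)
      else (st.1 + 1, some c, st.2.2)
    else (st.1 + 1, st.2)

/-- The online max algorithm on the list `l` of items. -/
noncomputable def maxRun (S : List α) (u L : ℝ) (l : List α) :
    ℕ × Option (Candidate α) × List α :=
  l.foldl (maxStep M f S u L) (1, none, [])

variable {M f}

theorem maxStep_length_le (S : List α) (u L : ℝ) (st : ℕ × Option (Candidate α) × List α)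
    (e : α) : (maxStep M f S u L st e).2.2.length ≤ st.2.2.length + 1 := by
  unfold maxStep
  cases candidate M f S e with
  | none => simp
  | some c => dsimp only; split_ifs <;> simp

theorem maxStep_length_lt (S : List α) (u : ℝ) {L : ℝ} (st : ℕ × Option (Candidate α) × List α)
    (e : α) (h : (st.2.2.length : ℝ) < L + 1) :
    ((maxStep M f S u L st e).2.2.length : ℝ) < L + 1 := by
  unfold maxStep
  cases candidate M f S e with
  | none => simpa using h
  | some c =>
    dsimp only
    split_ifs with h1 h2
    · simpa using h2.2
    · simpa using h
    · simpa using h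

theorem maxRun_concat (S : List α) (u L : ℝ) (l : List α) (e : α) :
    maxRun M f S u L (l ++ [e]) = maxStep M f S u L (maxRun M f S u L l) e := by
  simp [maxRun, List.foldl_append]

theorem maxRun_fst (S : List α) (u L : ℝ) (l : List α) :
    (maxRun M f S u L l).1 = l.length + 1 := by
  induction l using List.reverseRecOn with
  | nil => rfl
  | append_singleton l e ih =>
    rw [maxRun_concat, List.length_append, List.length_singleton, ← ih]
    unfold maxStep
    cases candidate M f S e with
    | none => rfl
    | some c => dsimp only; split_ifs <;> rfl

theorem maxStep_best (S : List α) (u L : ℝ) (st : ℕ × Option (Candidate α) × List α) (e : α) :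
    (maxStep M f S u L st e).2.1 = merge st.2.1 (candidate M f S e) := by
  unfold maxStep merge
  cases candidate M f S e with
  | none => rfl
  | some c => dsimp only; split_ifs <;> rfl

theorem maxRun_isMaximum (S : List α) (u L : ℝ) (l : List α) :
    IsMaximum M f S l.toFinset (maxRun M f S u L l).2.1 := by
  induction l using List.reverseRecOn with
  | nil => exact isMaximum_empty S
  | append_singleton l e ih =>
    rw [maxRun_concat, maxStep_best]
    have := ih.insert e
    rwa [show (l ++ [e]).toFinset = insert e l.toFinset by ext; simp]

theorem maxRun_subset (S : List α) (u L : ℝ) (l : List α) :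
    ∀ x ∈ (maxRun M f S u L l).2.2, x ∈ l := by
  induction l using List.reverseRecOn with
  | nil => simp [maxRun]
  | append_singleton l e ih =>
    rw [maxRun_concat]
    unfold maxStep
    intro x hx
    rw [List.mem_append, List.mem_singleton]
    cases hc : candidate M f S e with
    | none => rw [hc] at hx; exact Or.inl (ih x hx)
    | some c =>
      rw [hc] at hx
      dsimp only at hx
      split_ifs at hx with h1 h2
      · rcases List.mem_cons.1 hx with h | h
        · exact Or.inr h
        · exact Or.inl (ih x h)
      · exact Or.inl (ih x hx)
      · exact Or.inl (ih x hx)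

theorem maxRun_length_le (S : List α) (u L : ℝ) (l : List α) :
    (maxRun M f S u L l).2.2.length ≤ l.length := by
  induction l using List.reverseRecOn with
  | nil => simp [maxRun]
  | append_singleton l e ih =>
    rw [maxRun_concat]
    have := maxStep_length_le (M := M) (f := f) S u L (maxRun M f S u L l) e
    simp only [List.length_append, List.length_singleton]
    omega

theorem maxRun_length_lt (S : List α) (u : ℝ) {L : ℝ} (hL : 0 ≤ L) (l : List α) :
    ((maxRun M f S u L l).2.2.length : ℝ) < L + 1 := by
  induction l using List.reverseRecOn with
  | nil => simp [maxRun]; linarith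
  | append_singleton l e ih =>
    rw [maxRun_concat]
    exact maxStep_length_lt _ _ _ _ ih

/-- The main loop of the online max algorithm is a fold of `maxStep`. It reads exactly the items in
`l`, and puts exactly the selected ones on the shortlist. -/
theorem run_onlineMaxLoop (S : List α) (u L : ℝ) (l rest : List α) (i : ℕ)
    (best : Option (Candidate α)) (A : List α) (s : RunState α) (hs : s.upcoming = l ++ rest)
    (hA : A.toFinset ⊆ s.shortlist) :
    ∃ s', (onlineMaxLoop S (f S.toFinset) u L l.length i best A).run M f s =
        ((l.foldl (maxStep M f S u L) (i, best, A)).2, s') ∧ s'.upcoming = rest ∧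
      s'.shortlist = s.shortlist ∪ (l.foldl (maxStep M f S u L) (i, best, A)).2.2.toFinset ∧
      s'.steps ≤ s.steps + l.length * (4 * S.length + 7) := by
  induction l generalizing i best A s with
  | nil =>
    refine ⟨s, rfl, hs, ?_, by simp⟩
    simpa using hA
  | cons e l ih =>
    rw [List.length_cons, onlineMaxLoop, run_bind]
    let s1 : RunState α := ⟨l ++ rest, some e, s.shortlist, s.steps + 1⟩
    have h1 : (nextItem : OnlineProg α _).run M f s = (some e, s1) := by
      simp [nextItem, OnlineProg.run, hs, s1]
    rw [h1]
    dsimp only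
    obtain ⟨t2, ht2, h3⟩ := computes_evaluate (M := M) (f := f) S e s1
    rw [run_bind, h3]
    dsimp only
    rw [run_bind]
    let s2 : RunState α := ⟨l ++ rest, some e, s.shortlist, s.steps + 1 + t2 + 1⟩
    have h4 : (ticks 1 : OnlineProg α _).run M f { s1 with steps := s1.steps + t2 } =
      ((), s2) := rfl
    rw [h4, List.foldl_cons]
    dsimp only
    have hstep : (l.length + 1) * (4 * S.length + 7) =
        l.length * (4 * S.length + 7) + (4 * S.length + 7) := by ring
    -- A round that selects nothing.
    have plain : ∀ best' : Option (Candidate α), ∃ s',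
        (onlineMaxLoop S (f S.toFinset) u L l.length (i + 1) best' A).run M f s2 =
          ((l.foldl (maxStep M f S u L) (i + 1, best', A)).2, s') ∧ s'.upcoming = rest ∧
        s'.shortlist =
          s.shortlist ∪ (l.foldl (maxStep M f S u L) (i + 1, best', A)).2.2.toFinset ∧
        s'.steps ≤ s.steps + (l.length + 1) * (4 * S.length + 7) := by
      intro best'
      obtain ⟨s', g1, g2, g3, g4⟩ := ih (i + 1) best' A s2 rfl hA
      refine ⟨s', g1, g2, g3, ?_⟩
      have : s2.steps = s.steps + 1 + t2 + 1 := rfl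
      omega
    cases hc : candidate M f S e with
    | none =>
      have : maxStep M f S u L (i, best, A) e = (i + 1, best, A) := by simp [maxStep, hc]
      rw [this]
      exact plain best
    | some c =>
      by_cases hb : c.beats best = true
      · by_cases hu : u ≤ (i : ℝ) ∧ (A.length : ℝ) < L
        · have : maxStep M f S u L (i, best, A) e = (i + 1, some c, e :: A) := by
            simp only [maxStep, hc, hb, if_true]
            rw [if_pos hu]
          rw [this]
          dsimp only
          rw [if_pos hb, if_pos hu, run_bind]
          let s3 : RunState α := ⟨l ++ rest, some e, s.shortlist ∪ {e}, s.steps + 1 + t2 + 2⟩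
          have h5 : (selectCurrent : OnlineProg α _).run M f s2 = ((), s3) := by
            simp only [selectCurrent, OnlineProg.run, s2, s3, Option.toFinset_some]
            congr 2
            ext x
            simp
          rw [h5]
          obtain ⟨s', g1, g2, g3, g4⟩ := ih (i + 1) (some c) (e :: A) s3 rfl (by
            intro x
            simp only [List.toFinset_cons, mem_insert, s3, mem_union, mem_singleton]
            rintro (h | h)
            · exact Or.inr h
            · exact Or.inl (hA h))
          refine ⟨s', g1, g2, ?_, ?_⟩
          · rw [g3]
            have hmem : e ∈ (l.foldl (maxStep M f S u L) (i + 1, some c, e :: A)).2.2 := by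
              have : ∀ (l : List α) (st : ℕ × Option (Candidate α) × List α), e ∈ st.2.2 →
                  e ∈ (l.foldl (maxStep M f S u L) st).2.2 := by
                intro l
                induction l with
                | nil => exact fun st h => h
                | cons x l ih =>
                  intro st h
                  refine ih _ ?_
                  unfold maxStep
                  cases candidate M f S x with
                  | none => exact h
                  | some c =>
                    dsimp only
                    split_ifs
                    · exact List.mem_cons_of_mem _ h
                    · exact h
                    · exact h
              exact this l _ List.mem_cons_self
            ext x
            simp only [s3, mem_union, mem_singleton, List.mem_toFinset]
            constructor
            · rintro ((h | rfl) | h)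
              · exact Or.inl h
              · exact Or.inr hmem
              · exact Or.inr h
            · rintro (h | h)
              · exact Or.inl (Or.inl h)
              · exact Or.inr h
          · have : s3.steps = s.steps + 1 + t2 + 2 := rfl
            omega
        · have : maxStep M f S u L (i, best, A) e = (i + 1, some c, A) := by
            simp only [maxStep, hc, hb, if_true]
            rw [if_neg hu]
          rw [this]
          dsimp only
          rw [if_pos hb, if_neg hu]
          exact plain (some c)
      · have : maxStep M f S u L (i, best, A) e = (i + 1, best, A) := by
          simp only [maxStep, hc]
          rw [if_neg hb]
        rw [this]
        dsimp only
        rw [if_neg hb]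
        exact plain best

variable (M f)

/-- The effect of the algorithm on the current solution and the array when it processes the slot
`s` with the list `y s` of items. -/
noncomputable def slotStep {m : ℕ} (δ : ℝ) (y : Fin m → List α) (J : Fin m → Fin m)
    (st : List α × (Fin m → Option α)) (s : Fin m) : List α × (Fin m → Option α) :=
  let r := maxRun M f st.1 ((y s).length * δ / 2) (4 * Real.log (2 / δ)) (y s)
  match merge r.2.1 ((st.2 (J s)).bind (candidate M f st.1)) with
  | none => st
  | some c =>
    if 0 < c.gain then
      (exchange st.1 c, if c.item ∈ r.2.2 then Function.update st.2 s (some c.item) else st.2)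
    else st

variable {M f}

theorem slotStep_fst {m : ℕ} (δ : ℝ) (y : Fin m → List α) (J : Fin m → Fin m)
    (st : List α × (Fin m → Option α)) (s : Fin m) :
    (slotStep M f δ y J st s).1 = improve M f st.1 ((y s).toFinset ∪ (st.2 (J s)).toFinset) := by
  have hmax : IsMaximum M f st.1 ((y s).toFinset ∪ (st.2 (J s)).toFinset)
      (merge (maxRun M f st.1 ((y s).length * δ / 2) (4 * Real.log (2 / δ)) (y s)).2.1
        ((st.2 (J s)).bind (candidate M f st.1))) := by
    have h := maxRun_isMaximum (M := M) (f := f) st.1 ((y s).length * δ / 2)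
      (4 * Real.log (2 / δ)) (y s)
    cases hR : st.2 (J s) with
    | none => simpa [merge] using h
    | some x =>
      have := h.insert x
      simpa [union_comm, ← insert_eq] using this
  unfold slotStep improve
  rw [hmax.improver_eq]
  dsimp only
  rcases merge _ _ with _ | c
  · simp
  · by_cases hg : 0 < c.gain
    · simp [hg, Option.filter_some_pos]
    · simp [hg, Option.filter_some_neg]

/-- The run of the loop over the slots is a fold of `slotStep`. The shortlist contains everything
in the array, grows by fewer than `L + 1` items per slot, and the number of steps is bounded in
terms of the numbers of slots and items. -/
theorem run_slots (hf : Monotone f) {k m : ℕ}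
    (hk : ∀ S : Finset α, M.Indep (S : Set α) → #S ≤ k) {δ : ℝ}
    (hδ : 0 ≤ Real.log (2 / δ)) (y : Fin m → List α) (J : Fin m → Fin m) (l : List (Fin m))
    (st : List α × (Fin m → Option α)) (s : RunState α)
    (hs : s.upcoming = l.flatMap y) (hnd : st.1.Nodup) (hi : M.Indep (st.1.toFinset : Set α))
    (hR : ∀ j x, st.2 j = some x → x ∈ s.shortlist) :
    ∃ s', (slots δ (fun j => (y j).length) J l st.1 st.2).run M f s =
        (l.foldl (slotStep M f δ y J) st, s') ∧
      (∀ j x, (l.foldl (slotStep M f δ y J) st).2 j = some x → x ∈ s'.shortlist) ∧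
      (l.foldl (slotStep M f δ y J) st).1.Nodup ∧
      M.Indep ((l.foldl (slotStep M f δ y J) st).1.toFinset : Set α) ∧
      (#s'.shortlist : ℝ) ≤ #s.shortlist + l.length * (4 * Real.log (2 / δ) + 1) ∧
      s'.steps ≤ s.steps + l.length * (5 * k + 10) + (l.flatMap y).length * (4 * k + 8) := by
  induction l generalizing st s with
  | nil => exact ⟨s, rfl, hR, hnd, hi, by simp, by simp⟩
  | cons a l ih =>
    obtain ⟨SH, R⟩ := st
    dsimp only at hnd hi hR ⊢
    have hlen : SH.length ≤ k := by
      rw [← List.toFinset_card_of_nodup hnd]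
      exact hk _ hi
    rw [slots, run_bind]
    let s1 : RunState α := { s with steps := s.steps + 1 }
    have e1 : (ticks 1 : OnlineProg α _).run M f s = ((), s1) := rfl
    rw [e1, run_bind]
    let s2 : RunState α := { s with steps := s.steps + 2 }
    have e2 : (askValue SH.toFinset).run M f s1 = (f SH.toFinset, s2) := rfl
    rw [e2, run_bind]
    dsimp only
    have e3 : ∃ t ≤ 4 * k + 4, (match R (J a) with
        | none => return none
        | some x => evaluate SH (f SH.toFinset) x : OnlineProg α (Option (Candidate α))).run M f
          s2 = ((R (J a)).bind (candidate M f SH), { s with steps := s.steps + 2 + t }) := by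
      cases R (J a) with
      | none => exact ⟨0, by omega, rfl⟩
      | some x =>
        obtain ⟨t, ht, h⟩ := computes_evaluate (M := M) (f := f) SH x s2
        exact ⟨t, by omega, h⟩
    obtain ⟨t3, ht3, e3⟩ := e3
    erw [e3]
    rw [run_bind]
    dsimp only
    obtain ⟨s4, e4, u4, sh4, st4⟩ := run_onlineMaxLoop (M := M) (f := f) SH
      ((y a).length * δ / 2) (4 * Real.log (2 / δ)) (y a) (l.flatMap y) 1 none []
      { s with steps := s.steps + 2 + t3 } (by simpa using hs) (by simp)
    unfold onlineMax
    rw [e4]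
    change ∃ s', _
    set r := maxRun M f SH ((y a).length * δ / 2) (4 * Real.log (2 / δ)) (y a) with hr
    have hr' : List.foldl (maxStep M f SH ((y a).length * δ / 2) (4 * Real.log (2 / δ)))
      (1, none, []) (y a) = r := rfl
    rw [hr'] at sh4 ⊢
    dsimp only at sh4 st4 ⊢
    rw [run_bind]
    let s5 : RunState α := { s4 with steps := s4.steps + 2 }
    have e5 : (ticks 2 : OnlineProg α _).run M f s4 = ((), s5) := rfl
    rw [e5]
    dsimp only
    have hL : r.2.2.length ≤ (y a).length := maxRun_length_le _ _ _ _
    have hL' : (r.2.2.length : ℝ) < 4 * Real.log (2 / δ) + 1 :=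
      maxRun_length_lt _ _ (by linarith) _
    have hcard : (#s4.shortlist : ℝ) ≤ #s.shortlist + (4 * Real.log (2 / δ) + 1) := by
      rw [sh4]
      have h1 : #(s.shortlist ∪ r.2.2.toFinset) ≤ #s.shortlist + r.2.2.length :=
        (card_union_le _ _).trans (Nat.add_le_add_left (List.toFinset_card_le _) _)
      have h2 : (#(s.shortlist ∪ r.2.2.toFinset) : ℝ) ≤ #s.shortlist + r.2.2.length := by
        exact_mod_cast h1
      linarith
    have hsub : s.shortlist ⊆ s4.shortlist := by rw [sh4]; exact subset_union_left
    have hsteps : s4.steps ≤ s.steps + (4 * k + 6) + (y a).length * (4 * k + 7) := by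
      have : (y a).length * (4 * SH.length + 7) ≤ (y a).length * (4 * k + 7) :=
        Nat.mul_le_mul_left _ (by omega)
      omega
    have hinv := improve_spec hf hnd hi ((y a).toFinset ∪ (R (J a)).toFinset)
    have hfst := slotStep_fst (M := M) (f := f) δ y J (SH, R) a
    rw [← hfst] at hinv
    -- The recursion, started in the state after this slot.
    have fin : ∀ (s6 : RunState α), s6.upcoming = s4.upcoming → s6.shortlist = s4.shortlist →
        s6.steps ≤ s4.steps + 2 + (k + (y a).length + 2) →
        (∀ j x, (slotStep M f δ y J (SH, R) a).2 j = some x → x ∈ s6.shortlist) →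
        ∃ s', (slots δ (fun j => (y j).length) J l (slotStep M f δ y J (SH, R) a).1
            (slotStep M f δ y J (SH, R) a).2).run M f s6 =
            ((a :: l).foldl (slotStep M f δ y J) (SH, R), s') ∧
          (∀ j x, ((a :: l).foldl (slotStep M f δ y J) (SH, R)).2 j = some x →
            x ∈ s'.shortlist) ∧
          ((a :: l).foldl (slotStep M f δ y J) (SH, R)).1.Nodup ∧
          M.Indep (((a :: l).foldl (slotStep M f δ y J) (SH, R)).1.toFinset : Set α) ∧
          (#s'.shortlist : ℝ) ≤ #s.shortlist + (a :: l).length * (4 * Real.log (2 / δ) + 1) ∧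
          s'.steps ≤ s.steps + (a :: l).length * (5 * k + 10) +
            ((a :: l).flatMap y).length * (4 * k + 8) := by
      intro s6 hu hsh hst hR6
      obtain ⟨s', g1, g2, g3, g4, g5, g6⟩ := ih (slotStep M f δ y J (SH, R) a) s6
        (by rw [hu, u4]) hinv.1 hinv.2.1 hR6
      refine ⟨s', g1, g2, g3, g4, ?_, ?_⟩
      · rw [hsh] at g5
        push_cast [List.length_cons]
        linarith
      · have h1 : (a :: l).length * (5 * k + 10) = l.length * (5 * k + 10) + (5 * k + 10) := by
          rw [List.length_cons]; ring
        have h2 : ((a :: l).flatMap y).length * (4 * k + 8) =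
            (y a).length * (4 * k + 7) + (y a).length + (l.flatMap y).length * (4 * k + 8) := by
          rw [List.flatMap_cons, List.length_append]; ring
        omega
    have hstep : slotStep M f δ y J (SH, R) a =
        match merge r.2.1 ((R (J a)).bind (candidate M f SH)) with
        | none => (SH, R)
        | some c =>
          if 0 < c.gain then
            (exchange SH c, if c.item ∈ r.2.2 then Function.update R a (some c.item) else R)
          else (SH, R) := rfl
    rcases hm : merge r.2.1 ((R (J a)).bind (candidate M f SH)) with _ | c
    · rw [hm] at hstep
      dsimp only at hstep
      rw [hstep] at fin
      exact fin s5 rfl rfl (by simp only [s5]; omega) fun j x h => hsub (hR j x h)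
    · rw [hm] at hstep
      dsimp only at hstep ⊢
      by_cases hg : 0 < c.gain
      · rw [if_pos hg] at hstep
        rw [if_pos hg, run_bind]
        rw [hstep] at fin
        refine fin { s5 with steps := s5.steps + (SH.length + r.2.2.length + 2) } rfl rfl ?_ ?_
        · simp only [s5]; omega
        · intro j x h
          change x ∈ s4.shortlist
          dsimp only at h
          split_ifs at h with hmem
          · by_cases hj : j = a
            · subst hj
              rw [Function.update_self] at h
              obtain rfl := Option.some.inj h
              rw [sh4]
              exact mem_union_right _ (List.mem_toFinset.2 hmem)
            · rw [Function.update_of_ne hj] at h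
              exact hsub (hR j x h)
          · exact hsub (hR j x h)
      · rw [if_neg hg] at hstep
        rw [if_neg hg]
        rw [hstep] at fin
        exact fin s5 rfl rfl (by simp only [s5]; omega) fun j x h => hsub (hR j x h)

end

end MatroidShortlist

/-! ### The output, the shortlist and the running time of an execution -/

namespace MatroidShortlist

open OnlineProg

section

/-- A list can be cut into consecutive blocks of prescribed lengths. -/
theorem exists_flatMap_eq {ι β : Type} [DecidableEq ι] (X : ι → ℕ) (l : List ι) (hl : l.Nodup)
    (L : List β) (hL : L.length = (l.map X).sum) :
    ∃ y : ι → List β, (∀ j ∈ l, (y j).length = X j) ∧ l.flatMap y = L := by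
  induction l generalizing L with
  | nil => exact ⟨fun _ => [], by simp, by simpa using (List.length_eq_zero_iff.1 hL).symm⟩
  | cons a l ih =>
    rw [List.nodup_cons] at hl
    rw [List.map_cons, List.sum_cons] at hL
    obtain ⟨y, h1, h2⟩ := ih hl.2 (L.drop (X a)) (by rw [List.length_drop]; omega)
    have hne : ∀ j ∈ l, j ≠ a := fun j hj h => hl.1 (h ▸ hj)
    refine ⟨Function.update y a (L.take (X a)), ?_, ?_⟩
    · intro j hj
      rcases List.mem_cons.1 hj with rfl | hj
      · rw [Function.update_self, List.length_take]; omega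
      · rw [Function.update_of_ne (hne j hj), h1 j hj]
    · rw [List.flatMap_cons, Function.update_self]
      have : l.flatMap (Function.update y a (L.take (X a))) = l.flatMap y :=
        List.flatMap_congr fun j hj => Function.update_of_ne (hne j hj) _ _
      rw [this, h2, List.take_append_drop]

theorem exists_blocks {n m : ℕ} (b : Fin n → Fin m) :
    ∃ y : Fin m → List (Fin n), (∀ j, (y j).length = #{i | b i = j}) ∧
      (List.finRange m).flatMap y = List.finRange n := by
  obtain ⟨y, h1, h2⟩ := exists_flatMap_eq (fun j => #{i | b i = j}) (List.finRange m)
    (List.nodup_finRange m) (List.finRange n) (by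
      rw [List.length_finRange, ← Fin.sum_univ_def]
      have := Finset.card_eq_sum_card_fiberwise (f := b) (s := univ) (t := univ) (by simp)
      simpa using this)
  exact ⟨y, fun j => h1 j (List.mem_finRange j), h2⟩

/-- The slots for the ball throws `b`: consecutive positions, with the loads of the bins as
sizes. -/
noncomputable def blocks {n m : ℕ} (b : Fin n → Fin m) : Fin m → List (Fin n) :=
  (exists_blocks b).choose

theorem length_blocks {n m : ℕ} (b : Fin n → Fin m) (j : Fin m) :
    (blocks b j).length = #{i | b i = j} := (exists_blocks b).choose_spec.1 j

theorem flatMap_blocks {n m : ℕ} (b : Fin n → Fin m) :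
    (List.finRange m).flatMap (blocks b) = List.finRange n := (exists_blocks b).choose_spec.2

variable {α : Type} [LinearOrder α] (M : Matroid α) (f : Finset α → ℝ)

/-- The items of the solution that are also in the array. -/
def keptItems {m : ℕ} (st : List α × (Fin m → Option α)) : Finset α :=
  st.1.toFinset.filter fun x => ∃ j, st.2 j = some x

/-- The output of the algorithm when the list of the items in each slot `s` is `y s`. -/
noncomputable def outputOf {m : ℕ} (δ : ℝ) (y : Fin m → List α) (J : Fin m → Fin m) : Finset α :=
  keptItems ((List.finRange m).foldl (slotStep M f δ y J) ([], fun _ => none))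

variable {M f}

/-- The output of an execution, and bounds that hold for every arrival order and all coins. -/
theorem execute_spec [Fintype α] (hf : Monotone f) {k β : ℕ} {ε : ℝ}
    (hk : ∀ S : Finset α, M.Indep (S : Set α) → #S ≤ k)
    (hδ : 0 ≤ Real.log (2 / (ε / 2))) (σ : Fin (Fintype.card α) ≃ α)
    (c : Coins (Fintype.card α) (k * β)) :
    output M f k β ε σ c =
        outputOf M f (ε / 2) (fun j => (blocks c.1 j).map σ) c.2 ∧
      ((shortlist M f k β ε σ c).card : ℝ) ≤ (k * β : ℕ) * (4 * Real.log (2 / (ε / 2)) + 1) ∧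
      runningTime M f k β ε σ c ≤ Fintype.card α + 2 * (k * β) + (k * β) * (5 * k + 10) +
        Fintype.card α * (4 * k + 8) + k * (k * β) ∧
      output M f k β ε σ c ⊆ shortlist M f k β ε σ c ∧
      M.Indep (output M f k β ε σ c : Set α) := by
  set y : Fin (k * β) → List α := fun j => (blocks c.1 j).map σ with hy
  have hfm : (List.finRange (k * β)).flatMap y = (List.finRange _).map σ := by
    rw [← flatMap_blocks c.1, List.map_flatMap]
  have hlen : (fun j => #{i | c.1 i = j}) = fun j => (y j).length := by
    funext j
    rw [hy, List.length_map, length_blocks]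
  let s0 : RunState α :=
    ⟨(List.finRange _).map σ, none, ∅, 0 + (Fintype.card α + 2 * (k * β))⟩
  obtain ⟨s', g1, g2, g3, g4, g5, g6⟩ := run_slots (M := M) hf hk hδ y c.2
    (List.finRange (k * β)) ([], fun _ => none) s0 hfm.symm (by simp) (by simp) (by simp)
  set st := (List.finRange (k * β)).foldl (slotStep M f (ε / 2) y c.2) ([], fun _ => none)
    with hst
  have hex : execute M f k β ε σ c =
      (keptItems st, { s' with steps := s'.steps + st.1.length * (k * β) }) := by
    unfold execute algorithm
    rw [run_bind]
    have e1 : (ticks (Fintype.card α + 2 * (k * β)) : OnlineProg α _).run M f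
        ⟨(List.finRange _).map σ, none, ∅, 0⟩ = ((), s0) := rfl
    rw [e1, run_bind, hlen, g1]
    rfl
  have hout : output M f k β ε σ c = keptItems st := by rw [output, hex]
  have hsl : shortlist M f k β ε σ c = s'.shortlist := by rw [shortlist, hex]
  have hSH : st.1.length ≤ k := by
    rw [← List.toFinset_card_of_nodup g3]
    exact hk _ g4
  refine ⟨hout, ?_, ?_, ?_, ?_⟩
  · rw [hsl]
    rw [List.length_finRange] at g5
    simpa [s0] using g5
  · have : runningTime M f k β ε σ c = s'.steps + st.1.length * (k * β) := by
      rw [runningTime, hex]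
    rw [this]
    rw [hfm, List.length_map, List.length_finRange, List.length_finRange] at g6
    have h2 : st.1.length * (k * β) ≤ k * (k * β) := Nat.mul_le_mul_right _ hSH
    have h3 : s0.steps = 0 + (Fintype.card α + 2 * (k * β)) := rfl
    omega
  · rw [hout, hsl]
    intro x hx
    obtain ⟨-, j, hj⟩ := mem_filter.1 hx
    exact g2 j x hj
  · rw [hout]
    exact g4.subset (by exact_mod_cast filter_subset _ _)

end

end MatroidShortlist

/-! ### Uniform averages over functions, and lists without repetitions -/

section

variable {α ι β : Type}

/-- Replacing one coordinate of a uniformly random function by an independent uniformly random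
value does not change its distribution. -/
theorem expect_update [Fintype ι] [DecidableEq ι] [Fintype β]
    (F : (ι → β) → ℝ) (i : ι) : 𝔼 x, F x = 𝔼 x : ι → β, 𝔼 y : β, F (Function.update x i y) := by
  rcases isEmpty_or_nonempty β with h | h
  · have : IsEmpty (ι → β) := ⟨fun x => h.elim (x i)⟩
    simp
  have h1 : ∑ p : (ι → β) × β, F (Function.update p.1 i p.2) = ∑ p : (ι → β) × β, F p.1 := by
    refine Finset.sum_nbij' (fun p => (Function.update p.1 i p.2, p.1 i))
      (fun p => (Function.update p.1 i p.2, p.1 i)) (by simp) (by simp) ?_ ?_ ?_ <;>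
    · rintro ⟨x, y⟩ -
      simp
  rw [Fintype.sum_prod_type, Fintype.sum_prod_type] at h1
  simp only [sum_const, card_univ, nsmul_eq_mul, ← mul_sum] at h1
  simp only [Fintype.expect_eq_sum_div_card, ← sum_div]
  rw [h1, mul_div_cancel_left₀ _ (Nat.cast_ne_zero.2 Fintype.card_ne_zero)]

theorem expect_prod [Fintype ι] [Fintype β] (F : ι × β → ℝ) :
    𝔼 p, F p = 𝔼 a, 𝔼 b, F (a, b) := by
  rw [← Finset.expect_product, univ_product_univ]

theorem exists_perm_map_eq [Fintype α] [DecidableEq α] {l l' : List α} (h : l.Nodup)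
    (hp : l.Perm l') : ∃ π : Equiv.Perm α, l.map π = l' := by
  have h' : l'.Nodup := hp.nodup_iff.1 h
  have hlen := hp.length_eq
  let e : {x // x ∈ l} ≃ {x // x ∈ l'} :=
    (h.getEquiv l).symm.trans ((finCongr hlen).trans (h'.getEquiv l'))
  refine ⟨e.extendSubtype, ?_⟩
  refine List.ext_getElem (by simpa using hlen) fun i h1 h2 => ?_
  rw [List.getElem_map, Equiv.extendSubtype_apply_of_mem _ _ (List.getElem_mem _)]
  have h3 : i < l.length := by simpa using h1
  have : (h.getEquiv l).symm ⟨l[i], List.getElem_mem _⟩ = ⟨i, h3⟩ := by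
    rw [Equiv.symm_apply_eq]
    rfl
  simp only [e, Equiv.trans_apply, this]
  rfl

theorem flatMap_injOn {y y' : ι → List α} {l : List ι}
    (hlen : ∀ j ∈ l, (y j).length = (y' j).length)
    (h : l.flatMap y = l.flatMap y') : ∀ j ∈ l, y j = y' j := by
  induction l with
  | nil => simp
  | cons a l ih =>
    rw [List.flatMap_cons, List.flatMap_cons] at h
    obtain ⟨h1, h2⟩ := List.append_inj h (hlen a List.mem_cons_self)
    intro j hj
    rcases List.mem_cons.1 hj with rfl | hj
    · exact h1
    · exact ih (fun j hj => hlen j (List.mem_cons_of_mem _ hj)) h2 j hj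

end

/-! ### Random slot sizes and a random order as a random assignment of the items to slots -/

namespace MatroidShortlist

section

variable {α : Type}

/-- The items of the slot `j`, in the order `τ`, for the assignment `χ` of items to slots. -/
def slotItems {m n : ℕ} (χ : α → Fin m) (τ : Fin n ≃ α) (j : Fin m) : List α :=
  ((List.finRange n).map τ).filter fun x => χ x = j

theorem mem_slotItems {m n : ℕ} {χ : α → Fin m} {τ : Fin n ≃ α} {j : Fin m} {x : α} :
    x ∈ slotItems χ τ j ↔ χ x = j := by
  simp only [slotItems, List.mem_filter, List.mem_map, List.mem_finRange, true_and,
    decide_eq_true_eq, and_iff_right_iff_imp]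
  exact fun _ => ⟨τ.symm x, by simp⟩

theorem nodup_map_finRange {n : ℕ} (τ : Fin n ≃ α) : ((List.finRange n).map τ).Nodup :=
  (List.nodup_finRange n).map τ.injective

theorem nodup_slotItems {m n : ℕ} (χ : α → Fin m) (τ : Fin n ≃ α) (j : Fin m) :
    (slotItems χ τ j).Nodup := (nodup_map_finRange τ).filter _

theorem map_slotItems {m n : ℕ} (χ : α → Fin m) (τ : Fin n ≃ α) (j : Fin m)
    (π : Equiv.Perm α) :
    (slotItems χ τ j).map π = slotItems (χ ∘ π.symm) (τ.trans π) j := by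
  unfold slotItems
  rw [List.filter_map, List.filter_map, List.map_map]
  congr 1
  refine List.filter_congr fun i _ => ?_
  simp

/-- The blocks of the positions can be relabelled so that they become the given slots, if the
sizes are right. -/
theorem exists_relabel [Fintype α] {m : ℕ} (χ : α → Fin m)
    (τ : Fin m → (Fin (Fintype.card α) ≃ α)) (σ₀ : Fin (Fintype.card α) ≃ α) :
    ∃ σ : Fin (Fintype.card α) ≃ α,
      ∀ j, (blocks (χ ∘ σ₀) j).map σ = slotItems χ (τ j) j := by
  classical
  set L := (List.finRange m).flatMap fun j => slotItems χ (τ j) j with hL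
  have hnd : L.Nodup := by
    rw [hL, List.nodup_flatMap]
    refine ⟨fun j _ => nodup_slotItems _ _ _, ?_⟩
    refine (List.nodup_finRange m).imp fun {i j} hij x hx hx' => hij ?_
    rw [← mem_slotItems.1 hx, mem_slotItems.1 hx']
  have hall : ∀ x, x ∈ L := fun x => by
    rw [hL, List.mem_flatMap]
    exact ⟨χ x, List.mem_finRange _, mem_slotItems.2 rfl⟩
  have hlen : Fintype.card α = L.length := by
    rw [← List.toFinset_card_of_nodup hnd, ← Finset.card_univ]
    congr 1
    ext x
    simp [hall x]
  let σ : Fin (Fintype.card α) ≃ α :=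
    (finCongr hlen).trans (hnd.getEquivOfForallMemList L hall)
  have hσ : (List.finRange (Fintype.card α)).map σ = L := by
    refine List.ext_getElem (by simp [hlen]) fun i h1 h2 => ?_
    simp [σ]
  refine ⟨σ, fun j => ?_⟩
  refine flatMap_injOn (y := fun j => (blocks (χ ∘ σ₀) j).map σ)
    (y' := fun j => slotItems χ (τ j) j) (l := List.finRange m) ?_ ?_ j (List.mem_finRange j)
  · intro j _
    rw [List.length_map, length_blocks, ← List.toFinset_card_of_nodup (nodup_slotItems _ _ _)]
    rw [← Finset.card_map σ₀.toEmbedding]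
    congr 1
    ext x
    simp only [mem_map, mem_filter, mem_univ, true_and, List.mem_toFinset, mem_slotItems]
    constructor
    · rintro ⟨i, hi, rfl⟩
      exact hi
    · exact fun h => ⟨σ₀.symm x, by simpa using h, by simp⟩
  · rw [← hL, ← hσ, ← flatMap_blocks (χ ∘ σ₀), List.map_flatMap]

/-- Cutting a random arrival order into slots with the loads of random bins amounts to assigning
the items to slots independently and uniformly at random, and ordering the items of each slot
uniformly at random, independently of the other slots. Both distributions are invariant under
permutations of the items, and the vectors of slot sizes have the same distribution. -/
theorem expect_blocks_eq_expect_slotItems [Fintype α] [DecidableEq α] {m : ℕ}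
    (F : (Fin m → List α) → ℝ) :
    𝔼 σ : Fin (Fintype.card α) ≃ α, 𝔼 b : Fin (Fintype.card α) → Fin m,
        F (fun j => (blocks b j).map σ) =
      𝔼 χ : α → Fin m, 𝔼 τ : Fin m → (Fin (Fintype.card α) ≃ α),
        F (fun j => slotItems χ (τ j) j) := by
  let σ₀ : Fin (Fintype.card α) ≃ α := (Fintype.equivFin α).symm
  have : Nonempty (Fin m → (Fin (Fintype.card α) ≃ α)) := ⟨fun _ => σ₀⟩
  let Ψ : (Fin (Fintype.card α) → Fin m) → ℝ := fun b =>
    𝔼 σ : Fin (Fintype.card α) ≃ α, F (fun j => (blocks b j).map σ)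
  have h1 : ∀ (χ : α → Fin m) (τ : Fin m → (Fin (Fintype.card α) ≃ α)),
      𝔼 π : Equiv.Perm α, F (fun j => (slotItems χ (τ j) j).map π) = Ψ (χ ∘ σ₀) := by
    intro χ τ
    obtain ⟨σ, hσ⟩ := exists_relabel χ τ σ₀
    let e : Equiv.Perm α ≃ (Fin (Fintype.card α) ≃ α) :=
      ⟨fun π => σ.trans π, fun ρ => σ.symm.trans ρ, fun π => by ext; simp, fun ρ => by ext; simp⟩
    refine Fintype.expect_equiv e _ _ fun π => ?_
    congr 1
    funext j
    rw [← hσ j, List.map_map]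
    rfl
  have h2 : ∀ π : Equiv.Perm α, 𝔼 χ : α → Fin m, 𝔼 τ : Fin m → (Fin (Fintype.card α) ≃ α),
        F (fun j => slotItems χ (τ j) j) =
      𝔼 χ : α → Fin m, 𝔼 τ : Fin m → (Fin (Fintype.card α) ≃ α),
        F (fun j => (slotItems χ (τ j) j).map π) := by
    intro π
    symm
    refine Fintype.expect_equiv (π.arrowCongr (Equiv.refl _)) _ _ fun χ => ?_
    let e : (Fin (Fintype.card α) ≃ α) ≃ (Fin (Fintype.card α) ≃ α) :=
      ⟨fun ρ => ρ.trans π, fun ρ => ρ.trans π.symm, fun ρ => by ext; simp, fun ρ => by ext; simp⟩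
    refine Fintype.expect_equiv ((Equiv.refl (Fin m)).arrowCongr e) _ _ fun τ => ?_
    congr 1
    funext j
    rw [map_slotItems]
    rfl
  calc _ = 𝔼 b, Ψ b := Finset.expect_comm _ _ _
    _ = 𝔼 χ : α → Fin m, Ψ (χ ∘ σ₀) := by
        symm
        refine Fintype.expect_equiv (σ₀.symm.arrowCongr (Equiv.refl _)) _ _ fun χ => ?_
        rfl
    _ = 𝔼 χ : α → Fin m, 𝔼 τ : Fin m → (Fin (Fintype.card α) ≃ α), 𝔼 π : Equiv.Perm α,
          F (fun j => (slotItems χ (τ j) j).map π) := by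
        simp only [h1, Fintype.expect_const]
    _ = 𝔼 π : Equiv.Perm α, 𝔼 χ : α → Fin m, 𝔼 τ : Fin m → (Fin (Fintype.card α) ≃ α),
          F (fun j => (slotItems χ (τ j) j).map π) :=
        (Finset.expect_congr rfl fun χ _ => Finset.expect_comm _ _ _).trans
          (Finset.expect_comm _ _ _)
    _ = _ := (Finset.expect_congr rfl fun π _ => (h2 π).symm).trans (Fintype.expect_const _)

end

end MatroidShortlist

/-! ### The failure probability of the online max algorithm -/

namespace MatroidShortlist

section

variable {α : Type} [DecidableEq α]

/-- The lists that contain each element of `B` exactly once. -/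
def orders (B : Finset α) : Finset (List α) := ⟨B.val.lists, Multiset.lists_nodup_finset B⟩

theorem mem_orders {B : Finset α} {l : List α} : l ∈ orders B ↔ l.Nodup ∧ l.toFinset = B := by
  have h : l ∈ orders B ↔ B.val = (l : Multiset α) := by
    change l ∈ B.val.lists ↔ _
    exact Multiset.mem_lists_iff _ _
  rw [h]
  constructor
  · intro h
    have hn : l.Nodup := Multiset.coe_nodup.1 (h ▸ B.nodup)
    refine ⟨hn, Finset.val_injective ?_⟩
    rw [h, List.toFinset_val, hn.dedup]
  · rintro ⟨hn, rfl⟩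
    rw [List.toFinset_val, hn.dedup]

theorem orders_nonempty (B : Finset α) : (orders B).Nonempty :=
  ⟨B.toList, mem_orders.2 ⟨B.nodup_toList, B.toList_toFinset⟩⟩

theorem card_orders (B : Finset α) : #(orders B) = (#B).factorial := by
  have h : ((B.toList : List α) : Multiset α) = B.val := B.coe_toList
  change Multiset.card B.val.lists = _
  rw [← h, Multiset.lists_coe, Multiset.coe_card, List.length_permutations, B.length_toList]

theorem length_of_mem_orders {B : Finset α} {l : List α} (h : l ∈ orders B) : l.length = #B := by
  obtain ⟨h1, rfl⟩ := mem_orders.1 h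
  rw [List.toFinset_card_of_nodup h1]

/-- A uniformly random order of `B` consists of a uniformly random last element and a uniformly
random order of the other elements. -/
theorem card_mul_expect_orders (B : Finset α) (hB : B.Nonempty) (F : List α → ℝ) :
    #B * 𝔼 l ∈ orders B, F l = ∑ x ∈ B, 𝔼 l ∈ orders (B.erase x), F (l ++ [x]) := by
  have hsum : ∑ l ∈ orders B, F l = ∑ x ∈ B, ∑ l ∈ orders (B.erase x), F (l ++ [x]) := by
    rw [sum_sigma']
    symm
    refine sum_bij (fun p _ => p.2 ++ [p.1]) ?_ ?_ ?_ ?_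
    · rintro ⟨x, l⟩ h
      obtain ⟨hx, hl⟩ := mem_sigma.1 h
      obtain ⟨h1, h2⟩ := mem_orders.1 hl
      dsimp only at hx h1 h2 ⊢
      have hxl : x ∉ l := fun h => by
        have := List.mem_toFinset.2 h
        rw [h2] at this
        exact absurd rfl (mem_erase.1 this).1
      refine mem_orders.2 ⟨?_, ?_⟩
      · rw [List.nodup_append]
        exact ⟨h1, by simp, by rintro a ha b hb rfl; exact hxl (List.mem_singleton.1 hb ▸ ha)⟩
      · rw [List.toFinset_append, h2]
        ext z
        by_cases hz : z = x
        · simp [hz, hx]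
        · simp [hz]
    · rintro ⟨x, l⟩ - ⟨x', l'⟩ - h
      obtain ⟨rfl, h2⟩ := List.append_inj' h rfl
      obtain rfl : x = x' := by simpa using h2
      rfl
    · intro l hl
      obtain ⟨h1, h2⟩ := mem_orders.1 hl
      have hne : l ≠ [] := by
        rintro rfl
        exact hB.ne_empty (by simpa using h2.symm)
      have hl' := List.dropLast_append_getLast hne
      have hn : (l.dropLast ++ [l.getLast hne]).Nodup := by rwa [hl']
      rw [List.nodup_append] at hn
      refine ⟨⟨l.getLast hne, l.dropLast⟩, ?_, hl'⟩
      refine mem_sigma.2 ⟨?_, mem_orders.2 ⟨hn.1, ?_⟩⟩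
      · rw [← h2]
        exact List.mem_toFinset.2 (List.getLast_mem hne)
      · have h3 : B = insert (l.getLast hne) l.dropLast.toFinset := by
          conv_lhs => rw [← h2, ← hl']
          ext; simp
        rw [h3, erase_insert]
        intro hm
        exact hn.2.2 _ (List.mem_toFinset.1 hm) _ (List.mem_singleton_self _) rfl
    · rintro ⟨x, l⟩ -
      rfl
  obtain ⟨N, hN⟩ : ∃ N, #B = N + 1 := Nat.exists_eq_succ_of_ne_zero hB.card_ne_zero
  have h1 : ∀ x ∈ B, 𝔼 l ∈ orders (B.erase x), F (l ++ [x]) =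
      (∑ l ∈ orders (B.erase x), F (l ++ [x])) / (N.factorial : ℝ) := by
    intro x hx
    rw [Finset.expect_eq_sum_div_card, card_orders, card_erase_of_mem hx, hN, Nat.add_sub_cancel]
  rw [sum_congr rfl h1, ← sum_div, ← hsum, Finset.expect_eq_sum_div_card, card_orders, hN,
    Nat.factorial_succ]
  have : (N.factorial : ℝ) ≠ 0 := by positivity
  push_cast
  field_simp

/-- The elements of `B`, in the order `τ`. -/
def orderOf {n : ℕ} (τ : Fin n ≃ α) (B : Finset α) : List α :=
  ((List.finRange n).map τ).filter fun x => x ∈ B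

theorem orderOf_mem_orders {n : ℕ} (τ : Fin n ≃ α) (B : Finset α) :
    orderOf τ B ∈ orders B := by
  refine mem_orders.2 ⟨(nodup_map_finRange τ).filter _, ?_⟩
  ext x
  simp only [orderOf, List.mem_toFinset, List.mem_filter, List.mem_map, List.mem_finRange,
    true_and, decide_eq_true_eq, and_iff_right_iff_imp]
  exact fun _ => ⟨τ.symm x, by simp⟩

/-- A uniformly random order of all items induces a uniformly random order of `B`. -/
theorem expect_orderOf [Fintype α] (B : Finset α) (F : List α → ℝ) :
    𝔼 τ : Fin (Fintype.card α) ≃ α, F (orderOf τ B) = 𝔼 l ∈ orders B, F l := by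
  have : Nonempty (Fin (Fintype.card α) ≃ α) := ⟨(Fintype.equivFin α).symm⟩
  -- All orders of `B` are induced by equally many orders of all items.
  have hfib : ∀ l ∈ orders B, ∀ l' ∈ orders B,
      #{τ : Fin (Fintype.card α) ≃ α | orderOf τ B = l} ≤
        #{τ : Fin (Fintype.card α) ≃ α | orderOf τ B = l'} := by
    intro l hl l' hl'
    obtain ⟨h1, h2⟩ := mem_orders.1 hl
    obtain ⟨h1', h2'⟩ := mem_orders.1 hl'
    obtain ⟨π, hπ⟩ := exists_perm_map_eq h1 ((List.perm_ext_iff_of_nodup h1 h1').2 fun x => by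
      rw [← List.mem_toFinset, ← List.mem_toFinset, h2, h2'])
    have hB : ∀ x, π x ∈ B ↔ x ∈ B := by
      have him : B.map π.toEmbedding = B := by
        rw [← h2']
        conv_lhs => rw [h2', ← h2]
        rw [← hπ]
        ext x
        simp only [mem_map_equiv, List.mem_toFinset, List.mem_map]
        exact ⟨fun h => ⟨_, h, by simp⟩, by rintro ⟨y, hy, rfl⟩; simpa using hy⟩
      intro x
      conv_lhs => rw [← him]
      simp
    refine card_le_card_of_injOn (fun τ => τ.trans π) ?_ ?_
    · intro τ hτ
      have hτ : orderOf τ B = l := by simpa using hτ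
      have : orderOf (τ.trans π) B = (orderOf τ B).map π := by
        unfold orderOf
        rw [List.filter_map, List.filter_map, List.map_map]
        congr 1
        refine List.filter_congr fun i _ => ?_
        simp [hB]
      simp [this, hτ, hπ]
    · intro τ _ τ' _ h
      ext i
      have := congrArg (fun e => π.symm (e i)) h
      simpa using this
  obtain ⟨l₀, hl₀⟩ := orders_nonempty B
  set K := #{τ : Fin (Fintype.card α) ≃ α | orderOf τ B = l₀} with hK
  have hKl : ∀ l ∈ orders B, #{τ : Fin (Fintype.card α) ≃ α | orderOf τ B = l} = K :=
    fun l hl => le_antisymm (hfib l hl _ hl₀) (hfib _ hl₀ l hl)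
  have hmaps : ∀ τ ∈ (univ : Finset (Fin (Fintype.card α) ≃ α)), orderOf τ B ∈ orders B :=
    fun τ _ => orderOf_mem_orders τ B
  have hsum : ∀ G : List α → ℝ, ∑ τ : Fin (Fintype.card α) ≃ α, G (orderOf τ B) =
      K * ∑ l ∈ orders B, G l := by
    intro G
    rw [← sum_fiberwise_of_maps_to hmaps, mul_sum]
    refine sum_congr rfl fun l hl => ?_
    rw [sum_congr rfl (g := fun _ => G l) fun τ hτ => by rw [(mem_filter.1 hτ).2], sum_const,
      hKl l hl, nsmul_eq_mul]
  have hcard := hsum fun _ => 1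
  simp only [sum_const, card_univ, nsmul_eq_mul, mul_one] at hcard
  have hpos : (Fintype.card (Fin (Fintype.card α) ≃ α) : ℝ) ≠ 0 :=
    Nat.cast_ne_zero.2 Fintype.card_ne_zero
  rw [Fintype.expect_eq_sum_div_card, Finset.expect_eq_sum_div_card, hsum, hcard]
  rw [hcard] at hpos
  exact mul_div_mul_left _ _ (left_ne_zero_of_mul hpos)

end

section

variable {α : Type} [LinearOrder α] (M : Matroid α) (f : Finset α → ℝ)

/-- The online max algorithm on the list `l` finds a best item but does not select it. -/
def Misses (S : List α) (u L : ℝ) (l : List α) : Prop :=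
  ∃ c, (maxRun M f S u L l).2.1 = some c ∧ c.item ∉ (maxRun M f S u L l).2.2

variable {M f}

/-- The last round on an order of `B` that ends with `x`. If `x` is the best item of `B`, it is
selected exactly when neither the position nor the capacity forbids it; otherwise the last round
changes neither the best item nor the selection. -/
theorem maxRun_concat_cases (S : List α) (u L : ℝ) {B : Finset α} {x : α} (hx : x ∈ B)
    {l : List α} (hl : l ∈ orders (B.erase x)) :
    ((∃ c, IsBest M f S B c ∧ c.item = x) ∧
      (u ≤ (#B : ℝ) ∧ ((maxRun M f S u L l).2.2.length : ℝ) < L →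
        (maxRun M f S u L (l ++ [x])).2.2 = x :: (maxRun M f S u L l).2.2) ∧
      (¬ (u ≤ (#B : ℝ) ∧ ((maxRun M f S u L l).2.2.length : ℝ) < L) →
        (maxRun M f S u L (l ++ [x])).2.2 = (maxRun M f S u L l).2.2)) ∨
    ((¬ ∃ c, IsBest M f S B c ∧ c.item = x) ∧
      (maxRun M f S u L (l ++ [x])).2 = (maxRun M f S u L l).2) := by
  have hpos : (maxRun M f S u L l).1 = #B := by
    rw [maxRun_fst, length_of_mem_orders hl, card_erase_add_one hx]
  have hlB := (mem_orders.1 hl).2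
  have hmax := maxRun_isMaximum (M := M) (f := f) S u L l
  have hmax' := maxRun_isMaximum (M := M) (f := f) S u L (l ++ [x])
  rw [show (l ++ [x]).toFinset = B by
    rw [List.toFinset_append, hlB]; ext z; by_cases hz : z = x <;> simp [hz, hx]] at hmax'
  rw [hlB] at hmax
  rw [maxRun_concat] at hmax' ⊢
  unfold maxStep at hmax' ⊢
  cases hc : candidate M f S x with
  | none =>
    refine Or.inr ⟨?_, rfl⟩
    rintro ⟨c, hb, rfl⟩
    rw [hb.2.1] at hc
    cases hc
  | some c =>
    have hcx := (candidate_spec hc).1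
    rw [hc] at hmax'
    dsimp only at hmax' ⊢
    rw [hpos] at hmax' ⊢
    by_cases hb : c.beats (maxRun M f S u L l).2.1 = true
    · rw [if_pos hb] at hmax' ⊢
      left
      constructor
      · refine ⟨c, ?_, hcx⟩
        refine hmax'.1 c ?_
        split_ifs <;> rfl
      · refine ⟨fun h => ?_, fun h => ?_⟩
        · rw [if_pos h]
        · rw [if_neg h]
    · rw [if_neg hb] at hmax' ⊢
      refine Or.inr ⟨?_, rfl⟩
      rintro ⟨d, hd, hdx⟩
      rcases hbest : (maxRun M f S u L l).2.1 with _ | b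
      · rw [hbest] at hb
        exact hb rfl
      · have h1 := hmax'.1 b hbest
        have h2 := (hmax.1 b hbest).1
        rw [h1.unique hd, hdx] at h2
        exact absurd rfl (mem_erase.1 h2).1

open Classical in
theorem card_isBest_le_one (S : List α) (B : Finset α) :
    #{x ∈ B | ∃ c, IsBest M f S B c ∧ c.item = x} ≤ 1 := by
  refine card_le_one.2 fun x hx y hy => ?_
  obtain ⟨-, c, hc, rfl⟩ := mem_filter.1 hx
  obtain ⟨-, d, hd, rfl⟩ := mem_filter.1 hy
  rw [hc.unique hd]

/-- The number of selected items has a small exponential moment: the item at position `i ≥ a` is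
the best one so far with probability at most `1 / i`, independently of what was selected before,
and the product of the factors `1 + 1 / i` telescopes. The hypothesis `hu` says that `a` is the
first position at which items may be selected. -/
theorem expect_two_pow_le (S : List α) {u : ℝ} (L : ℝ) {a : ℕ} (ha : 1 ≤ a)
    (hu : ∀ i : ℕ, 1 ≤ i → (u ≤ i ↔ a ≤ i)) (B : Finset α) :
    𝔼 l ∈ orders B, (2 : ℝ) ^ (maxRun M f S u L l).2.2.length ≤
      max 1 (((#B : ℝ) + 1) / a) := by
  classical
  induction hN : #B generalizing B with
  | zero =>
    obtain rfl := card_eq_zero.1 hN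
    refine le_trans ?_ (le_max_left _ _)
    rw [Finset.expect_eq_sum_div_card, card_orders]
    have : orders (∅ : Finset α) = {[]} := by
      ext l; simp [mem_orders]; rintro rfl; simp
    simp [this, maxRun]
  | succ N ih =>
    have hB : B.Nonempty := card_pos.1 (by omega)
    have hapos : (0 : ℝ) < a := by exact_mod_cast ha
    have hrec := card_mul_expect_orders B hB
      fun l => (2 : ℝ) ^ (maxRun M f S u L l).2.2.length
    rw [hN] at hrec
    have hterm : ∀ x ∈ B, 𝔼 l ∈ orders (B.erase x),
        (2 : ℝ) ^ (maxRun M f S u L (l ++ [x])).2.2.length ≤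
        max 1 (((N : ℝ) + 1) / a) * (1 + if a ≤ N + 1 then
          (if ∃ c, IsBest M f S B c ∧ c.item = x then 1 else 0) else 0) := by
      intro x hx
      have h1 := ih (B.erase x) (by rw [card_erase_of_mem hx, hN]; rfl)
      refine le_trans ?_ (mul_le_mul_of_nonneg_right h1 (by positivity))
      rw [Finset.expect_mul]
      refine expect_le_expect fun l hl => ?_
      have hu' := hu (N + 1) (by omega)
      rcases maxRun_concat_cases (M := M) (f := f) S u L hx hl with ⟨h1, h2, h3⟩ | ⟨h1, h2⟩
      · rw [if_pos h1]
        rw [hN] at h2 h3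
        by_cases haN : a ≤ N + 1
        · rw [if_pos haN]
          by_cases hsel : u ≤ ((N + 1 : ℕ) : ℝ) ∧ ((maxRun M f S u L l).2.2.length : ℝ) < L
          · rw [h2 hsel, List.length_cons, pow_succ]
            exact mul_le_mul_of_nonneg_left (by norm_num) (by positivity)
          · rw [h3 hsel]
            exact le_mul_of_one_le_right (by positivity) (by norm_num)
        · rw [h3 fun h => haN (hu'.1 h.1), if_neg haN]
          simp
      · rw [h2]
        exact le_mul_of_one_le_right (by positivity) (by
          rw [if_neg h1]; simp)
    have hsum := sum_le_sum hterm
    rw [← hrec, ← mul_sum, sum_add_distrib] at hsum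
    have hcnt : ∑ x ∈ B, (if a ≤ N + 1 then
          (if ∃ c, IsBest M f S B c ∧ c.item = x then (1 : ℝ) else 0) else 0) ≤
        if a ≤ N + 1 then 1 else 0 := by
      split_ifs
      · rw [sum_boole]
        exact_mod_cast card_isBest_le_one S B
      · simp
    have hle : ((N + 1 : ℕ) : ℝ) *
        𝔼 l ∈ orders B, (2 : ℝ) ^ (maxRun M f S u L l).2.2.length ≤
        max 1 (((N : ℝ) + 1) / a) * ((N + 1) + if a ≤ N + 1 then 1 else 0) := by
      refine hsum.trans (mul_le_mul_of_nonneg_left ?_ (by positivity))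
      rw [sum_const, hN, nsmul_eq_mul, mul_one]
      push_cast
      linarith
    have hNpos : (0 : ℝ) < N + 1 := by positivity
    push_cast at hle ⊢
    refine le_of_mul_le_mul_left (hle.trans ?_) hNpos
    by_cases haN : a ≤ N + 1
    · have haN' : (a : ℝ) ≤ N + 1 := by exact_mod_cast haN
      rw [if_pos haN, max_eq_right ((one_le_div hapos).2 haN'),
        max_eq_right ((one_le_div hapos).2 (by linarith))]
      apply le_of_eq
      ring
    · have haN' : (N : ℝ) + 1 ≤ a := by exact_mod_cast (not_le.1 haN).le
      rw [if_neg haN, max_eq_left ((div_le_one hapos).2 haN'), add_zero, one_mul]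
      exact le_mul_of_one_le_right hNpos.le (le_max_left _ _)

open Classical in
/-- The best item is missed only if it arrives before position `a`, or if the capacity `L` is
exhausted when it arrives. The latter is bounded by Markov's inequality for the exponential moment
of the number of selected items. -/
theorem card_mul_expect_misses_le (S : List α) {u : ℝ} (L : ℝ) {a : ℕ} (ha : 1 ≤ a)
    (hu : ∀ i : ℕ, 1 ≤ i → (u ≤ i ↔ a ≤ i)) (B : Finset α) :
    #B * 𝔼 l ∈ orders B, (if Misses M f S u L l then (1 : ℝ) else 0) ≤
      (a - 1) + (#B : ℝ) ^ 2 / a * (2 : ℝ) ^ (-L) := by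
  have hapos : (0 : ℝ) < a := by exact_mod_cast ha
  have ha1 : (1 : ℝ) ≤ a := by exact_mod_cast ha
  have hL : (0 : ℝ) < (2 : ℝ) ^ (-L) := by positivity
  induction hN : #B generalizing B with
  | zero =>
    rw [Nat.cast_zero, zero_mul]
    have : (0 : ℝ) ≤ a - 1 := by linarith
    positivity
  | succ N ih =>
    have hB : B.Nonempty := card_pos.1 (by omega)
    by_cases haN : a ≤ N + 1
    swap
    · have h1 : 𝔼 l ∈ orders B, (if Misses M f S u L l then (1 : ℝ) else 0) ≤ 1 :=
        expect_le (orders_nonempty B) fun l _ => by split_ifs <;> norm_num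
      have h2 : ((N + 1 : ℕ) : ℝ) ≤ a - 1 := by
        have : ((N + 1 + 1 : ℕ) : ℝ) ≤ a := by exact_mod_cast not_le.1 haN
        push_cast at this ⊢
        linarith
      have h3 : 0 ≤ ((N + 1 : ℕ) : ℝ) ^ 2 / a * (2 : ℝ) ^ (-L) := by positivity
      have h4 := mul_le_of_le_one_right (Nat.cast_nonneg (α := ℝ) (N + 1)) h1
      linarith
    by_cases hbest : ∃ c, IsBest M f S B c
    swap
    · have h1 : 𝔼 l ∈ orders B, (if Misses M f S u L l then (1 : ℝ) else 0) = 0 := by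
        refine expect_eq_zero fun l hl => if_neg ?_
        rintro ⟨c, hc, -⟩
        have := (maxRun_isMaximum (M := M) (f := f) S u L l).1 c hc
        rw [(mem_orders.1 hl).2] at this
        exact hbest ⟨c, this⟩
      have : (0 : ℝ) ≤ a - 1 := by linarith
      rw [h1, mul_zero]
      positivity
    obtain ⟨c, hc⟩ := hbest
    have hrec := card_mul_expect_orders B hB
      fun l => if Misses M f S u L l then (1 : ℝ) else 0
    rw [hN] at hrec
    rw [hrec, ← add_sum_erase _ _ hc.1]
    have hu' := (hu (N + 1) (by omega)).2 haN
    have hlast : 𝔼 l ∈ orders (B.erase c.item),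
        (if Misses M f S u L (l ++ [c.item]) then (1 : ℝ) else 0) ≤
          (N + 1) / a * (2 : ℝ) ^ (-L) := by
      have h1 := expect_two_pow_le (M := M) (f := f) S L ha hu (B.erase c.item)
      rw [card_erase_of_mem hc.1, hN, Nat.add_sub_cancel, max_eq_right ((one_le_div hapos).2
        (by exact_mod_cast haN : (a : ℝ) ≤ N + 1))] at h1
      refine le_trans ?_ (mul_le_mul_of_nonneg_right h1 hL.le)
      rw [Finset.expect_mul]
      refine expect_le_expect fun l hl => ?_
      split_ifs with hm
      · rcases maxRun_concat_cases (M := M) (f := f) S u L hc.1 hl with ⟨-, h2, h3⟩ | ⟨h1, -⟩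
        · rw [hN] at h2 h3
          by_cases hlen : ((maxRun M f S u L l).2.2.length : ℝ) < L
          · obtain ⟨d, hd, hd'⟩ := hm
            rw [h2 ⟨hu', hlen⟩] at hd'
            have hdB := (maxRun_isMaximum (M := M) (f := f) S u L (l ++ [c.item])).1 d hd
            rw [show (l ++ [c.item]).toFinset = B by
              rw [List.toFinset_append, (mem_orders.1 hl).2]
              ext z
              by_cases hz : z = c.item <;> simp [hz, hc.1]] at hdB
            rw [hdB.unique hc] at hd'
            exact absurd List.mem_cons_self hd'
          · rw [← Real.rpow_natCast, ← Real.rpow_add two_pos]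
            exact Real.one_le_rpow (by norm_num) (by linarith)
        · exact absurd ⟨c, hc, rfl⟩ h1
      · positivity
    have hrest : ∑ x ∈ B.erase c.item, 𝔼 l ∈ orders (B.erase x),
        (if Misses M f S u L (l ++ [x]) then (1 : ℝ) else 0) ≤
          (a - 1) + (N : ℝ) ^ 2 / a * (2 : ℝ) ^ (-L) := by
      have hcardc : #(B.erase c.item) = N := by rw [card_erase_of_mem hc.1, hN]; rfl
      have ha0 : (0 : ℝ) ≤ a - 1 := by linarith
      rcases Nat.eq_zero_or_pos N with hN0 | hN0
      · rw [card_eq_zero.1 (hcardc.trans hN0), sum_empty]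
        positivity
      · have hNpos : (0 : ℝ) < N := by exact_mod_cast hN0
        refine (sum_le_card_nsmul _ _ (((a - 1) + (N : ℝ) ^ 2 / a * (2 : ℝ) ^ (-L)) / N)
          fun x hx => ?_).trans ?_
        · obtain ⟨hxc, hxB⟩ := mem_erase.1 hx
          rw [le_div_iff₀ hNpos, mul_comm]
          refine le_trans (mul_le_mul_of_nonneg_left ?_ hNpos.le) (ih (B.erase x)
            (by rw [card_erase_of_mem hxB, hN]; rfl))
          refine expect_le_expect fun l hl => ?_
          rcases maxRun_concat_cases (M := M) (f := f) S u L hxB hl with ⟨⟨d, hd, rfl⟩, -⟩ | ⟨-, h2⟩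
          · exact absurd (by rw [hd.unique hc]) hxc
          · have : Misses M f S u L (l ++ [x]) ↔ Misses M f S u L l := by
              unfold Misses; rw [h2]
            simp only [this, le_refl]
        · rw [hcardc, nsmul_eq_mul, mul_div_cancel₀ _ hNpos.ne']
    have hfin : ((N : ℝ) + 1) / a * (2 : ℝ) ^ (-L) + (N : ℝ) ^ 2 / a * (2 : ℝ) ^ (-L) ≤
        ((N + 1 : ℕ) : ℝ) ^ 2 / a * (2 : ℝ) ^ (-L) := by
      rw [← add_mul, ← add_div]
      refine mul_le_mul_of_nonneg_right (div_le_div_of_nonneg_right ?_ hapos.le) hL.le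
      push_cast
      nlinarith [Nat.cast_nonneg (α := ℝ) N]
    linarith

open Classical in
/-- The online max algorithm misses the best item of a randomly ordered set with probability at
most `3 δ / 4`. -/
theorem expect_misses_le [Fintype α] (S : List α) {δ : ℝ} (h0 : 0 < δ) (h1 : δ ≤ 1 / 2)
    (B : Finset α) :
    𝔼 τ : Fin (Fintype.card α) ≃ α, (if Misses M f S (#B * δ / 2) (4 * Real.log (2 / δ))
      (orderOf τ B) then (1 : ℝ) else 0) ≤ 3 / 4 * δ := by
  rw [expect_orderOf B fun l =>
    if Misses M f S (#B * δ / 2) (4 * Real.log (2 / δ)) l then (1 : ℝ) else 0]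
  rcases B.eq_empty_or_nonempty with rfl | hB
  · rw [expect_eq_zero]
    · positivity
    · intro l hl
      refine if_neg ?_
      rintro ⟨c, hc, -⟩
      have := (maxRun_isMaximum (M := M) (f := f) S _ _ l).1 c hc
      rw [(mem_orders.1 hl).2] at this
      exact absurd this.1 (notMem_empty _)
  have hN : (0 : ℝ) < #B := by exact_mod_cast hB.card_pos
  set a := max 1 ⌈(#B * δ / 2 : ℝ)⌉₊ with ha
  have hu : ∀ i : ℕ, 1 ≤ i → ((#B * δ / 2 : ℝ) ≤ i ↔ a ≤ i) := fun i hi => by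
    rw [ha, max_le_iff, Nat.ceil_le]
    exact ⟨fun h => ⟨hi, h⟩, fun h => h.2⟩
  have key := card_mul_expect_misses_le (M := M) (f := f) S (4 * Real.log (2 / δ))
    (le_max_left _ _ : 1 ≤ a) hu B
  have ha1 : (a : ℝ) - 1 ≤ #B * δ / 2 := by
    rw [ha, Nat.cast_max, sub_le_iff_le_add]
    refine max_le (by rw [Nat.cast_one]; have : 0 ≤ #B * δ / 2 := by positivity
                      linarith) (Nat.ceil_lt_add_one (by positivity)).le
  have ha2 : #B * δ / 2 ≤ a := by
    rw [ha, Nat.cast_max]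
    exact (Nat.le_ceil _).trans (le_max_right _ _)
  have hLpos : 0 < Real.log (2 / δ) := Real.log_pos (by rw [lt_div_iff₀ h0]; linarith)
  -- For `L = log (2 / δ)` the right-hand side is `exp (-2 L - log 2)`, and `L ≥ 2 log 2`.
  have hpow : (2 : ℝ) ^ (-(4 * Real.log (2 / δ))) ≤ (δ / 2) ^ 2 * (1 / 2) := by
    have hlog2 := Real.log_two_gt_d9
    have e1 : (δ / 2) ^ 2 * (1 / 2) = Real.exp (-(2 * Real.log (2 / δ)) - Real.log 2) := by
      rw [Real.exp_sub, Real.exp_log two_pos, Real.exp_neg, mul_comm 2, Real.exp_mul,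
        Real.exp_log (by positivity)]
      norm_num
      field_simp
    rw [e1, Real.rpow_def_of_pos two_pos]
    refine Real.exp_le_exp.2 ?_
    have h4 : 2 * Real.log 2 ≤ Real.log (2 / δ) := by
      rw [← Real.log_rpow two_pos]
      refine Real.log_le_log (by positivity) ?_
      rw [le_div_iff₀ h0]
      norm_num
      linarith
    nlinarith
  have hdiv : (#B : ℝ) ^ 2 / a ≤ #B * (2 / δ) := by
    rw [div_le_iff₀ (by exact_mod_cast (le_max_left _ _ : 1 ≤ a))]
    calc (#B : ℝ) ^ 2 = #B * (2 / δ) * (#B * δ / 2) := by field_simp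
      _ ≤ _ := mul_le_mul_of_nonneg_left ha2 (by positivity)
  have hfin : (#B : ℝ) ^ 2 / a * (2 : ℝ) ^ (-(4 * Real.log (2 / δ))) ≤ #B * (δ / 4) := by
    calc _ ≤ #B * (2 / δ) * ((δ / 2) ^ 2 * (1 / 2)) :=
          mul_le_mul hdiv hpow (by positivity) (by positivity)
      _ = #B * (δ / 4) := by field_simp; norm_num
  refine le_of_mul_le_mul_left (key.trans ?_) hN
  linarith

end

end MatroidShortlist

/-! ### The process on the slots -/

namespace MatroidShortlist

section

variable {α : Type} [LinearOrder α] [Fintype α] (M : Matroid α) (f : Finset α → ℝ) {m : ℕ}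

/-- The set of the items of the slot `s`. -/
def slotSet (χ : α → Fin m) (s : Fin m) : Finset α := {x | χ x = s}

/-- One slot of the algorithm, for the assignment `χ` of items to slots. The outcome of the online
max algorithm is an input: `ζ s S B` tells whether it selects the best item of `B` when it is run
in the slot `s` with the values `g(·, S)`. -/
noncomputable def processStep (χ : α → Fin m) (J : Fin m → Fin m)
    (ζ : Fin m → List α → Finset α → Bool) (st : List α × (Fin m → Option α)) (s : Fin m) :
    List α × (Fin m → Option α) :=
  (improve M f st.1 (slotSet χ s ∪ (st.2 (J s)).toFinset),
    match improver M f st.1 (slotSet χ s ∪ (st.2 (J s)).toFinset) with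
    | none => st.2
    | some c =>
      if c.item ∈ slotSet χ s ∧ ζ s st.1 (slotSet χ s) = true then
        Function.update st.2 s (some c.item)
      else st.2)

/-- The solution and the array after the first `t` slots. -/
noncomputable def process (χ : α → Fin m) (J : Fin m → Fin m)
    (ζ : Fin m → List α → Finset α → Bool) (t : ℕ) : List α × (Fin m → Option α) :=
  ((List.finRange m).take t).foldl (processStep M f χ J ζ) ([], fun _ => none)

/-- Whether the online max algorithm selects the best item of the slot `s` in the process. -/
noncomputable def success (χ : α → Fin m) (J : Fin m → Fin m)
    (ζ : Fin m → List α → Finset α → Bool) (s : Fin m) : Bool :=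
  ζ s (process M f χ J ζ s).1 (slotSet χ s)

open Classical in
/-- The outcomes of the online max algorithm when the items of the slot `s` arrive in the order
`τ s`. -/
noncomputable def outcome (δ : ℝ) (τ : Fin m → (Fin (Fintype.card α) ≃ α)) :
    Fin m → List α → Finset α → Bool :=
  fun s S B => decide (¬ Misses M f S (#B * δ / 2) (4 * Real.log (2 / δ)) (orderOf (τ s) B))

variable {M f}
variable {χ : α → Fin m} {J : Fin m → Fin m} {ζ : Fin m → List α → Finset α → Bool}

theorem mem_slotSet {s : Fin m} {x : α} : x ∈ slotSet χ s ↔ χ x = s := by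
  simp [slotSet]

theorem process_zero : process M f χ J ζ 0 = ([], fun _ => none) := rfl

theorem process_succ (s : Fin m) :
    process M f χ J ζ (s + 1) = processStep M f χ J ζ (process M f χ J ζ s) s := by
  unfold process
  rw [List.take_add_one, List.foldl_append]
  simp

/-- Two processes agree if each of their steps has the same effect on the states of the first. -/
theorem process_congr {χ' : α → Fin m} {J' : Fin m → Fin m}
    {ζ' : Fin m → List α → Finset α → Bool} {t : ℕ} (ht : t ≤ m)
    (h : ∀ s : Fin m, (s : ℕ) < t → processStep M f χ J ζ (process M f χ J ζ s) s =
      processStep M f χ' J' ζ' (process M f χ J ζ s) s) :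
    process M f χ J ζ t = process M f χ' J' ζ' t := by
  induction t with
  | zero => rfl
  | succ t ih =>
    have ih := ih (by omega) fun s hs => h s (by omega)
    have e1 := process_succ (M := M) (f := f) (χ := χ) (J := J) (ζ := ζ) ⟨t, ht⟩
    have e2 := process_succ (M := M) (f := f) (χ := χ') (J := J') (ζ := ζ') ⟨t, ht⟩
    dsimp only at e1 e2
    rw [e1, e2, h ⟨t, ht⟩ (by simp)]
    dsimp only
    rw [ih]

theorem slotItems_eq_orderOf (χ : α → Fin m) (τ : Fin (Fintype.card α) ≃ α) (s : Fin m) :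
    slotItems χ τ s = orderOf τ (slotSet χ s) :=
  List.filter_congr fun x _ => by simp [mem_slotSet]

/-- The algorithm follows the process. -/
theorem slotStep_eq_processStep (δ : ℝ) (τ : Fin m → (Fin (Fintype.card α) ≃ α))
    (st : List α × (Fin m → Option α)) (s : Fin m) :
    slotStep M f δ (fun j => slotItems χ (τ j) j) J st s =
      processStep M f χ J (outcome M f δ τ) st s := by
  set B := slotSet χ s with hB
  set l := slotItems χ (τ s) s with hl
  have hlo : l ∈ orders B := by
    rw [hl, slotItems_eq_orderOf]
    exact orderOf_mem_orders _ _
  have hlB : l.toFinset = B := (mem_orders.1 hlo).2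
  refine Prod.ext ?_ ?_
  · rw [slotStep_fst]
    change improve M f st.1 (l.toFinset ∪ _) = _
    rw [hlB]
    rfl
  · unfold slotStep processStep
    dsimp only
    rw [← hl, ← hB, length_of_mem_orders hlo]
    set r := maxRun M f st.1 (#B * δ / 2) (4 * Real.log (2 / δ)) l with hr
    have h := maxRun_isMaximum (M := M) (f := f) st.1 (#B * δ / 2) (4 * Real.log (2 / δ)) l
    rw [hlB, ← hr] at h
    have hmax : IsMaximum M f st.1 (B ∪ (st.2 (J s)).toFinset)
        (merge r.2.1 ((st.2 (J s)).bind (candidate M f st.1))) := by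
      cases hR : st.2 (J s) with
      | none => simpa [merge] using h
      | some x =>
        have := h.insert x
        simpa [union_comm, ← insert_eq] using this
    rw [hmax.improver_eq]
    rcases hm : merge r.2.1 ((st.2 (J s)).bind (candidate M f st.1)) with _ | c
    · rfl
    · by_cases hg : 0 < c.gain
      · simp only [hg, if_true, Option.filter_some_pos (p := fun c => decide (0 < c.gain))
          (a := c) (by simpa using hg)]
        have hiff : c.item ∈ r.2.2 ↔ c.item ∈ B ∧ outcome M f δ τ s st.1 B = true := by
          have hc := hmax.1 c hm
          have hout : outcome M f δ τ s st.1 B = true ↔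
              ¬ Misses M f st.1 (#B * δ / 2) (4 * Real.log (2 / δ)) l := by
            rw [hl, slotItems_eq_orderOf]
            simp [outcome, hB]
          have hbest : c.item ∈ B → r.2.1 = some c := by
            intro hcB
            have hcb : IsBest M f st.1 B c :=
              ⟨hcB, hc.2.1, fun e he => hc.2.2 e (mem_union_left _ he)⟩
            rcases hb : r.2.1 with _ | d
            · have := h.2 hb _ hcB
              rw [hc.2.1] at this
              cases this
            · rw [(h.1 d hb).unique hcb]
          rw [hout]
          constructor
          · intro hA
            have hcB : c.item ∈ B := by
              rw [← hlB]
              exact List.mem_toFinset.2 (maxRun_subset _ _ _ _ _ hA)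
            refine ⟨hcB, ?_⟩
            rintro ⟨d, hd, hd'⟩
            obtain rfl := Option.some.inj ((hbest hcB).symm.trans hd)
            exact hd' hA
          · rintro ⟨hcB, hmiss⟩
            by_contra hA
            exact hmiss ⟨c, hbest hcB, hA⟩
        simp only [hiff]
      · simp [hg, Option.filter_some_neg]

theorem outputOf_eq_keptItems (δ : ℝ) (τ : Fin m → (Fin (Fintype.card α) ≃ α)) :
    outputOf M f δ (fun j => slotItems χ (τ j) j) J =
      keptItems (process M f χ J (outcome M f δ τ) m) := by
  have h : slotStep M f δ (fun j => slotItems χ (τ j) j) J =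
      processStep M f χ J (outcome M f δ τ) := by
    funext st s
    exact slotStep_eq_processStep δ τ st s
  rw [outputOf, h, process, List.take_of_length_le (by simp)]

/-! ### Invariants of the process -/

theorem processStep_snd_of_ne {st : List α × (Fin m → Option α)} {s j : Fin m} (h : j ≠ s) :
    (processStep M f χ J ζ st s).2 j = st.2 j := by
  unfold processStep
  dsimp only
  cases improver M f st.1 (slotSet χ s ∪ (st.2 (J s)).toFinset) with
  | none => rfl
  | some c =>
    dsimp only
    split_ifs
    · exact Function.update_of_ne h _ _
    · rfl

theorem processStep_snd_self {st : List α × (Fin m → Option α)} {s : Fin m} {x : α}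
    (h : (processStep M f χ J ζ st s).2 s = some x) :
    st.2 s = some x ∨ (χ x = s ∧ ζ s st.1 (slotSet χ s) = true ∧
      ∃ c, improver M f st.1 (slotSet χ s ∪ (st.2 (J s)).toFinset) = some c ∧ c.item = x) := by
  unfold processStep at h
  dsimp only at h
  cases hc : improver M f st.1 (slotSet χ s ∪ (st.2 (J s)).toFinset) with
  | none => rw [hc] at h; exact Or.inl h
  | some c =>
    rw [hc] at h
    dsimp only at h
    split_ifs at h with h1
    · rw [Function.update_self] at h
      obtain rfl := Option.some.inj h
      exact Or.inr ⟨mem_slotSet.1 h1.1, h1.2, c, rfl, rfl⟩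
    · exact Or.inl h

theorem processStep_snd_of_improver {st : List α × (Fin m → Option α)} {s : Fin m}
    {c : Candidate α} (hc : improver M f st.1 (slotSet χ s ∪ (st.2 (J s)).toFinset) = some c)
    (h : χ c.item = s) (hζ : ζ s st.1 (slotSet χ s) = true) :
    (processStep M f χ J ζ st s).2 s = some c.item := by
  unfold processStep
  rw [hc]
  dsimp only
  rw [if_pos ⟨mem_slotSet.2 h, hζ⟩, Function.update_self]

theorem process_array (t : ℕ) (ht : t ≤ m) {j : Fin m} {x : α}
    (h : (process M f χ J ζ t).2 j = some x) : χ x = j ∧ (j : ℕ) < t := by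
  induction t with
  | zero => simp [process_zero] at h
  | succ t ih =>
    have e := process_succ (M := M) (f := f) (χ := χ) (J := J) (ζ := ζ) ⟨t, ht⟩
    dsimp only at e
    rw [e] at h
    by_cases hj : j = ⟨t, ht⟩
    · subst hj
      rcases processStep_snd_self h with h | h
      · exact absurd (ih (by omega) h).2 (lt_irrefl _)
      · exact ⟨h.1, Nat.lt_succ_self t⟩
    · rw [processStep_snd_of_ne hj] at h
      exact (ih (by omega) h).imp id fun h => by omega

/-- A cell of the array changes only in its own slot. -/
theorem process_array_eq {j : Fin m} {t : ℕ} (hj : (j : ℕ) < t) (ht : t ≤ m) :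
    (process M f χ J ζ t).2 j = (process M f χ J ζ (j + 1)).2 j := by
  induction t with
  | zero => omega
  | succ t ih =>
    have e := process_succ (M := M) (f := f) (χ := χ) (J := J) (ζ := ζ) ⟨t, ht⟩
    dsimp only at e
    by_cases hjt : (j : ℕ) = t
    · rw [hjt]
    · rw [e, processStep_snd_of_ne (fun h => hjt (by rw [h])), ih (by omega) (by omega)]

theorem process_solution_lt (t : ℕ) (ht : t ≤ m) {x : α} (h : x ∈ (process M f χ J ζ t).1) :
    (χ x : ℕ) < t := by
  induction t with
  | zero => simp [process_zero] at h
  | succ t ih =>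
    have e := process_succ (M := M) (f := f) (χ := χ) (J := J) (ζ := ζ) ⟨t, ht⟩
    dsimp only at e
    rw [e] at h
    rcases mem_improve h with ⟨c, hc, rfl⟩ | h
    · rcases mem_union.1 (improver_eq_some.1 hc).1.1 with h | h
      · rw [mem_slotSet.1 h]
        exact Nat.lt_succ_self t
      · have := process_array t (by omega) (Option.mem_toFinset.1 h)
        rw [this.1]
        omega
    · exact (ih (by omega) h).trans (Nat.lt_succ_self t)

/-- An item of the solution is in the array, unless the online max algorithm missed it. -/
theorem process_solution_mem_array (t : ℕ) (ht : t ≤ m) {x : α}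
    (h : x ∈ (process M f χ J ζ t).1) (hs : success M f χ J ζ (χ x) = true) :
    (process M f χ J ζ t).2 (χ x) = some x := by
  induction t with
  | zero => simp [process_zero] at h
  | succ t ih =>
    have e := process_succ (M := M) (f := f) (χ := χ) (J := J) (ζ := ζ) ⟨t, ht⟩
    dsimp only at e
    rw [e] at h ⊢
    rcases mem_improve h with ⟨c, hc, rfl⟩ | h
    · by_cases hct : χ c.item = ⟨t, ht⟩
      · rw [hct]
        refine processStep_snd_of_improver hc hct ?_
        rw [hct] at hs
        exact hs
      · rw [processStep_snd_of_ne hct]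
        rcases mem_union.1 (improver_eq_some.1 hc).1.1 with h | h
        · exact absurd (mem_slotSet.1 h) hct
        · have h := Option.mem_toFinset.1 h
          rwa [(process_array t (by omega) h).1]
    · have := process_solution_lt t (by omega) h
      rw [processStep_snd_of_ne (fun h => by rw [h] at this; simp at this)]
      exact ih (by omega) h

theorem process_solution_indep (hf : Monotone f) (t : ℕ) (ht : t ≤ m) :
    (process M f χ J ζ t).1.Nodup ∧ M.Indep ((process M f χ J ζ t).1.toFinset : Set α) := by
  induction t with
  | zero => simp [process_zero]
  | succ t ih =>
    have e := process_succ (M := M) (f := f) (χ := χ) (J := J) (ζ := ζ) ⟨t, ht⟩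
    dsimp only at e
    rw [e]
    have ih := ih (by omega)
    have := improve_spec hf ih.1 ih.2 (slotSet χ ⟨t, ht⟩ ∪
      ((process M f χ J ζ t).2 (J ⟨t, ht⟩)).toFinset)
    exact ⟨this.1, this.2.1⟩

variable (M f χ J ζ) in
/-- The items that are available in the slot `s`: those that arrive in it and the sampled one. -/
noncomputable def available (s : Fin m) : Finset α :=
  slotSet χ s ∪ ((process M f χ J ζ s).2 (J s)).toFinset

theorem value_process_succ (hf : Monotone f) (s : Fin m) :
    f (process M f χ J ζ (s + 1)).1.toFinset = f (process M f χ J ζ s).1.toFinset +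
      (available M f χ J ζ s).sup (gainOf M f (process M f χ J ζ s).1) := by
  have ih := process_solution_indep (M := M) (χ := χ) (J := J) (ζ := ζ) hf s s.2.le
  rw [process_succ]
  exact (improve_spec hf ih.1 ih.2 _).2.2

/-! ### Changing the slot of an item, or the outcome in a slot -/

theorem process_update_outcome (t : Fin m) (z : List α → Finset α → Bool) {i : ℕ}
    (hi : i ≤ t) :
    process M f χ J (Function.update ζ t z) i = process M f χ J ζ i := by
  symm
  refine process_congr (hi.trans t.2.le) fun s hs => ?_
  unfold processStep
  rw [Function.update_of_ne]
  rintro rfl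
  omega

/-- Only the outcome for the actual solution and the actual set of items matters. -/
theorem process_update_success (t : Fin m) {b : Bool} (hb : success M f χ J ζ t = b) {i : ℕ}
    (hi : i ≤ m) :
    process M f χ J ζ i = process M f χ J (Function.update ζ t fun _ _ => b) i := by
  refine process_congr hi fun s hs => ?_
  by_cases hst : s = t
  · subst hst
    have : ζ s (process M f χ J ζ s).1 (slotSet χ s) = b := hb
    unfold processStep
    rw [this, Function.update_self]
  · unfold processStep
    rw [Function.update_of_ne hst]

/-- An item that was not added to the array in its slot, although the online max algorithm was
successful there, could as well have been in a later slot. -/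
theorem process_move {e : α} {s : Fin m} (hes : χ e < s)
    (hs : success M f χ J ζ (χ e) = true)
    (he : (process M f χ J ζ s).2 (χ e) ≠ some e) :
    process M f χ J ζ s = process M f (Function.update χ e s) J
      (Function.update ζ (χ e) fun _ _ => true) s := by
  have hslot : ∀ i : Fin m, i ≠ χ e → i ≠ s →
      slotSet (Function.update χ e s) i = slotSet χ i := by
    intro i h1 h2
    ext x
    rw [mem_slotSet, mem_slotSet]
    by_cases hx : x = e
    · subst hx
      rw [Function.update_self]
      exact ⟨fun h => absurd h.symm h2, fun h => absurd h.symm h1⟩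
    · rw [Function.update_of_ne hx]
  refine process_congr s.2.le fun i hi => ?_
  have his : i ≠ s := fun h => by rw [h] at hi; exact lt_irrefl _ hi
  by_cases hie : i = χ e
  · subst hie
    set t := χ e with ht
    have hslot' : slotSet (Function.update χ e s) t = (slotSet χ t).erase e := by
      ext x
      rw [mem_slotSet, mem_erase, mem_slotSet]
      by_cases hx : x = e
      · subst hx
        rw [Function.update_self]
        exact ⟨fun h => absurd h.symm his, fun h => absurd rfl h.1⟩
      · rw [Function.update_of_ne hx]
        exact ⟨fun h => ⟨hx, h⟩, fun h => h.2⟩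
    set st := process M f χ J ζ t with hst
    have hρ : e ∉ (st.2 (J t)).toFinset := fun h => by
      have := process_array t t.2.le (Option.mem_toFinset.1 h)
      rw [← ht] at this
      rw [← this.1] at this
      exact lt_irrefl _ this.2
    have hT : slotSet (Function.update χ e s) t ∪ (st.2 (J t)).toFinset =
        (slotSet χ t ∪ (st.2 (J t)).toFinset).erase e := by
      rw [hslot', erase_union_distrib, erase_eq_of_notMem hρ]
    have hne : ∀ c, improver M f st.1 (slotSet χ t ∪ (st.2 (J t)).toFinset) = some c →
        c.item ≠ e := by
      rintro c hc rfl
      refine he ?_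
      rw [process_array_eq hes s.2.le, process_succ]
      exact processStep_snd_of_improver hc rfl hs
    unfold processStep
    rw [hT, improve, improve, improver_erase hne, Function.update_self]
    refine Prod.ext rfl ?_
    dsimp only
    cases hc : improver M f st.1 (slotSet χ t ∪ (st.2 (J t)).toFinset) with
    | none => rfl
    | some c =>
      have hz : ζ t st.1 (slotSet χ t) = true := hs
      have hcs : c.item ∈ slotSet (Function.update χ e s) t ↔ c.item ∈ slotSet χ t := by
        rw [hslot', mem_erase]
        exact ⟨fun h => h.2, fun h => ⟨hne c hc, h⟩⟩
      simp only [hcs, hz]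
  · unfold processStep
    rw [hslot i hie his, Function.update_of_ne hie]

/-- As long as an item stays in the solution, it does not matter whether it was selected by the
online max algorithm when it arrived: an item that is sampled while it is in the solution has no
positive gain. -/
theorem process_outcome_irrelevant (hf : Monotone f) {x : α} {s : ℕ} (hxs : (χ x : ℕ) < s)
    (hs : s ≤ m)
    (hx : x ∈ (process M f χ J (Function.update ζ (χ x) fun _ _ => false) s).1) :
    (process M f χ J (Function.update ζ (χ x) fun _ _ => true) s).1 =
      (process M f χ J (Function.update ζ (χ x) fun _ _ => false) s).1 ∧
    (∀ j, j ≠ χ x → (process M f χ J (Function.update ζ (χ x) fun _ _ => true) s).2 j =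
      (process M f χ J (Function.update ζ (χ x) fun _ _ => false) s).2 j) ∧
    (process M f χ J (Function.update ζ (χ x) fun _ _ => true) s).2 (χ x) = some x ∧
    (process M f χ J (Function.update ζ (χ x) fun _ _ => false) s).2 (χ x) = none := by
  set t := χ x with ht
  set ζ₀ := Function.update ζ t fun _ _ => false with hζ₀
  set ζ₁ := Function.update ζ t fun _ _ => true with hζ₁
  induction s, (show (t : ℕ) + 1 ≤ s from hxs) using Nat.le_induction with
  | base =>
    have e0 : process M f χ J ζ₀ t = process M f χ J ζ t := process_update_outcome t _ le_rfl
    have e1 : process M f χ J ζ₁ t = process M f χ J ζ t := process_update_outcome t _ le_rfl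
    rw [process_succ, e0] at hx
    rw [process_succ, process_succ, e0, e1]
    have hxt : x ∉ (process M f χ J ζ t).1 := fun h =>
      lt_irrefl _ (ht ▸ process_solution_lt t t.2.le h)
    obtain ⟨c, hc, hcx⟩ := (mem_improve hx).resolve_right hxt
    refine ⟨rfl, fun j hj => ?_, ?_, ?_⟩
    · rw [processStep_snd_of_ne hj, processStep_snd_of_ne hj]
    · rw [hcx]
      refine processStep_snd_of_improver hc (by rw [← hcx]) ?_
      rw [hζ₁, Function.update_self]
    · rw [Option.eq_none_iff_forall_ne_some]
      intro y hy
      rcases processStep_snd_self hy with h | h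
      · exact lt_irrefl _ (process_array t t.2.le h).2
      · have := h.2.1
        rw [hζ₀, Function.update_self] at this
        cases this
  | succ s hts ih =>
    have e0 := process_succ (M := M) (f := f) (χ := χ) (J := J) (ζ := ζ₀) ⟨s, hs⟩
    have e1 := process_succ (M := M) (f := f) (χ := χ) (J := J) (ζ := ζ₁) ⟨s, hs⟩
    dsimp only at e0 e1
    set i : Fin m := ⟨s, hs⟩ with hi
    have hit : i ≠ t := fun h => by
      have : s = (t : ℕ) := congrArg Fin.val h
      omega
    have hxs' : x ∈ (process M f χ J ζ₀ s).1 := by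
      rw [e0] at hx
      rcases mem_improve hx with ⟨c, hc, hcx⟩ | h
      · exfalso
        rcases mem_union.1 (improver_eq_some.1 hc).1.1 with h | h
        · rw [← hcx, mem_slotSet] at h
          exact hit (h.symm.trans ht.symm)
        · rw [← hcx, Option.mem_toFinset] at h
          have hJ := (process_array s (by omega) h).1
          rw [← ht] at hJ
          rw [← hJ] at h
          -- The cell of `x` is empty if it was not selected, so `x` cannot come back.
          have h3 : (process M f χ J ζ₀ s).2 t = none := by
            rw [process_array_eq (j := t) (by omega) (by omega), process_succ,
              Option.eq_none_iff_forall_ne_some]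
            intro y hy
            rcases processStep_snd_self hy with h | h
            · exact lt_irrefl _ (process_array t t.2.le h).2
            · have := h.2.1
              rw [hζ₀, Function.update_self] at this
              cases this
          rw [Option.mem_def, h3] at h
          cases h
      · exact h
    obtain ⟨h1, h2, h3, h4⟩ := ih (by omega) (by omega) hxs'
    have himp : improver M f (process M f χ J ζ₀ s).1
          (slotSet χ i ∪ ((process M f χ J ζ₁ s).2 (J i)).toFinset) =
        improver M f (process M f χ J ζ₀ s).1
          (slotSet χ i ∪ ((process M f χ J ζ₀ s).2 (J i)).toFinset) := by
      by_cases hJ : J i = t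
      · rw [hJ, h3, h4]
        have hxi : x ∉ slotSet χ i := fun h => hit ((mem_slotSet.1 h).symm.trans ht.symm)
        rw [← improver_erase (e := x) (T := slotSet χ i ∪ (some x).toFinset)]
        · congr 1
          rw [erase_union_distrib, erase_eq_of_notMem hxi]
          simp
        · rintro c hc rfl
          exact improver_item_notMem hf hc hxs'
      · rw [h2 _ hJ]
    rw [e0, e1]
    refine ⟨?_, ?_, ?_, ?_⟩
    · unfold processStep improve
      dsimp only
      rw [h1, himp]
    · intro j hj
      unfold processStep
      dsimp only
      rw [h1, himp]
      have hz : ζ₁ i = ζ₀ i := by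
        rw [hζ₁, hζ₀, Function.update_of_ne hit, Function.update_of_ne hit]
      rw [hz]
      cases improver M f (process M f χ J ζ₀ s).1
          (slotSet χ i ∪ ((process M f χ J ζ₀ s).2 (J i)).toFinset) with
      | none => exact h2 j hj
      | some c =>
        dsimp only
        split_ifs
        · by_cases hji : j = i
          · rw [hji, Function.update_self, Function.update_self]
          · rw [Function.update_of_ne hji, Function.update_of_ne hji, h2 j hj]
        · exact h2 j hj
    · rw [processStep_snd_of_ne hit.symm, h3]
    · rw [processStep_snd_of_ne hit.symm, h4]

end

end MatroidShortlist

/-! ### Random subsets, and averaging over the outcomes in the slots -/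

section

variable {α : Type} [LinearOrder α] {f : Finset α → ℝ}

/-- The marginal value of `x ∈ A` with respect to the smaller elements of `A`, in the fixed order
of the items. -/
def marginal (f : Finset α → ℝ) (A : Finset α) (x : α) : ℝ :=
  f {y ∈ A | y ≤ x} - f {y ∈ A | y < x}

theorem marginal_nonneg (hf : Monotone f) (A : Finset α) (x : α) : 0 ≤ marginal f A x :=
  sub_nonneg.2 (hf (monotone_filter_right _ fun _ _ h => le_of_lt h))

theorem sum_marginal (f : Finset α → ℝ) (A : Finset α) :
    ∑ x ∈ A, marginal f A x = f A - f ∅ := by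
  induction A using Finset.induction_on_max with
  | empty => simp
  | insert a A ha ih =>
    have haA : a ∉ A := fun h => lt_irrefl _ (ha a h)
    have h1 : ∀ x ∈ A, marginal f (insert a A) x = marginal f A x := by
      intro x hx
      unfold marginal
      rw [filter_insert, filter_insert, if_neg (not_le.2 (ha x hx)),
        if_neg (not_lt.2 (ha x hx).le)]
    rw [sum_insert haA, sum_congr rfl h1, ih, marginal, filter_insert, filter_insert,
      if_pos le_rfl, if_neg (lt_irrefl a), filter_true_of_mem fun x hx => (ha x hx).le,
      filter_true_of_mem ha]
    ring

theorem IsSubmodular.sum_marginal_le (hf : IsSubmodular f) {A C : Finset α} (h : C ⊆ A) :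
    ∑ x ∈ C, marginal f A x ≤ f C - f ∅ := by
  induction C using Finset.induction_on_max with
  | empty => simp
  | insert a C ha ih =>
    have haC : a ∉ C := fun h => lt_irrefl _ (ha a h)
    have haA : a ∈ A := h (mem_insert_self _ _)
    have hCA : C ⊆ A := (subset_insert _ _).trans h
    rw [sum_insert haC]
    have h1 := hf.insert_sub_le (S := C) (T := {y ∈ A | y < a}) (e := a)
      (fun x hx => mem_filter.2 ⟨hCA hx, ha x hx⟩) (by simp)
    have h2 : insert a {y ∈ A | y < a} = {y ∈ A | y ≤ a} := by
      ext y
      simp only [mem_insert, mem_filter, le_iff_lt_or_eq]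
      constructor
      · rintro (rfl | h)
        · exact ⟨haA, Or.inr rfl⟩
        · exact ⟨h.1, Or.inl h.2⟩
      · rintro ⟨h1, h2 | h2⟩
        · exact Or.inr ⟨h1, h2⟩
        · exact Or.inl h2
    rw [h2] at h1
    have := ih hCA
    unfold marginal at this ⊢
    linarith

/-- A random subset `X` of a random set `A` has almost the value of `A` on average, if each
element is lost with small probability, also when it is weighted by a function of `A`. -/
theorem IsSubmodular.one_sub_mul_expect_le [Fintype α] {Ω : Type} [Fintype Ω] [Nonempty Ω]
    (hmono : Monotone f)
    (hf : IsSubmodular f) (h0 : ∀ S, 0 ≤ f S) {η : ℝ} (hη : 0 ≤ η) (A X : Ω → Finset α)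
    (hX : ∀ ω, X ω ⊆ A ω)
    (h : ∀ (x : α) (w : Finset α → ℝ), (∀ S, 0 ≤ w S) →
      𝔼 ω, (if x ∈ A ω ∧ x ∉ X ω then w (A ω) else 0) ≤
        η * 𝔼 ω, (if x ∈ A ω then w (A ω) else 0)) :
    (1 - η) * 𝔼 ω, f (A ω) ≤ 𝔼 ω, f (X ω) := by
  have h1 : ∀ ω, f (A ω) ≤
      f (X ω) + ∑ x, if x ∈ A ω ∧ x ∉ X ω then marginal f (A ω) x else 0 := by
    intro ω
    have h2 := sum_marginal f (A ω)
    have h3 := hf.sum_marginal_le (hX ω)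
    rw [← sum_sdiff (hX ω)] at h2
    rw [← sum_filter]
    have h4 : ({x | x ∈ A ω ∧ x ∉ X ω} : Finset α) = A ω \ X ω := by ext x; simp
    rw [h4]
    linarith
  have h2 : ∀ ω, ∑ x, (if x ∈ A ω then marginal f (A ω) x else 0) ≤ f (A ω) := by
    intro ω
    rw [← sum_filter, filter_mem_eq_inter, univ_inter, sum_marginal]
    linarith [h0 ∅]
  have h3 := expect_le_expect (s := univ) fun ω _ => h1 ω
  have h4 := expect_le_expect (s := univ) fun ω _ => h2 ω
  rw [expect_add_distrib, expect_sum_comm] at h3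
  rw [expect_sum_comm] at h4
  have h5 := sum_le_sum (s := univ) fun x (_ : x ∈ univ) =>
    h x (fun S => marginal f S x) fun S => marginal_nonneg hmono S x
  rw [← mul_sum] at h5
  have h6 := mul_le_mul_of_nonneg_left h4 hη
  linarith

end

/-- At most one element of `T` exceeds all the other elements of `T`, so the surpluses over the
other elements add up to at most the maximum. -/
theorem sum_sub_sup_erase_le {α : Type} [DecidableEq α] (G : α → ℝ≥0) (T C : Finset α) :
    ∑ e ∈ C, (if e ∈ T then G e - (T.erase e).sup G else 0) ≤ T.sup G := by
  rw [← sum_filter]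
  set D := {e ∈ C | e ∈ T} with hD
  by_cases h : ∃ e ∈ D, G e - (T.erase e).sup G ≠ 0
  · obtain ⟨e, he, hne⟩ := h
    have heT : e ∈ T := (mem_filter.1 he).2
    have hlt : (T.erase e).sup G < G e := by
      rw [← tsub_pos_iff_lt]
      exact pos_iff_ne_zero.2 hne
    rw [sum_eq_single_of_mem e he]
    · exact tsub_le_self.trans (le_sup heT)
    · intro e' he' hee
      have he'T : e' ∈ T := (mem_filter.1 he').2
      rw [tsub_eq_zero_iff_le]
      exact ((le_sup (f := G) (mem_erase.2 ⟨hee, he'T⟩)).trans hlt.le).trans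
        (le_sup (f := G) (mem_erase.2 ⟨hee.symm, heT⟩))
  · push Not at h
    rw [sum_eq_zero h]
    exact zero_le

namespace MatroidShortlist

section

variable {α : Type} [LinearOrder α] [Fintype α] {M : Matroid α} {f : Finset α → ℝ} {m : ℕ}
variable {Ω : Type} [Fintype Ω] [Nonempty Ω] {z : Ω → List α → Finset α → Bool} {η : ℝ}
variable (χ : α → Fin m) (J : Fin m → Fin m)

theorem outcomes_update (τ : Fin m → Ω) (t : Fin m) (ω : Ω) :
    (fun s => z (Function.update τ t ω s)) = Function.update (fun s => z (τ s)) t (z ω) := by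
  funext s
  by_cases h : s = t
  · subst h; simp
  · simp [h]

theorem expect_failure_le (hz : ∀ S B, 𝔼 ω, (if z ω S B = true then (0 : ℝ) else 1) ≤ η)
    (t : Fin m) :
    𝔼 τ : Fin m → Ω,
      (if success M f χ J (fun s => z (τ s)) t = true then (0 : ℝ) else 1) ≤ η := by
  rw [expect_update _ t]
  refine expect_le univ_nonempty fun τ _ => ?_
  refine le_trans (le_of_eq ?_) (hz (process M f χ J (fun s => z (τ s)) t).1 (slotSet χ t))
  refine expect_congr rfl fun ω _ => ?_
  rw [outcomes_update, success, process_update_outcome t _ le_rfl, Function.update_self]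

theorem one_sub_le_expect_success
    (hz : ∀ S B, 𝔼 ω, (if z ω S B = true then (0 : ℝ) else 1) ≤ η) (S : List α) (B : Finset α) :
    1 - η ≤ 𝔼 ω, (if z ω S B = true then (1 : ℝ) else 0) := by
  have h : 𝔼 ω, (if z ω S B = true then (1 : ℝ) else 0) +
      𝔼 ω, (if z ω S B = true then (0 : ℝ) else 1) = 1 := by
    rw [← expect_add_distrib, ← Fintype.expect_const (ι := Ω) (1 : ℝ)]
    refine expect_congr rfl fun ω _ => ?_
    split_ifs <;> norm_num
  linarith [hz S B]

/-- Moving an item from a successful earlier slot, where it was not added to the array, to the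
slot `s` does not change the state before `s`, provided that the earlier slot is also successful
without the item. The factor `1 - η` pays for this. -/
theorem expect_move_le (hz : ∀ S B, 𝔼 ω, (if z ω S B = true then (0 : ℝ) else 1) ≤ η)
    (hη : η ≤ 1) {e : α} {s : Fin m} (hes : χ e < s)
    (φ : List α × (Fin m → Option α) → ℝ) (hφ : ∀ st, 0 ≤ φ st) :
    (1 - η) * 𝔼 τ : Fin m → Ω,
        (if success M f χ J (fun s => z (τ s)) (χ e) = true ∧
            (process M f χ J (fun s => z (τ s)) s).2 (χ e) ≠ some e
          then φ (process M f χ J (fun s => z (τ s)) s) else 0) ≤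
      𝔼 τ : Fin m → Ω, φ (process M f (Function.update χ e s) J (fun s => z (τ s)) s) := by
  rw [expect_update _ (χ e), expect_update (fun τ : Fin m → Ω =>
    φ (process M f (Function.update χ e s) J (fun s => z (τ s)) s)) (χ e), mul_expect]
  refine expect_le_expect fun τ _ => ?_
  simp only [outcomes_update]
  set ζ := fun s => z (τ s)
  set t := χ e with ht
  set χ' := Function.update χ e s with hχ'
  set Ψ := φ (process M f χ' J (Function.update ζ t fun _ _ => true) s) with hΨ
  have h1 : 𝔼 ω, (if success M f χ J (Function.update ζ t (z ω)) t = true ∧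
      (process M f χ J (Function.update ζ t (z ω)) s).2 t ≠ some e
      then φ (process M f χ J (Function.update ζ t (z ω)) s) else 0) ≤ Ψ := by
    refine expect_le univ_nonempty fun ω _ => ?_
    split_ifs with h
    · have := process_move (M := M) (f := f) (J := J) (ζ := Function.update ζ t (z ω)) hes h.1 h.2
      rw [this, ← ht, Function.update_idem]
    · exact hφ _
  have h2 : (1 - η) * Ψ ≤
      𝔼 ω, φ (process M f χ' J (Function.update ζ t (z ω)) s) := by
    refine (mul_le_mul_of_nonneg_right (one_sub_le_expect_success hz
      (process M f χ' J ζ t).1 (slotSet χ' t)) (hφ _)).trans ?_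
    rw [expect_mul]
    refine expect_le_expect fun ω _ => ?_
    split_ifs with h
    · have hs : success M f χ' J (Function.update ζ t (z ω)) t = true := by
        rw [success, process_update_outcome t _ le_rfl, Function.update_self]
        exact h
      rw [process_update_success t hs s.2.le, Function.update_idem, one_mul]
    · rw [zero_mul]
      exact hφ _
  exact (mul_le_mul_of_nonneg_left h1 (by linarith)).trans h2

/-- An item of the final solution is lost in the output with probability at most `η`, even when it
is weighted by a function of the final solution. The reason is that the outcome in the slot of the
item has no influence on a solution that contains the item to the end. -/
theorem expect_not_kept_le (hf : Monotone f)
    (hz : ∀ S B, 𝔼 ω, (if z ω S B = true then (0 : ℝ) else 1) ≤ η) (x : α)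
    (w : Finset α → ℝ) (hw : ∀ S, 0 ≤ w S) :
    𝔼 τ : Fin m → Ω,
        (if x ∈ (process M f χ J (fun s => z (τ s)) m).1.toFinset ∧
            x ∉ keptItems (process M f χ J (fun s => z (τ s)) m)
          then w (process M f χ J (fun s => z (τ s)) m).1.toFinset else 0) ≤
      η * 𝔼 τ : Fin m → Ω, (if x ∈ (process M f χ J (fun s => z (τ s)) m).1.toFinset
        then w (process M f χ J (fun s => z (τ s)) m).1.toFinset else 0) := by
  set t := χ x with ht
  rw [expect_update _ t, expect_update (fun τ : Fin m → Ω =>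
    if x ∈ (process M f χ J (fun s => z (τ s)) m).1.toFinset
        then w (process M f χ J (fun s => z (τ s)) m).1.toFinset else 0) t, mul_expect]
  refine expect_le_expect fun τ _ => ?_
  simp only [outcomes_update]
  set ζ := fun s => z (τ s)
  set P₀ := process M f χ J (Function.update ζ t fun _ _ => false) m with hP₀
  -- An item that is lost belongs to the solution of the process in which its slot fails.
  have hlost : ∀ ω, x ∈ (process M f χ J (Function.update ζ t (z ω)) m).1.toFinset ∧
      x ∉ keptItems (process M f χ J (Function.update ζ t (z ω)) m) →
      z ω (process M f χ J ζ t).1 (slotSet χ t) = false ∧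
        process M f χ J (Function.update ζ t (z ω)) m = P₀ := by
    rintro ω ⟨h1, h2⟩
    have hs : success M f χ J (Function.update ζ t (z ω)) t = false := by
      rw [← Bool.not_eq_true]
      intro hs
      refine h2 (mem_filter.2 ⟨h1, t, ?_⟩)
      exact process_solution_mem_array m le_rfl (List.mem_toFinset.1 h1) hs
    refine ⟨?_, ?_⟩
    · rwa [success, process_update_outcome t _ le_rfl, Function.update_self] at hs
    · rw [process_update_success t hs le_rfl, Function.update_idem]
  by_cases hx : x ∈ P₀.1
  · have hout := process_outcome_irrelevant (M := M) (f := f) (χ := χ) (J := J) (ζ := ζ) hf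
      (x := x) (s := m) t.2 le_rfl hx
    have hall : ∀ ω, (process M f χ J (Function.update ζ t (z ω)) m).1 = P₀.1 := by
      intro ω
      rcases hb : success M f χ J (Function.update ζ t (z ω)) t with _ | _
      · rw [process_update_success t hb le_rfl, Function.update_idem]
      · rw [process_update_success t hb le_rfl, Function.update_idem]
        exact hout.1
    have h1 : 𝔼 ω, (if x ∈ (process M f χ J (Function.update ζ t (z ω)) m).1.toFinset
        then w (process M f χ J (Function.update ζ t (z ω)) m).1.toFinset else 0) =
        w P₀.1.toFinset := by
      simp only [hall, List.mem_toFinset, hx, if_true, Fintype.expect_const]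
    rw [h1]
    refine le_trans ?_ (mul_le_mul_of_nonneg_right
      (hz (process M f χ J ζ t).1 (slotSet χ t)) (hw _))
    rw [expect_mul]
    refine expect_le_expect fun ω _ => ?_
    split_ifs with h2 h3 h3
    · rw [(hlost ω h2).1] at h3
      cases h3
    · rw [hall, one_mul]
    · rw [zero_mul]
    · rw [one_mul]
      exact hw _
  · have h1 : 𝔼 ω, (if x ∈ (process M f χ J (Function.update ζ t (z ω)) m).1.toFinset ∧
        x ∉ keptItems (process M f χ J (Function.update ζ t (z ω)) m)
        then w (process M f χ J (Function.update ζ t (z ω)) m).1.toFinset else 0) = 0 := by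
      refine expect_eq_zero fun ω _ => if_neg fun h => hx ?_
      have := (hlost ω h).2
      rw [this] at h
      exact List.mem_toFinset.1 h.1
    rw [h1]
    have hη : 0 ≤ η := (expect_nonneg fun ω _ => by split_ifs <;> norm_num).trans (hz [] ∅)
    refine mul_nonneg hη (expect_nonneg fun ω _ => ?_)
    split_ifs
    · exact hw _
    · exact le_rfl

end

end MatroidShortlist

/-! ### The expected increase in one slot -/

namespace MatroidShortlist

section

variable {α : Type} [LinearOrder α] [Fintype α] (M : Matroid α) (f : Finset α → ℝ) {m : ℕ}

/-- The amount by which the gain of `e` in the slot `s` exceeds the gains of all other available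
items, truncated at `0`. The item `e` itself need not be available. -/
noncomputable def surplus (χ : α → Fin m) (J : Fin m → Fin m)
    (ζ : Fin m → List α → Finset α → Bool) (s : Fin m) (e : α) : ℝ≥0 :=
  gainOf M f (process M f χ J ζ s).1 e -
    ((available M f χ J ζ s).erase e).sup (gainOf M f (process M f χ J ζ s).1)

variable {M f}
variable {Ω : Type} [Fintype Ω] [Nonempty Ω] {z : Ω → List α → Finset α → Bool} {η : ℝ}

/-- If `e` is not in the array, then its surplus depends only on the state before the slot and on
the other items of the slot. -/
theorem surplus_eq {χ : α → Fin m} {J : Fin m → Fin m} {ζ : Fin m → List α → Finset α → Bool}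
    {s : Fin m} {e : α} (he : (process M f χ J ζ s).2 (χ e) ≠ some e) :
    surplus M f χ J ζ s e = gainOf M f (process M f χ J ζ s).1 e -
      ((slotSet χ s).erase e ∪ ((process M f χ J ζ s).2 (J s)).toFinset).sup
        (gainOf M f (process M f χ J ζ s).1) := by
  have hρ : e ∉ ((process M f χ J ζ s).2 (J s)).toFinset := fun h => by
    have h := Option.mem_toFinset.1 h
    rw [← (process_array s s.2.le h).1] at h
    exact he h
  rw [surplus, available, erase_union_distrib, erase_eq_of_notMem hρ]

/-- The surplus of an item that was neither missed nor added to the array is, on average, hardly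
larger than its surplus would be if the item arrived in the slot `s`. -/
theorem expect_surplus_move_le
    (hz : ∀ S B, 𝔼 ω, (if z ω S B = true then (0 : ℝ) else 1) ≤ η) (hη0 : 0 ≤ η) (hη : η ≤ 1)
    (χ : α → Fin m) (J : Fin m → Fin m) (s : Fin m) (e : α) :
    (1 - η) * 𝔼 τ : Fin m → Ω,
        (if (χ e < s → success M f χ J (fun s => z (τ s)) (χ e) = true) ∧
            (process M f χ J (fun s => z (τ s)) s).2 (χ e) ≠ some e
          then (surplus M f χ J (fun s => z (τ s)) s e : ℝ) else 0) ≤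
      𝔼 τ : Fin m → Ω,
        (surplus M f (Function.update χ e s) J (fun s => z (τ s)) s e : ℝ) := by
  set φ : List α × (Fin m → Option α) → ℝ := fun st =>
    ((gainOf M f st.1 e - ((slotSet χ s).erase e ∪ (st.2 (J s)).toFinset).sup
        (gainOf M f st.1) : ℝ≥0) : ℝ) with hφ
  have hslot : (slotSet (Function.update χ e s) s).erase e = (slotSet χ s).erase e := by
    ext x
    rw [mem_erase, mem_erase, mem_slotSet, mem_slotSet]
    exact and_congr_right fun hx => by rw [Function.update_of_ne hx]
  have h1 : ∀ ζ, (surplus M f (Function.update χ e s) J ζ s e : ℝ) =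
      φ (process M f (Function.update χ e s) J ζ s) := by
    intro ζ
    rw [surplus_eq, hslot]
    intro h
    have := process_array s s.2.le h
    rw [Function.update_self] at this
    exact lt_irrefl _ this.2
  simp only [h1]
  by_cases hes : χ e < s
  · refine le_trans (le_of_eq ?_) (expect_move_le χ J hz hη hes φ fun st => NNReal.coe_nonneg _)
    congr 1
    refine expect_congr rfl fun τ _ => ?_
    have hiff : (χ e < s → success M f χ J (fun s => z (τ s)) (χ e) = true) ↔
        success M f χ J (fun s => z (τ s)) (χ e) = true := ⟨fun h => h hes, fun h _ => h⟩
    simp only [hiff]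
    split_ifs with h
    · rw [surplus_eq h.2]
    · rfl
  · rw [mul_expect]
    refine expect_le_expect fun τ _ => ?_
    have hp : process M f χ J (fun s => z (τ s)) s =
        process M f (Function.update χ e s) J (fun s => z (τ s)) s := by
      refine process_congr s.2.le fun i hi => ?_
      have hslot' : slotSet (Function.update χ e s) i = slotSet χ i := by
        ext x
        rw [mem_slotSet, mem_slotSet]
        by_cases hx : x = e
        · subst hx
          rw [Function.update_self]
          refine ⟨fun h => ?_, fun h => absurd (by rw [h]; exact hi) hes⟩
          rw [h] at hi
          exact absurd hi (lt_irrefl _)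
        · rw [Function.update_of_ne hx]
      unfold processStep
      rw [hslot']
    have hφ0 : 0 ≤ φ (process M f (Function.update χ e s) J (fun s => z (τ s)) s) :=
      NNReal.coe_nonneg _
    split_ifs with h
    · rw [surplus_eq h.2, hp]
      exact mul_le_of_le_one_left hφ0 (by linarith)
    · rw [mul_zero]
      exact hφ0

/-- An item arrives in the slot `s` with probability `1 / m`. -/
theorem expect_ite_arrive (h : (α → Fin m) → ℝ) (s : Fin m) (e : α) :
    𝔼 χ, (if χ e = s then h χ else 0) = 𝔼 χ, (1 / m : ℝ) * h (Function.update χ e s) := by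
  rw [expect_update _ e]
  refine expect_congr rfl fun χ _ => ?_
  simp only [Function.update_self]
  rw [Fintype.expect_eq_sum_div_card, Finset.sum_ite_eq' univ s, if_pos (mem_univ _),
    Fintype.card_fin]
  ring

/-- An item in the array is sampled with probability `1 / m`, and then its surplus is as large as
it can be, since no other item is sampled. -/
theorem expect_surplus_sample_le (χ : α → Fin m) (ζ : Fin m → List α → Finset α → Bool)
    (s : Fin m) (e : α) :
    (1 / m : ℝ) * 𝔼 J : Fin m → Fin m,
        (if (process M f χ J ζ s).2 (χ e) = some e then (surplus M f χ J ζ s e : ℝ) else 0) ≤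
      𝔼 J : Fin m → Fin m,
        (if (process M f χ J ζ s).2 (χ e) = some e ∧ J s = χ e
          then (surplus M f χ J ζ s e : ℝ) else 0) := by
  have : Nonempty (Fin m) := ⟨s⟩
  rw [expect_update _ s, expect_update (fun J : Fin m → Fin m =>
    if (process M f χ J ζ s).2 (χ e) = some e ∧ J s = χ e
          then (surplus M f χ J ζ s e : ℝ) else 0) s, mul_expect]
  refine expect_le_expect fun J _ => ?_
  have hp : ∀ j, process M f χ (Function.update J s j) ζ s = process M f χ J ζ s := by
    intro j
    symm
    refine process_congr s.2.le fun i hi => ?_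
    unfold processStep
    rw [Function.update_of_ne (fun h => by rw [h] at hi; exact lt_irrefl _ hi)]
  simp only [hp, Function.update_self]
  by_cases hR : (process M f χ J ζ s).2 (χ e) = some e
  swap
  · simp [hR]
  simp only [hR, if_true, true_and]
  set G := gainOf M f (process M f χ J ζ s).1 with hG
  have heB : e ∉ slotSet χ s := fun h => by
    have := (process_array s s.2.le hR).2
    rw [mem_slotSet.1 h] at this
    exact lt_irrefl _ this
  have h1 : ∀ j, surplus M f χ (Function.update J s j) ζ s e ≤ G e - (slotSet χ s).sup G := by
    intro j
    rw [surplus, hp]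
    refine tsub_le_tsub_left (sup_mono ?_) _
    intro x hx
    refine mem_erase.2 ⟨?_, mem_union_left _ hx⟩
    rintro rfl
    exact heB hx
  have h2 : surplus M f χ (Function.update J s (χ e)) ζ s e = G e - (slotSet χ s).sup G := by
    rw [surplus, available, hp, Function.update_self, hR, erase_union_distrib,
      erase_eq_of_notMem heB]
    simp [hG]
  rw [Fintype.expect_eq_sum_div_card (f := fun j => if j = χ e then _ else _),
    Finset.sum_ite_eq' univ (χ e), if_pos (mem_univ _), Fintype.card_fin, h2, div_mul_eq_mul_div,
    one_mul]
  refine div_le_div_of_nonneg_right ?_ (Nat.cast_nonneg _)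
  exact expect_le univ_nonempty fun j _ => NNReal.coe_le_coe.2 (h1 j)

/-- Each item that was not missed is available in the slot `s` with probability almost `1 / m`,
also when it is weighted by its surplus over the other available items. -/
theorem expect_surplus_le
    (hz : ∀ S B, 𝔼 ω, (if z ω S B = true then (0 : ℝ) else 1) ≤ η) (hη0 : 0 ≤ η) (hη : η ≤ 1)
    (s : Fin m) (e : α) :
    (1 - η) / m * 𝔼 χ : α → Fin m, 𝔼 J : Fin m → Fin m, 𝔼 τ : Fin m → Ω,
        (if χ e < s → success M f χ J (fun s => z (τ s)) (χ e) = true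
          then (surplus M f χ J (fun s => z (τ s)) s e : ℝ) else 0) ≤
      𝔼 χ : α → Fin m, 𝔼 J : Fin m → Fin m, 𝔼 τ : Fin m → Ω,
        (if e ∈ available M f χ J (fun s => z (τ s)) s
          then (surplus M f χ J (fun s => z (τ s)) s e : ℝ) else 0) := by
  have : Nonempty (Fin m) := ⟨s⟩
  have hm : (0 : ℝ) < m := by exact_mod_cast s.pos
  have hη1 : 0 ≤ 1 - η := by linarith
  set Φ : (α → Fin m) → (Fin m → Fin m) → (Fin m → Ω) → ℝ := fun χ J τ =>
    (surplus M f χ J (fun s => z (τ s)) s e : ℝ) with hΦ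
  have hΦ0 : ∀ χ J τ, 0 ≤ Φ χ J τ := fun _ _ _ => NNReal.coe_nonneg _
  let inR : (α → Fin m) → (Fin m → Fin m) → (Fin m → Ω) → Prop := fun χ J τ =>
    (process M f χ J (fun s => z (τ s)) s).2 (χ e) = some e
  let ok : (α → Fin m) → (Fin m → Fin m) → (Fin m → Ω) → Prop := fun χ J τ =>
    χ e < s → success M f χ J (fun s => z (τ s)) (χ e) = true
  classical
  -- Items that arrive in the slot.
  have harr : (1 - η) / m * 𝔼 χ, 𝔼 J, 𝔼 τ, (if ok χ J τ ∧ ¬ inR χ J τ then Φ χ J τ else 0) ≤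
      𝔼 χ, 𝔼 J, 𝔼 τ, (if χ e = s then Φ χ J τ else 0) := by
    have e1 : 𝔼 χ : α → Fin m, 𝔼 J, 𝔼 τ, (if χ e = s then Φ χ J τ else 0) =
        𝔼 χ : α → Fin m, (if χ e = s then 𝔼 J, 𝔼 τ, Φ χ J τ else 0) := by
      refine expect_congr rfl fun χ _ => ?_
      split_ifs <;> simp
    rw [e1, expect_ite_arrive, expect_update _ e, mul_expect]
    refine expect_le_expect fun χ _ => ?_
    rw [div_eq_mul_one_div, mul_comm (1 - η), mul_assoc]
    refine mul_le_mul_of_nonneg_left ?_ (by positivity)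
    rw [mul_expect]
    refine expect_le univ_nonempty fun y _ => ?_
    rw [mul_expect]
    refine expect_le_expect fun J _ => ?_
    have := expect_surplus_move_le (M := M) (f := f) hz hη0 hη (Function.update χ e y) J s e
    rw [Function.update_idem] at this
    exact this
  -- Items that are sampled.
  have hsamp : (1 - η) / m * 𝔼 χ, 𝔼 J, 𝔼 τ, (if inR χ J τ then Φ χ J τ else 0) ≤
      𝔼 χ, 𝔼 J, 𝔼 τ, (if inR χ J τ ∧ J s = χ e then Φ χ J τ else 0) := by
    rw [mul_expect]
    refine expect_le_expect fun χ _ => ?_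
    rw [expect_comm, expect_comm (f := fun J τ => if inR χ J τ ∧ J s = χ e then Φ χ J τ else 0),
      mul_expect]
    refine expect_le_expect fun τ _ => ?_
    refine le_trans ?_ (expect_surplus_sample_le (M := M) (f := f) χ (fun s => z (τ s)) s e)
    refine mul_le_mul_of_nonneg_right ?_ (expect_nonneg fun J _ => ?_)
    · exact div_le_div_of_nonneg_right (by linarith) hm.le
    · split_ifs
      · exact hΦ0 _ _ _
      · exact le_rfl
  have hsplit : 𝔼 χ, 𝔼 J, 𝔼 τ, (if ok χ J τ then Φ χ J τ else 0) ≤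
      𝔼 χ, 𝔼 J, 𝔼 τ, (if ok χ J τ ∧ ¬ inR χ J τ then Φ χ J τ else 0) +
        𝔼 χ, 𝔼 J, 𝔼 τ, (if inR χ J τ then Φ χ J τ else 0) := by
    simp only [← expect_add_distrib]
    refine expect_le_expect fun χ _ => expect_le_expect fun J _ => expect_le_expect fun τ _ => ?_
    have := hΦ0 χ J τ
    by_cases h1 : ok χ J τ <;> by_cases h2 : inR χ J τ <;> simp [h1, h2, this]
  have hjoin : 𝔼 χ, 𝔼 J, 𝔼 τ, (if χ e = s then Φ χ J τ else 0) +
      𝔼 χ, 𝔼 J, 𝔼 τ, (if inR χ J τ ∧ J s = χ e then Φ χ J τ else 0) ≤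
      𝔼 χ, 𝔼 J, 𝔼 τ, (if e ∈ available M f χ J (fun s => z (τ s)) s then Φ χ J τ else 0) := by
    simp only [← expect_add_distrib]
    refine expect_le_expect fun χ _ => expect_le_expect fun J _ => expect_le_expect fun τ _ => ?_
    by_cases h1 : χ e = s
    · have h2 : ¬ (inR χ J τ ∧ J s = χ e) := fun h => by
        have := (process_array s s.2.le h.1).2
        rw [h1] at this
        exact lt_irrefl _ this
      have h3 : e ∈ available M f χ J (fun s => z (τ s)) s :=
        mem_union_left _ (mem_slotSet.2 h1)
      rw [if_pos h1, if_neg h2, if_pos h3, add_zero]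
    · rw [if_neg h1, zero_add]
      by_cases h2 : inR χ J τ ∧ J s = χ e
      · have h3 : e ∈ available M f χ J (fun s => z (τ s)) s := by
          refine mem_union_right _ (Option.mem_toFinset.2 ?_)
          rw [h2.2]
          exact h2.1
        rw [if_pos h2, if_pos h3]
      · rw [if_neg h2]
        split_ifs
        · exact hΦ0 _ _ _
        · exact le_rfl
  have h := mul_le_mul_of_nonneg_left hsplit (div_nonneg hη1 hm.le)
  rw [mul_add] at h
  exact (h.trans (add_le_add harr hsamp)).trans hjoin

/-- The items of `T` that have not been missed before the slot `s`. -/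
noncomputable def notMissed (M : Matroid α) (f : Finset α → ℝ) (χ : α → Fin m)
    (J : Fin m → Fin m) (ζ : Fin m → List α → Finset α → Bool) (s : Fin m) (T : Finset α) :
    Finset α :=
  T.filter fun e => χ e < s → success M f χ J ζ (χ e) = true

/-- The expected increase of the value of the solution in one slot. The gain in the slot is at
least the sum of the surpluses of the available items of `T`; these items are available with
probability about `1 / m`, and the gains exceed the surpluses by at most the gain in the slot, which
is paid for by the factor on the right. -/
theorem expect_value_succ (hmono : Monotone f) (hf : IsSubmodular f) (h0 : ∀ S, 0 ≤ f S)
    (hz : ∀ S B, 𝔼 ω, (if z ω S B = true then (0 : ℝ) else 1) ≤ η) (hη0 : 0 ≤ η) (hη : η ≤ 1)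
    {T : Finset α} (hT : M.Indep (T : Set α)) {k : ℕ} (hk : #T ≤ k) (s : Fin m) :
    (1 - η) / m * ((1 - η) * f T -
        2 * 𝔼 χ : α → Fin m, 𝔼 J : Fin m → Fin m, 𝔼 τ : Fin m → Ω,
          f (process M f χ J (fun s => z (τ s)) s).1.toFinset) ≤
      (1 + (1 - η) / m * k) *
        (𝔼 χ : α → Fin m, 𝔼 J : Fin m → Fin m, 𝔼 τ : Fin m → Ω,
          f (process M f χ J (fun s => z (τ s)) (s + 1)).1.toFinset -
        𝔼 χ : α → Fin m, 𝔼 J : Fin m → Fin m, 𝔼 τ : Fin m → Ω,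
          f (process M f χ J (fun s => z (τ s)) s).1.toFinset) := by
  have : Nonempty (Fin m) := ⟨s⟩
  have hm : (0 : ℝ) < m := by exact_mod_cast s.pos
  set q := (1 - η) / m with hq
  have hq0 : 0 ≤ q := div_nonneg (by linarith) hm.le
  -- The gain in this slot.
  set Γ : (α → Fin m) → (Fin m → Fin m) → (Fin m → Ω) → ℝ := fun χ J τ =>
    ((available M f χ J (fun s => z (τ s)) s).sup
      (gainOf M f (process M f χ J (fun s => z (τ s)) s).1) : ℝ≥0) with hΓ
  set V : (α → Fin m) → (Fin m → Fin m) → (Fin m → Ω) → ℝ := fun χ J τ =>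
    f (process M f χ J (fun s => z (τ s)) s).1.toFinset with hV
  have hsucc : 𝔼 χ : α → Fin m, 𝔼 J : Fin m → Fin m, 𝔼 τ : Fin m → Ω,
      f (process M f χ J (fun s => z (τ s)) (s + 1)).1.toFinset =
      𝔼 χ, 𝔼 J, 𝔼 τ, V χ J τ + 𝔼 χ, 𝔼 J, 𝔼 τ, Γ χ J τ := by
    simp only [← expect_add_distrib]
    refine expect_congr rfl fun χ _ => expect_congr rfl fun J _ => expect_congr rfl fun τ _ => ?_
    exact value_process_succ hmono s
  rw [hsucc, add_sub_cancel_left]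
  set Φ : (α → Fin m) → (Fin m → Fin m) → (Fin m → Ω) → α → ℝ := fun χ J τ e =>
    (surplus M f χ J (fun s => z (τ s)) s e : ℝ) with hΦ
  -- The surpluses of the available items add up to at most the gain.
  have h1 : ∑ e ∈ T, q * 𝔼 χ, 𝔼 J, 𝔼 τ,
      (if χ e < s → success M f χ J (fun s => z (τ s)) (χ e) = true then Φ χ J τ e else 0) ≤
      𝔼 χ, 𝔼 J, 𝔼 τ, Γ χ J τ := by
    refine (sum_le_sum fun e _ => expect_surplus_le (M := M) (f := f) hz hη0 hη s e).trans ?_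
    simp only [← expect_sum_comm]
    refine expect_le_expect fun χ _ => expect_le_expect fun J _ => expect_le_expect fun τ _ => ?_
    have := sum_sub_sup_erase_le (gainOf M f (process M f χ J (fun s => z (τ s)) s).1)
      (available M f χ J (fun s => z (τ s)) s) T
    rw [← NNReal.coe_le_coe, NNReal.coe_sum] at this
    refine le_trans (le_of_eq ?_) this
    refine sum_congr rfl fun e _ => ?_
    split_ifs <;> rfl
  -- By the local search inequality, the surpluses are large.
  have h2 : ∀ χ J τ, f (notMissed M f χ J (fun s => z (τ s)) s T) - 2 * V χ J τ - k * Γ χ J τ ≤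
      ∑ e ∈ T, (if χ e < s → success M f χ J (fun s => z (τ s)) (χ e) = true
        then Φ χ J τ e else 0) := by
    intro χ J τ
    have hsub : notMissed M f χ J (fun s => z (τ s)) s T ⊆ T := filter_subset _ _
    have hls := sub_two_mul_le_sum_gainOf hmono hf h0
      (process_solution_indep (M := M) (χ := χ) (J := J) (ζ := fun s => z (τ s)) hmono s s.2.le).2
      (hT.subset (by exact_mod_cast hsub))
    have hterm : ∀ e ∈ notMissed M f χ J (fun s => z (τ s)) s T,
        (gainOf M f (process M f χ J (fun s => z (τ s)) s).1 e : ℝ) ≤ Φ χ J τ e + Γ χ J τ := by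
      intro e _
      have h3 : gainOf M f (process M f χ J (fun s => z (τ s)) s).1 e ≤
          surplus M f χ J (fun s => z (τ s)) s e + (available M f χ J (fun s => z (τ s)) s).sup
            (gainOf M f (process M f χ J (fun s => z (τ s)) s).1) :=
        le_tsub_add.trans (add_le_add_right (sup_mono (erase_subset _ _)) _)
      exact_mod_cast h3
    have hsum := sum_le_sum hterm
    rw [sum_add_distrib, sum_const, nsmul_eq_mul] at hsum
    have hΓ0 : 0 ≤ Γ χ J τ := NNReal.coe_nonneg _
    have hcard : (#(notMissed M f χ J (fun s => z (τ s)) s T) : ℝ) * Γ χ J τ ≤ k * Γ χ J τ :=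
      mul_le_mul_of_nonneg_right (by exact_mod_cast (card_le_card hsub).trans hk) hΓ0
    rw [← sum_filter]
    change _ ≤ ∑ e ∈ notMissed M f χ J (fun s => z (τ s)) s T, Φ χ J τ e
    change f _ - 2 * V χ J τ ≤ _ at hls
    linarith
  -- On average, little of the value of `T` is missed.
  have h3 : (1 - η) * f T ≤ 𝔼 χ : α → Fin m, 𝔼 J : Fin m → Fin m, 𝔼 τ : Fin m → Ω,
      f (notMissed M f χ J (fun s => z (τ s)) s T) := by
    refine le_expect univ_nonempty fun χ _ => le_expect univ_nonempty fun J _ => ?_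
    have := hf.one_sub_mul_expect_le (Ω := Fin m → Ω) hmono h0 hη0 (fun _ => T)
      (fun τ => notMissed M f χ J (fun s => z (τ s)) s T) (fun τ => filter_subset _ _) (by
        intro x w hw
        by_cases hx : x ∈ T
        swap
        · simp [hx]
        simp only [hx, true_and, if_true, Fintype.expect_const]
        refine le_trans ?_ (mul_le_mul_of_nonneg_right
          (expect_failure_le (M := M) (f := f) χ J hz (χ x)) (hw T))
        rw [expect_mul]
        refine expect_le_expect fun τ _ => ?_
        by_cases hs : success M f χ J (fun s => z (τ s)) (χ x) = true
        · simp [notMissed, hx, hs]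
        · rw [if_neg hs, one_mul]
          split_ifs
          · exact hw T
          · exact le_rfl)
    rwa [Fintype.expect_const] at this
  have h4 : 𝔼 χ, 𝔼 J, 𝔼 τ, (f (notMissed M f χ J (fun s => z (τ s)) s T) - 2 * V χ J τ -
      k * Γ χ J τ) ≤ 𝔼 χ, 𝔼 J, 𝔼 τ,
      ∑ e ∈ T, (if χ e < s → success M f χ J (fun s => z (τ s)) (χ e) = true
        then Φ χ J τ e else 0) :=
    expect_le_expect fun χ _ => expect_le_expect fun J _ => expect_le_expect fun τ _ => h2 χ J τ
  simp only [expect_sub_distrib, expect_sum_comm, ← mul_expect] at h4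
  rw [← mul_sum] at h1
  have h5 := (mul_le_mul_of_nonneg_left h4 hq0).trans h1
  have h6 := mul_le_mul_of_nonneg_left h3 hq0
  linarith

end

end MatroidShortlist

/-! ### The competitive ratio -/

/-- A sequence that moves in each step by at least the fraction `2 r` of its distance to `D / 2`. -/
theorem half_mul_one_sub_pow_le {a : ℕ → ℝ} {D r : ℝ} {m : ℕ} (h0 : 0 ≤ a 0) (hr : 2 * r ≤ 1)
    (h : ∀ t < m, r * (D - 2 * a t) ≤ a (t + 1) - a t) :
    D / 2 * (1 - (1 - 2 * r) ^ m) ≤ a m := by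
  have key : ∀ t ≤ m, D / 2 - a t ≤ (1 - 2 * r) ^ t * (D / 2) := by
    intro t
    induction t with
    | zero => intro _; simpa using h0
    | succ t ih =>
      intro ht
      have h1 := mul_le_mul_of_nonneg_left (ih (by omega)) (by linarith : 0 ≤ 1 - 2 * r)
      have h2 := h t ht
      rw [pow_succ']
      linarith
  have := key m le_rfl
  linarith

/-- The progress rate `r` of one slot, for `m = k β` slots: the factor `1 - 2 r` per slot
accumulates to about `exp (-2)`. -/
theorem one_sub_pow_le_exp {η : ℝ} (hη0 : 0 ≤ η) (hη : η ≤ 1) {k β : ℕ} (hk : 1 ≤ k) (hβ : 2 ≤ β)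
    {r : ℝ} (hr : r = (1 - η) / (k * β : ℕ) / (1 + (1 - η) / (k * β : ℕ) * k)) :
    2 * r ≤ 1 ∧ (1 - 2 * r) ^ (k * β) ≤ Real.exp (-2 + 2 * (η + 1 / β)) := by
  have hk' : (1 : ℝ) ≤ k := by exact_mod_cast hk
  have hβ' : (2 : ℝ) ≤ β := by exact_mod_cast hβ
  have hm : (2 : ℝ) ≤ (k * β : ℕ) := by push_cast; nlinarith
  have hq0 : 0 ≤ (1 - η) / (k * β : ℕ) := div_nonneg (by linarith) (by linarith)
  have hden : 1 ≤ 1 + (1 - η) / (k * β : ℕ) * k :=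
    le_add_of_nonneg_right (mul_nonneg hq0 (by linarith))
  have h1 : 2 * r ≤ 1 := by
    have e1 : r ≤ (1 - η) / (k * β : ℕ) := by
      rw [hr]
      exact div_le_self hq0 hden
    have e2 : (1 - η) / (k * β : ℕ) ≤ 1 / 2 :=
      div_le_div₀ zero_le_one (by linarith) two_pos hm
    linarith
  refine ⟨h1, ?_⟩
  have h2 : 1 - (η + 1 / β) ≤ r * (k * β : ℕ) := by
    have e1 : r * (k * β : ℕ) = (1 - η) / (1 + (1 - η) / β) := by
      rw [hr]
      push_cast
      have : (1 : ℝ) + (1 - η) / (k * β) * k = 1 + (1 - η) / β := by field_simp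
      rw [this]
      field_simp
    have e2 : 0 < 1 + (1 - η) / β := by
      have : 0 ≤ (1 - η) / (β : ℝ) := div_nonneg (by linarith) (by linarith)
      linarith
    rw [e1, le_div_iff₀ e2]
    have e3 : (1 - η) / (β : ℝ) = (1 - η) * (1 / β) := by ring
    rw [e3]
    have e4 : 0 ≤ 1 / (β : ℝ) := by positivity
    nlinarith [mul_nonneg (mul_nonneg hη0 e4) (by linarith : 0 ≤ 1 - η),
      mul_nonneg hη0 e4, mul_nonneg (mul_nonneg e4 e4) (by linarith : 0 ≤ 1 - η)]
  calc (1 - 2 * r) ^ (k * β) ≤ Real.exp (-(2 * r)) ^ (k * β) :=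
        pow_le_pow_left₀ (by linarith) (Real.one_sub_le_exp_neg _) _
    _ = Real.exp (-(2 * (r * (k * β : ℕ)))) := by
        rw [← Real.exp_nat_mul]
        congr 1
        ring
    _ ≤ _ := Real.exp_le_exp.2 (by linarith)

/-- The numerical estimate of the ratio, where `3 ε / 8` is the failure probability of the online
max algorithm and `x` is the sum of this probability and of the loss from the finite number of
slots. -/
theorem ratio_le {ε x : ℝ} (hε0 : 0 ≤ ε) (hε : ε ≤ 1) (hx0 : 0 ≤ x) (hx : x ≤ 77 / 200 * ε) :
    1 - 1 / Real.exp 1 ^ 2 - ε ≤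
      (1 - 3 / 8 * ε) ^ 2 * (1 - Real.exp (-2 + 2 * x)) := by
  set E := 1 / Real.exp 1 ^ 2 with hE
  have hE0 : 0 ≤ E := by positivity
  have hE1 : E ≤ 3 / 20 := by
    rw [hE, div_le_iff₀ (by positivity)]
    nlinarith [Real.exp_one_gt_d9]
  have hexp : Real.exp (-2 + 2 * x) = E * Real.exp (2 * x) := by
    rw [Real.exp_add, hE, Real.exp_neg, ← Real.exp_nat_mul]
    norm_num
  have h1 : Real.exp (2 * x) ≤ 1 + 2 * x + (2 * x) ^ 2 := by
    have := (abs_le.1 (Real.abs_exp_sub_one_sub_id_le (x := 2 * x)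
      (by rw [abs_of_nonneg (by linarith)]; linarith))).2
    linarith
  have h2 : 2 * x + (2 * x) ^ 2 ≤ 3 / 2 * ε := by nlinarith
  have h3 : E * (2 * x + (2 * x) ^ 2) ≤ 3 / 20 * (3 / 2 * ε) :=
    mul_le_mul hE1 h2 (by positivity) (by norm_num)
  have h4 : 1 - E - 9 / 40 * ε ≤ 1 - Real.exp (-2 + 2 * x) := by
    rw [hexp]
    nlinarith [mul_le_mul_of_nonneg_left h1 hE0]
  have h5 : 1 - Real.exp (-2 + 2 * x) ≤ 1 := by linarith [Real.exp_pos (-2 + 2 * x)]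
  have h6 : 1 - 3 / 4 * ε ≤ (1 - 3 / 8 * ε) ^ 2 := by nlinarith
  have h7 : 0 ≤ 1 - Real.exp (-2 + 2 * x) := by linarith
  have h8 := mul_le_mul_of_nonneg_right h6 h7
  nlinarith

namespace MatroidShortlist

/-- Random positions for the slots and a random arrival order amount to a random slot for each item
and an independent random order of the items of each slot. -/
theorem expect_coins_eq {α : Type} [Fintype α] [DecidableEq α] {m : ℕ}
    (F : (Fin m → List α) → (Fin m → Fin m) → ℝ) :
    𝔼 ω : (Fin (Fintype.card α) ≃ α) × Coins (Fintype.card α) m,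
        F (fun j => (blocks ω.2.1 j).map ω.1) ω.2.2 =
      𝔼 χ : α → Fin m, 𝔼 J : Fin m → Fin m, 𝔼 τ : Fin m → (Fin (Fintype.card α) ≃ α),
        F (fun j => slotItems χ (τ j) j) J := by
  have h1 : ∀ σ : Fin (Fintype.card α) ≃ α, 𝔼 c : Coins (Fintype.card α) m,
      F (fun j => (blocks c.1 j).map σ) c.2 =
      𝔼 J : Fin m → Fin m, 𝔼 b : Fin (Fintype.card α) → Fin m,
        F (fun j => (blocks b j).map σ) J := fun σ => by
    rw [expect_comm]
    exact expect_prod fun c : Coins (Fintype.card α) m => F (fun j => (blocks c.1 j).map σ) c.2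
  have h2 : 𝔼 ω : (Fin (Fintype.card α) ≃ α) × Coins (Fintype.card α) m,
      F (fun j => (blocks ω.2.1 j).map ω.1) ω.2.2 =
      𝔼 σ : Fin (Fintype.card α) ≃ α, 𝔼 c : Coins (Fintype.card α) m,
        F (fun j => (blocks c.1 j).map σ) c.2 :=
    expect_prod fun ω : (Fin (Fintype.card α) ≃ α) × Coins (Fintype.card α) m =>
      F (fun j => (blocks ω.2.1 j).map ω.1) ω.2.2
  rw [h2]
  simp only [h1]
  rw [expect_comm]
  simp only [fun J => expect_blocks_eq_expect_slotItems (α := α) (F := fun y => F y J)]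
  rw [expect_comm]

section

variable {α : Type} [LinearOrder α] [Fintype α] {M : Matroid α} {f : Finset α → ℝ}

/-- The expected value of the output when the outcomes of the online max algorithm in the slots
are independent and each of them is a failure with probability at most `η`. -/
theorem le_expect_keptItems {Ω : Type} [Fintype Ω] [Nonempty Ω]
    {z : Ω → List α → Finset α → Bool} {η : ℝ}
    (hmono : Monotone f) (hf : IsSubmodular f) (h0 : ∀ S, 0 ≤ f S)
    (hz : ∀ S B, 𝔼 ω, (if z ω S B = true then (0 : ℝ) else 1) ≤ η) (hη0 : 0 ≤ η) (hη : η ≤ 1)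
    {T : Finset α} (hT : M.Indep (T : Set α)) {k β : ℕ} (hk : #T ≤ k) (hk1 : 1 ≤ k)
    (hβ : 2 ≤ β) :
    1 / 2 * ((1 - η) ^ 2 * (1 - Real.exp (-2 + 2 * (η + 1 / β)))) * f T ≤
      𝔼 χ : α → Fin (k * β), 𝔼 J : Fin (k * β) → Fin (k * β), 𝔼 τ : Fin (k * β) → Ω,
        f (keptItems (process M f χ J (fun s => z (τ s)) (k * β))) := by
  have hm : 0 < k * β := by positivity
  have : Nonempty (Fin (k * β)) := ⟨⟨0, hm⟩⟩
  set a : ℕ → ℝ := fun t =>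
    𝔼 χ : α → Fin (k * β), 𝔼 J : Fin (k * β) → Fin (k * β), 𝔼 τ : Fin (k * β) → Ω,
      f (process M f χ J (fun s => z (τ s)) t).1.toFinset with ha
  have h1 : (1 - η) * a (k * β) ≤
      𝔼 χ : α → Fin (k * β), 𝔼 J : Fin (k * β) → Fin (k * β), 𝔼 τ : Fin (k * β) → Ω,
        f (keptItems (process M f χ J (fun s => z (τ s)) (k * β))) := by
    simp only [ha, mul_expect]
    refine expect_le_expect fun χ _ => expect_le_expect fun J _ => ?_
    rw [← mul_expect]
    exact hf.one_sub_mul_expect_le hmono h0 hη0 _ _ (fun τ => filter_subset _ _)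
      fun x w hw => expect_not_kept_le χ J hmono hz x w hw
  set q := (1 - η) / (k * β : ℕ) with hq
  have hq0 : 0 ≤ q := div_nonneg (by linarith) (Nat.cast_nonneg _)
  have hden : 0 < 1 + q * k := by positivity
  obtain ⟨hr, hpow⟩ := one_sub_pow_le_exp hη0 hη hk1 hβ (r := q / (1 + q * k)) rfl
  have h2 : (1 - η) * f T / 2 * (1 - (1 - 2 * (q / (1 + q * k))) ^ (k * β)) ≤ a (k * β) := by
    refine half_mul_one_sub_pow_le ?_ hr fun t ht => ?_
    · exact expect_nonneg fun _ _ => expect_nonneg fun _ _ => expect_nonneg fun _ _ => h0 _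
    · rw [div_mul_eq_mul_div, div_le_iff₀ hden, mul_comm (a (t + 1) - a t)]
      exact expect_value_succ hmono hf h0 hz hη0 hη hT hk ⟨t, ht⟩
  refine le_trans ?_ h1
  have h3 : (1 - η) * f T / 2 * (1 - Real.exp (-2 + 2 * (η + 1 / β))) ≤ a (k * β) :=
    le_trans (mul_le_mul_of_nonneg_left (by linarith)
      (div_nonneg (mul_nonneg (by linarith) (h0 T)) two_pos.le)) h2
  refine le_trans (le_of_eq ?_) (mul_le_mul_of_nonneg_left h3 (by linarith : 0 ≤ 1 - η))
  ring

theorem expect_output_eq {k β : ℕ} {ε : ℝ} (hmono : Monotone f)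
    (hk : ∀ S : Finset α, M.Indep (S : Set α) → #S ≤ k) (hδ : 0 ≤ Real.log (2 / (ε / 2))) :
    𝔼 ω : (Fin (Fintype.card α) ≃ α) × Coins (Fintype.card α) (k * β),
        f (output M f k β ε ω.1 ω.2) =
      𝔼 χ : α → Fin (k * β), 𝔼 J : Fin (k * β) → Fin (k * β),
        𝔼 τ : Fin (k * β) → (Fin (Fintype.card α) ≃ α),
          f (keptItems (process M f χ J (outcome M f (ε / 2) τ) (k * β))) := by
  have h1 : ∀ ω : (Fin (Fintype.card α) ≃ α) × Coins (Fintype.card α) (k * β),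
      f (output M f k β ε ω.1 ω.2) =
        f (outputOf M f (ε / 2) (fun j => (blocks ω.2.1 j).map ω.1) ω.2.2) := fun ω => by
    rw [(execute_spec hmono hk hδ ω.1 ω.2).1]
  simp only [← outputOf_eq_keptItems]
  rw [← expect_coins_eq fun y J => f (outputOf M f (ε / 2) y J)]
  exact expect_congr rfl fun ω _ => h1 ω

open Classical in
theorem expect_outcome_le (S : List α) (B : Finset α) {δ : ℝ} (h0 : 0 < δ) (h1 : δ ≤ 1 / 2) :
    𝔼 τ : Fin (Fintype.card α) ≃ α,
      (if decide (¬ Misses M f S (#B * δ / 2) (4 * Real.log (2 / δ)) (orderOf τ B)) = true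
        then (0 : ℝ) else 1) ≤ 3 / 4 * δ := by
  refine le_trans (le_of_eq (expect_congr rfl fun τ _ => ?_))
    (expect_misses_le (M := M) (f := f) S h0 h1 B)
  by_cases h : Misses M f S (#B * δ / 2) (4 * Real.log (2 / δ)) (orderOf τ B) <;> simp [h]

end

open Classical in
theorem le_maxIndepValue {α : Type} {M : Matroid α} {f : Finset α → ℝ} {S A : Finset α}
    (hS : M.Indep (S : Set α)) (h : S ⊆ A) : f S ≤ maxIndepValue M f A :=
  Finset.le_sup' f (mem_filter.2 ⟨mem_powerset.2 h, hS⟩)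

open Classical in
theorem exists_eq_maxIndepValue {α : Type} (M : Matroid α) (f : Finset α → ℝ) (A : Finset α) :
    ∃ S : Finset α, M.Indep (S : Set α) ∧ f S = maxIndepValue M f A := by
  obtain ⟨S, hS, h⟩ := Finset.exists_mem_eq_sup'
    (s := A.powerset.filter fun S : Finset α => M.Indep (S : Set α)) ⟨∅, by simp⟩ f
  exact ⟨S, (mem_filter.1 hS).2, h.symm⟩

theorem card_le_of_eRank_eq {α : Type} {M : Matroid α} {k : ℕ} (h : M.eRank = k) {S : Finset α}
    (hS : M.Indep (S : Set α)) : #S ≤ k := by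
  have := hS.encard_le_eRank
  rw [h, Set.encard_coe_eq_coe_finsetCard] at this
  exact_mod_cast this

theorem le_card_of_eRank_eq {α : Type} [Fintype α] {M : Matroid α} {k : ℕ} (h : M.eRank = k) :
    k ≤ Fintype.card α := by
  have h1 : M.eRank ≤ (Set.univ : Set α).encard :=
    (Matroid.eRank_le_encard_ground M).trans (Set.encard_le_encard (Set.subset_univ _))
  rw [h, Set.encard_univ, ENat.card_eq_coe_fintype_card] at h1
  exact_mod_cast h1

theorem shortlist_size_le {ε : ℝ} (h0 : 0 < ε) (h1 : ε ≤ 1) {k β : ℕ} (hβ : (β : ℝ) ≤ 101 / ε) :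
    ((k * β : ℕ) : ℝ) * (4 * Real.log (2 / (ε / 2)) + 1) ≤
      1010 * (k / ε) * Real.log (2 / ε) := by
  have e1 : 2 / (ε / 2) = 2 * (2 / ε) := by field_simp
  have e2 : Real.log (2 / (ε / 2)) = Real.log 2 + Real.log (2 / ε) := by
    rw [e1, Real.log_mul (by norm_num) (by positivity)]
  have e3 : Real.log 2 ≤ Real.log (2 / ε) :=
    Real.log_le_log two_pos ((le_div_iff₀ h0).2 (by linarith))
  have e4 := Real.log_two_gt_d9
  -- `log (4 / ε) ≤ 2 log (2 / ε)`, and `1 ≤ 2 log 2`.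
  have h2 : 4 * Real.log (2 / (ε / 2)) + 1 ≤ 10 * Real.log (2 / ε) := by linarith
  have hk : (0 : ℝ) ≤ k := Nat.cast_nonneg k
  push_cast
  calc (k : ℝ) * β * (4 * Real.log (2 / (ε / 2)) + 1)
      ≤ k * (101 / ε) * (10 * Real.log (2 / ε)) :=
        mul_le_mul (mul_le_mul_of_nonneg_left hβ hk) h2 (by linarith) (by positivity)
    _ = _ := by ring

theorem running_time_le {n k β t : ℕ} (hk : 1 ≤ k) (hn : k ≤ n)
    (h : t ≤ n + 2 * (k * β) + (k * β) * (5 * k + 10) + n * (4 * k + 8) + k * (k * β)) :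
    (t : ℝ) ≤ ((13 + 18 * β : ℕ) : ℝ) * (n * k) := by
  refine le_trans (Nat.cast_le.2 h) ?_
  have h1 : n ≤ n * k := Nat.le_mul_of_pos_right n hk
  have h2 : k * β ≤ n * k * β := by
    refine Nat.mul_le_mul_right _ ?_
    nlinarith
  have h3 : k * k * β ≤ n * k * β :=
    Nat.mul_le_mul_right _ (Nat.mul_le_mul_right _ hn)
  have : n + 2 * (k * β) + (k * β) * (5 * k + 10) + n * (4 * k + 8) + k * (k * β) ≤
      (13 + 18 * β) * (n * k) := by
    nlinarith
  exact_mod_cast this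

end MatroidShortlist

open MatroidShortlist in
theorem mainTheorem2 :
    ∃ C : ℝ, ∀ ε : ℝ, 0 < ε → ε ≤ 1 → ∃ (β : ℕ) (K : ℝ), 1 ≤ β ∧
      ∀ (α : Type) [Fintype α] [LinearOrder α] (M : Matroid α) (k : ℕ) (f : Finset α → ℝ),
        M.eRank = k → 1 ≤ k → Monotone f → IsSubmodular f → (∀ S, 0 ≤ f S) →
        (∀ (σ : Fin (Fintype.card α) ≃ α)
            (c : MatroidShortlist.Coins (Fintype.card α) (k * β)),
          ((MatroidShortlist.shortlist M f k β ε σ c).card : ℝ) ≤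
              C * (k / ε) * Real.log (2 / ε) ∧
            (MatroidShortlist.runningTime M f k β ε σ c : ℝ) ≤ K * (Fintype.card α * k) ∧
            MatroidShortlist.output M f k β ε σ c ⊆ MatroidShortlist.shortlist M f k β ε σ c ∧
            M.Indep (MatroidShortlist.output M f k β ε σ c : Set α)) ∧
        1 / 2 * (1 - 1 / Real.exp 1 ^ 2 - ε) * maxIndepValue M f Finset.univ ≤
          𝔼 ω : (Fin (Fintype.card α) ≃ α) ×
              MatroidShortlist.Coins (Fintype.card α) (k * β),
            f (MatroidShortlist.output M f k β ε ω.1 ω.2) ∧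
        1 / 2 * (1 - 1 / Real.exp 1 ^ 2 - ε) * maxIndepValue M f Finset.univ ≤
          𝔼 ω : (Fin (Fintype.card α) ≃ α) ×
              MatroidShortlist.Coins (Fintype.card α) (k * β),
            maxIndepValue M f (MatroidShortlist.shortlist M f k β ε ω.1 ω.2) := by
  refine ⟨1010, fun ε hε0 hε1 => ?_⟩
  -- About `100 / ε` slots per unit of rank make the loss from the discretization negligible.
  have hβ100 : 100 / ε ≤ (⌈100 / ε⌉₊ : ℝ) := Nat.le_ceil _
  have hβ101 : (⌈100 / ε⌉₊ : ℝ) ≤ 101 / ε := by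
    refine (Nat.ceil_lt_add_one (by positivity)).le.trans ?_
    have : 1 ≤ 1 / ε := (one_le_div hε0).2 hε1
    have e : 101 / ε = 100 / ε + 1 / ε := by ring
    linarith
  set β := ⌈100 / ε⌉₊
  have h100 : 100 ≤ 100 / ε := (le_div_iff₀ hε0).2 (by linarith)
  have hβ2 : 2 ≤ β := by
    have : (2 : ℝ) ≤ β := by linarith
    exact_mod_cast this
  refine ⟨β, (13 + 18 * β : ℕ), by omega, ?_⟩
  intro α _ _ M k f hrank hk1 hmono hf h0
  have hk : ∀ S : Finset α, M.Indep (S : Set α) → #S ≤ k := fun S => card_le_of_eRank_eq hrank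
  have hδ : 0 ≤ Real.log (2 / (ε / 2)) :=
    Real.log_nonneg ((le_div_iff₀ (by positivity)).2 (by linarith))
  have hspec := execute_spec (M := M) (f := f) (β := β) hmono hk hδ
  have hvalue : 1 / 2 * (1 - 1 / Real.exp 1 ^ 2 - ε) * maxIndepValue M f Finset.univ ≤
      𝔼 ω : (Fin (Fintype.card α) ≃ α) × Coins (Fintype.card α) (k * β),
        f (output M f k β ε ω.1 ω.2) := by
    classical
    obtain ⟨T, hT, hTv⟩ := exists_eq_maxIndepValue M f Finset.univ
    rw [expect_output_eq hmono hk hδ, ← hTv]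
    have : Nonempty (Fin (Fintype.card α) ≃ α) := ⟨(Fintype.equivFin α).symm⟩
    refine le_trans ?_ (le_expect_keptItems (η := 3 / 4 * (ε / 2)) hmono hf h0
      (fun S B => expect_outcome_le (M := M) (f := f) S B (by positivity) (by linarith))
      (by positivity) (by linarith) hT (hk T hT) hk1 hβ2)
    refine mul_le_mul_of_nonneg_right (mul_le_mul_of_nonneg_left ?_ (by norm_num)) (h0 T)
    have hx : (1 : ℝ) / β ≤ ε / 100 := by
      rw [div_le_div_iff₀ (by linarith) (by norm_num)]
      have := (div_le_iff₀ hε0).1 hβ100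
      linarith
    have hη : 3 / 4 * (ε / 2) = 3 / 8 * ε := by ring
    rw [hη]
    exact ratio_le hε0.le hε1 (by positivity) (by linarith)
  refine ⟨fun σ c => ?_, hvalue, hvalue.trans (expect_le_expect fun ω _ => ?_)⟩
  · obtain ⟨-, h1, h2, h3, h4⟩ := hspec σ c
    exact ⟨h1.trans (shortlist_size_le hε0 hε1 hβ101),
      running_time_le hk1 (le_card_of_eRank_eq hrank) h2, h3, h4⟩
  · obtain ⟨-, -, -, h3, h4⟩ := hspec ω.1 ω.2
    exact le_maxIndepValue h4 h3
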